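/- Let $G$ be a bipartite graph (vertices coloured black and white) with a fixed locally finite embedding in the plane $\mathbb{C}$, edges being drawn as simple polygonal arcs that meet only at common endpoints, and with positive edge weights $w(e)$. Call $\tau\in\mathbb{C}$ a period if translation by $\tau$ preserves the embedded graph, the colours of the vertices and the weights; assume that $G$ has two periods that are linearly independent over $\mathbb{R}$, and that $0$ lies in a face of $G$ (not on an edge). A dimer configuration is a set $M$ of edges such that every vertex is an endpoint of exactly one edge of $M$; the space of dimer configurations carries the $\sigma$-algebra generated by the events $\{e\in M\}$. For $R>0$ and a dimer configuration $m$, let $\pi(R,m)$ be the probability measure on the finitely many dimer configurations $N$ that agree with $m$ on all edges not contained in the open ball $B(0,R)$, with $\pi(R,m)(N)\propto\prod_{e\in N,\ e\subset B(0,R)}w(e)$. A probability measure $\mu$ on dimer configurations is an infinite-volume Gibbs measure if, for every $R>0$, the conditional law under $\mu$ of $M$ given the edges of $M$ not contained in $B(0,R)$ is $\pi(R,M)$. For $N$ in the support of $\pi(R,m)$, let $h_N$ be the height function of $N$, with reference flow $\mathbf 1_{m}$ and height fixed outside $B(0,R)$: the function on the faces of $G$ that vanishes at all points outside $B(0,R)$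 and increases by $\mathbf 1_{e\in N}-\mathbf 1_{e\in m}$ whenever an edge $e$ is crossed from its right to its left, as seen from its black towards its white endpoint. (Another reference flow, or another value of the height outside, would change $h_N(0)$ only by a constant depending on $m$.) The measure $\mu$ has the spread-out property if for every $\varepsilon>0$ there is $R>0$ such that \[ \mathbb{P}_\mu\Big[\forall x\in\mathbb{R},\ \mathbb{P}_{N\sim\pi(R,M)}\big[h_N(0)\in(x,x+1)\big]\le\varepsilon\Big]>1-\varepsilon . \] Then every infinite-volume Gibbs measure $\mu$ on the dimer configurations of $G$ that has the spread-out property is translation invariant: for every period $\tau$, the image of $\mu$ under the map $M\mapsto M+\tau$ is $\mu$. -/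

import Mathlib

open MeasureTheory ProbabilityTheory Filter Topology

/-- The oriented straight pieces of the polygonal line through the points of the list `e`. -/
def polySegments (e : List ℂ) : Set (ℂ × ℂ) := {s | [s.1, s.2] <:+: e}

/-- The polygonal line through the points of `e`, as a subset of the plane. -/
def polyCarrier (e : List ℂ) : Set ℂ := ⋃ s ∈ polySegments e, segment ℝ s.1 s.2

/-- The polygonal line through the points of `e` is a simple (non self-intersecting) arc. -/
structure IsPolyArc (e : List ℂ) : Prop where
  two_le : 2 ≤ e.length
  nodup : e.Nodup
  simple : ∀ s ∈ polySegments e, ∀ t ∈ polySegments e, s ≠ t →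
    segment ℝ s.1 s.2 ∩ segment ℝ t.1 t.2 ⊆ ({s.1, s.2} : Set ℂ) ∩ {t.1, t.2}

/-- `v` is the first or the last point of `e`. -/
def IsEndpoint (v : ℂ) (e : List ℂ) : Prop := e.head? = some v ∨ e.getLast? = some v

/-- The polygonal line `e` translated by `τ`. -/
def shiftEdge (τ : ℂ) (e : List ℂ) : List ℂ := e.map (· + τ)

/-- A bipartite graph with positive edge weights and a locally finite embedding in the plane.
An edge is a simple polygonal arc, listed from its black endpoint to its white endpoint
(so a straight edge is a list of length two, and multiple edges are possible). -/
structure PlaneBipartiteGraph where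
  black : Set ℂ
  white : Set ℂ
  edges : Set (List ℂ)
  weight : List ℂ → ℝ
  disjoint_colors : Disjoint black white
  arc : ∀ e ∈ edges, IsPolyArc e
  head_black : ∀ e ∈ edges, ∃ b ∈ black, e.head? = some b
  last_white : ∀ e ∈ edges, ∃ w ∈ white, e.getLast? = some w
  vertex_on_edge : ∀ e ∈ edges, ∀ v ∈ black ∪ white, v ∈ polyCarrier e → IsEndpoint v e
  edges_inter : ∀ e ∈ edges, ∀ e' ∈ edges, e ≠ e' →
    polyCarrier e ∩ polyCarrier e' ⊆ black ∪ white
  finite_vertices : ∀ R : ℝ, ((black ∪ white) ∩ Metric.closedBall 0 R).Finite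
  finite_edges : ∀ R : ℝ, {e ∈ edges | (polyCarrier e ∩ Metric.closedBall 0 R).Nonempty}.Finite
  weight_pos : ∀ e ∈ edges, 0 < weight e

namespace PlaneBipartiteGraph

/-- The union of all embedded edges; the faces are the components of its complement. -/
def carrier (G : PlaneBipartiteGraph) : Set ℂ := ⋃ e ∈ G.edges, polyCarrier e

/-- `M` is a dimer configuration (perfect matching): a set of edges such that each vertex is the
endpoint of exactly one of them. -/
def IsDimer (G : PlaneBipartiteGraph) (M : Set (List ℂ)) : Prop :=
  M ⊆ G.edges ∧ ∀ v ∈ G.black ∪ G.white, ∃! e, e ∈ M ∧ IsEndpoint v e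

/-- The space of dimer configurations. Its σ-algebra is the one induced by `Set (List ℂ)`, which is
generated by the events that a given edge belongs to the configuration. -/
abbrev Config (G : PlaneBipartiteGraph) : Type := {M : Set (List ℂ) // G.IsDimer M}

/-- The translation by `τ` preserves the graph, its embedding, the two colours and the weights. -/
structure IsPeriod (G : PlaneBipartiteGraph) (τ : ℂ) : Prop where
  black_iff : ∀ v, v + τ ∈ G.black ↔ v ∈ G.black
  white_iff : ∀ v, v + τ ∈ G.white ↔ v ∈ G.white
  edge_iff : ∀ e, shiftEdge τ e ∈ G.edges ↔ e ∈ G.edges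
  weight_eq : ∀ e ∈ G.edges, G.weight (shiftEdge τ e) = G.weight e

/-- The graph is periodic in two independent directions. -/
def IsBiperiodic (G : PlaneBipartiteGraph) : Prop :=
  ∃ u v : ℂ, LinearIndependent ℝ ![u, v] ∧ G.IsPeriod u ∧ G.IsPeriod v

theorem isEndpoint_shiftEdge (τ v : ℂ) (e : List ℂ) :
    IsEndpoint v (shiftEdge τ e) ↔ IsEndpoint (v - τ) e := by
  simp only [IsEndpoint, shiftEdge, List.head?_map, List.getLast?_map, Option.map_eq_some_iff,
    ← eq_sub_iff_add_eq]
  simp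

theorem shiftEdge_injective (τ : ℂ) : Function.Injective (shiftEdge τ) :=
  List.map_injective_iff.mpr (add_left_injective τ)

theorem IsPeriod.isDimer_image {G : PlaneBipartiteGraph} {τ : ℂ} (hτ : G.IsPeriod τ)
    {M : Set (List ℂ)} (hM : G.IsDimer M) : G.IsDimer (shiftEdge τ '' M) := by
  refine ⟨?_, ?_⟩
  · rintro _ ⟨e, he, rfl⟩
    exact (hτ.edge_iff e).2 (hM.1 he)
  · intro v hv
    have hv' : v - τ ∈ G.black ∪ G.white := by
      have h1 := hτ.black_iff (v - τ)
      have h2 := hτ.white_iff (v - τ)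
      rw [sub_add_cancel] at h1 h2
      exact hv.imp h1.1 h2.1
    obtain ⟨e, ⟨he, hve⟩, huniq⟩ := hM.2 _ hv'
    refine ⟨shiftEdge τ e, ⟨⟨e, he, rfl⟩, (isEndpoint_shiftEdge τ v e).2 hve⟩, ?_⟩
    rintro _ ⟨⟨e', he', rfl⟩, hve'⟩
    rw [huniq e' ⟨he', (isEndpoint_shiftEdge τ v e').1 hve'⟩]

/-- The translate by `τ` of a dimer configuration. -/
def translate (G : PlaneBipartiteGraph) {τ : ℂ} (hτ : G.IsPeriod τ) (M : G.Config) : G.Config :=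
  ⟨shiftEdge τ '' M.1, hτ.isDimer_image M.2⟩

/-- The edges contained in the ball `B(0, R)`. -/
def innerEdges (G : PlaneBipartiteGraph) (R : ℝ) : Set (List ℂ) :=
  {e ∈ G.edges | polyCarrier e ⊆ Metric.ball 0 R}

/-- The restriction of a configuration to the outside of `B(0, R)`. -/
def outside (G : PlaneBipartiteGraph) (R : ℝ) (M : G.Config) : Set (List ℂ) :=
  M.1 \ G.innerEdges R

/-- The product of the weights of the dimers of `N` inside `B(0, R)` (there are finitely many). -/
noncomputable def innerWeight (G : PlaneBipartiteGraph) (R : ℝ) (N : G.Config) : ℝ :=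
  ∏ᶠ e ∈ N.1 ∩ G.innerEdges R, G.weight e

/-- The unnormalised dimer measure on the (finitely many) configurations that agree with `m`
outside of `B(0, R)`. -/
noncomputable def localWeightMeasure (G : PlaneBipartiteGraph) (R : ℝ) (m : G.Config) :
    Measure G.Config :=
  Measure.sum fun N : {N : G.Config // G.outside R N = G.outside R m} =>
    ENNReal.ofReal (G.innerWeight R N.1) • Measure.dirac N.1

/-- The dimer probability measure `π(R, m)` on the configurations that agree with `m` outside of
`B(0, R)`: the probability of `N` is proportional to the product of the weights of its dimers. -/
noncomputable def localMeasure (G : PlaneBipartiteGraph) (R : ℝ) (m : G.Config) :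
    Measure G.Config :=
  (G.localWeightMeasure R m Set.univ)⁻¹ • G.localWeightMeasure R m

/-- The σ-algebra generated by the configuration outside of `B(0, R)`. -/
abbrev outsideSigma (G : PlaneBipartiteGraph) (R : ℝ) : MeasurableSpace G.Config :=
  MeasurableSpace.comap (G.outside R) inferInstance

/-- The Gibbs property: for every `R > 0`, the conditional law of `M` under `μ` given its
restriction to the outside of `B(0, R)` is `π(R, M)`. -/
def IsGibbs (G : PlaneBipartiteGraph) (μ : Measure G.Config) : Prop :=
  ∀ R : ℝ, 0 < R → ∀ A : Set G.Config, MeasurableSet A →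
    μ⟦A | G.outsideSigma R⟧ =ᵐ[μ] fun M => (G.localMeasure R M).real A

open Classical in
/-- The unit flow from black to white vertices carried by a dimer configuration. -/
noncomputable def flow (G : PlaneBipartiteGraph) (M : G.Config) (e : List ℂ) : ℝ :=
  if e ∈ M.1 then 1 else 0

/-- `h` is a height function of `M` with respect to the reference flow `ω`: a function on the faces
(i.e. locally constant off the edges) that, when an edge `e` is crossed so that one arrives on
its left, seen from its black towards its white endpoint, increases by `1_{e ∈ M} - ω e`.
The values of `h` on the edges themselves are irrelevant. -/
structure IsHeight (G : PlaneBipartiteGraph) (ω : List ℂ → ℝ) (M : G.Config) (h : ℂ → ℝ) :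
    Prop where
  locally_const : ∀ z ∉ G.carrier, ∀ᶠ z' in 𝓝 z, h z' = h z
  jump : ∀ e ∈ G.edges, ∀ s ∈ polySegments e, ∀ z ∈ openSegment ℝ s.1 s.2,
    ∀ᶠ t : ℝ in 𝓝[>] 0,
      h (z + t * (Complex.I * (s.2 - s.1))) - h (z - t * (Complex.I * (s.2 - s.1)))
        = G.flow M e - ω e

/-- The event that the height at `0` lies in `(x, x + 1)`, for configurations agreeing with `m`
outside of `B(0, R)`. The reference flow is that of `m`, and the height is fixed to be that of
`m`, i.e. `0`, at the points outside of `B(0, R)`; another reference flow or another value of the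
height outside would shift the height at `0` by a number that depends on `m` only. -/
def heightEvent (G : PlaneBipartiteGraph) (R : ℝ) (m : G.Config) (x : ℝ) : Set G.Config :=
  {N | ∃ h : ℂ → ℝ, G.IsHeight (G.flow m) N h ∧
    (∀ z ∉ G.carrier, z ∉ Metric.ball (0 : ℂ) R → h z = 0) ∧ h 0 ∈ Set.Ioo x (x + 1)}

/-- The spread-out property. -/
def IsSpreadOut (G : PlaneBipartiteGraph) (μ : Measure G.Config) : Prop :=
  ∀ ε : ℝ, 0 < ε → ∃ R : ℝ, 0 < R ∧
    1 - ε < μ.real {M | ∀ x : ℝ, (G.localMeasure R M).real (G.heightEvent R M x) ≤ ε}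

/-- Invariance under all the translations that preserve the coloured weighted embedded graph. -/
def IsTranslationInvariant (G : PlaneBipartiteGraph) (μ : Measure G.Config) : Prop :=
  ∀ (τ : ℂ) (hτ : G.IsPeriod τ), MeasurePreserving (G.translate hτ) μ μ

end PlaneBipartiteGraph

/-! The proof couples a configuration with its translate by exchanging parts of two samples. Fix a
period τ, a finite set S of edges and a large ball with set Λ of inner edges. For a boundary
condition m, sample N₁ from the law on Λ given m and, independently, N₂ from the law given the
translate of m. The symmetric difference of N₁ and N₂ is a disjoint union of cycles and paths.
Exchanging N₁ and N₂ along the components contained in Λ is an involution of pairs that keeps the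
product of the weights and both boundary conditions, so the exchanged first configuration still has
the law of N₁ (`abs_localExp_sub_le`). If every edge of S in the symmetric difference lies in such a
component, the exchanged configuration coincides with N₂ on S. Hence the two local laws can differ
on S only through the event that a component joins S to an edge not contained in the ball.

Heights make that event unlikely. The height difference of N₁ and N₂ is constant along a component
(`exists_heightDiff_mid_eq`, `heightDiff_mid_mid_of_connected`). Outside the ball it is the height
difference of m and its translate, and this is bounded uniformly in m and in the point
(`IsBiperiodic.exists_heightDiff_translate_le`): it is almost additive under iteration of the
translation, so a large value would grow linearly in the number of iterations, while between two
fixed points the height differences of all pairs of configurations are bounded. So on the bad event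
the two heights at 0 differ by at most a constant independent of the radius
(`IsBiperiodic.exists_localHeight_sub_le`). Given N₂, this confines the height of N₁ to a bounded
window, which by the spread-out property has small probability for most m
(`abs_localExp_sub_translate_le`). Integrating over m with the Gibbs property, used for the ball and
for its translate (`IsGibbs.integral_localExp`), gives equality on cylinder events
(`measure_preimage_translate_eq`).

Height differences are defined without any topology of the plane: the signed number of crossings of
two segments is a sum of arguments, and path independence (`heightDiff_cocycle`) follows because the
difference of two dimer flows has no divergence. -/

/-! ### Arguments and signed crossings of two segments -/

/-- The argument of a complex number, made odd under inversion by giving the value `0` to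
negative reals. -/
noncomputable def symmArg (q : ℂ) : ℝ := if q.arg = Real.pi then 0 else q.arg

theorem symmArg_zero : symmArg 0 = 0 := by simp [symmArg]

theorem symmArg_ofReal (r : ℝ) : symmArg (r : ℂ) = 0 := by
  unfold symmArg
  split_ifs with h
  · rfl
  · rcases le_or_gt 0 r with hr | hr
    · exact Complex.arg_ofReal_of_nonneg hr
    · exact absurd (Complex.arg_ofReal_of_neg hr) h

theorem abs_symmArg_le (q : ℂ) : |symmArg q| ≤ Real.pi := by
  unfold symmArg
  split_ifs
  · simpa using Real.pi_pos.le
  · exact Complex.abs_arg_le_pi q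

theorem symmArg_inv (q : ℂ) : symmArg q⁻¹ = -symmArg q := by
  unfold symmArg
  rw [Complex.arg_inv]
  have := Real.pi_pos
  have h2 := Complex.neg_pi_lt_arg q
  split_ifs <;> first | linarith | simp_all

theorem symmArg_div_swap (x y : ℂ) : symmArg (y / x) = -symmArg (x / y) := by
  rw [← symmArg_inv, inv_div]

theorem symmArg_real_mul {r : ℝ} (hr : 0 < r) (q : ℂ) : symmArg (r * q) = symmArg q := by
  unfold symmArg
  rw [Complex.arg_real_mul _ hr]

theorem symmArg_eq_arg {q : ℂ} (hq : q ∈ Complex.slitPlane) : symmArg q = q.arg := by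
  rw [symmArg, if_neg (Complex.slitPlane_arg_ne_pi hq)]

/-- Two points in a common open half-plane have arguments, relative to its axis, in (-π/2, π/2), so
their difference needs no correction by 2π. All vanishing statements below come from this branch. -/
theorem symmArg_div_of_re_pos {u x y : ℂ} (hx : 0 < (x / u).re) (hy : 0 < (y / u).re) :
    symmArg (x / y) = (x / u).arg - (y / u).arg := by
  have hu : u ≠ 0 := by rintro rfl; simp at hx
  have hx0 : x / u ≠ 0 := by intro h; simp [h] at hx
  have hy0 : y / u ≠ 0 := by intro h; simp [h] at hy
  have hxy : x / y = (x / u) / (y / u) := by field_simp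
  have h1 := abs_lt.1 (Complex.abs_arg_lt_pi_div_two_iff.2 (Or.inl hx))
  have h2 := abs_lt.1 (Complex.abs_arg_lt_pi_div_two_iff.2 (Or.inl hy))
  have key : (x / y).arg = (x / u).arg - (y / u).arg := by
    rw [← Complex.arg_coe_angle_toReal_eq_arg, hxy, Complex.arg_div_coe_angle hx0 hy0,
      ← Real.Angle.coe_sub, Real.Angle.toReal_coe_eq_self_iff_mem_Ioc]
    constructor <;> linarith
  rw [symmArg, if_neg, key]
  rw [key]
  intro h
  linarith

/-- Adding 1 does not change the sign of the imaginary part, so the arguments of ζ and 1 + ζ are on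
the same side of 0 and their difference stays in (-π, π). -/
theorem symmArg_one_add_add {ζ : ℂ} (hζ : ζ ∈ Complex.slitPlane) :
    symmArg (1 + ζ) + symmArg (ζ / (1 + ζ)) = symmArg ζ := by
  have h1 : 1 + ζ ∈ Complex.slitPlane := by
    rw [Complex.mem_slitPlane_iff] at hζ ⊢
    rcases hζ with h | h
    · left; simp; linarith
    · right; simpa using h
  have hζ0 : ζ ≠ 0 := Complex.slitPlane_ne_zero hζ
  have h10 : 1 + ζ ≠ 0 := Complex.slitPlane_ne_zero h1
  have key : (ζ / (1 + ζ)).arg = ζ.arg - (1 + ζ).arg ∧ (ζ / (1 + ζ)).arg ≠ Real.pi := by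
    have hm : ζ.arg - (1 + ζ).arg ∈ Set.Ioo (-Real.pi) Real.pi := by
      have a1 := Complex.neg_pi_lt_arg ζ
      have a2 := Complex.neg_pi_lt_arg (1 + ζ)
      have a3 := lt_of_le_of_ne (Complex.arg_le_pi ζ) (Complex.slitPlane_arg_ne_pi hζ)
      have a4 := lt_of_le_of_ne (Complex.arg_le_pi (1 + ζ)) (Complex.slitPlane_arg_ne_pi h1)
      rcases le_or_gt 0 ζ.im with hi | hi
      · have b1 := Complex.arg_nonneg_iff.2 hi
        have b2 : 0 ≤ (1 + ζ).arg := Complex.arg_nonneg_iff.2 (by simpa using hi)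
        constructor <;> linarith
      · have b1 := Complex.arg_neg_iff.2 hi
        have b2 : (1 + ζ).arg < 0 := Complex.arg_neg_iff.2 (by simpa using hi)
        constructor <;> linarith
    have e : (ζ / (1 + ζ)).arg = ζ.arg - (1 + ζ).arg := by
      rw [← Complex.arg_coe_angle_toReal_eq_arg, Complex.arg_div_coe_angle hζ0 h10,
        ← Real.Angle.coe_sub, Real.Angle.toReal_coe_eq_self_iff_mem_Ioc]
      exact ⟨hm.1, hm.2.le⟩
    exact ⟨e, by rw [e]; exact hm.2.ne⟩
  rw [symmArg_eq_arg h1, symmArg_eq_arg hζ, symmArg, if_neg key.2, key.1]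
  ring

/-- The signed number of crossings of the segment from `a` to `b` by the segment from `z'` to `z`
(positive when the latter crosses from right to left). -/
noncomputable def crossing (a b z z' : ℂ) : ℝ :=
  (symmArg ((b - z) / (a - z)) - symmArg ((b - z') / (a - z')) - symmArg ((b - z) / (b - z'))
    + symmArg ((a - z) / (a - z'))) / (2 * Real.pi)

theorem crossing_reverse (a b z z' : ℂ) : crossing b a z z' = -crossing a b z z' := by
  unfold crossing
  rw [symmArg_div_swap (b - z) (a - z), symmArg_div_swap (b - z') (a - z')]
  ring

theorem crossing_symm (a b z z' : ℂ) : crossing a b z' z = -crossing a b z z' := by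
  unfold crossing
  rw [symmArg_div_swap (b - z) (b - z'), symmArg_div_swap (a - z) (a - z')]
  ring

theorem crossing_add (a b z z' τ : ℂ) :
    crossing (a + τ) (b + τ) (z + τ) (z' + τ) = crossing a b z z' := by
  simp [crossing]

theorem abs_crossing_le (a b z z' : ℂ) : |crossing a b z z'| ≤ 2 := by
  unfold crossing
  have hp := Real.pi_pos
  rw [abs_div, abs_of_pos (by positivity : (0 : ℝ) < 2 * Real.pi), div_le_iff₀ (by positivity)]
  have h1 := abs_le.1 (abs_symmArg_le ((b - z) / (a - z)))
  have h2 := abs_le.1 (abs_symmArg_le ((b - z') / (a - z')))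
  have h3 := abs_le.1 (abs_symmArg_le ((b - z) / (b - z')))
  have h4 := abs_le.1 (abs_symmArg_le ((a - z) / (a - z')))
  rw [abs_le]
  constructor <;> linarith

theorem exists_re_div_pos_of_disjoint {s t : Set ℂ} (hs : Convex ℝ s) (hs' : IsCompact s)
    (ht : Convex ℝ t) (ht' : IsClosed t) (h : Disjoint s t) :
    ∃ u : ℂ, ∀ x ∈ s, ∀ y ∈ t, 0 < ((y - x) / u).re := by
  obtain ⟨f, c, d, hf, hcd, hg⟩ :=
    RCLike.geometric_hahn_banach_compact_closed (𝕜 := ℂ) hs hs' ht ht' h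
  -- A ℂ-linear functional is multiplication by its value at 1, so its real part is w ↦ Re (w / u)
  -- with u the inverse of that value.
  refine ⟨(f 1)⁻¹, fun x hx y hy => ?_⟩
  have e : ∀ w, f w = w * f 1 := fun w => by
    rw [← smul_eq_mul, ← map_smul, smul_eq_mul, mul_one]
  have h1 := hf x hx
  have h2 := hg y hy
  rw [e] at h1 h2
  simp only [RCLike.re_to_complex] at h1 h2
  rw [div_inv_eq_mul, sub_mul, Complex.sub_re]
  linarith

theorem isCompact_segment_complex (a b : ℂ) : IsCompact (segment ℝ a b) := by
  rw [segment_eq_image_lineMap]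
  exact isCompact_Icc.image (by fun_prop)

/-- The four terms turn successively through a - z, b - z, b - z', a - z' and back, so generically
`crossing` is the winding number of this quadrilateral about 0. Separating the segments puts its
corners in one open half-plane, where the arguments telescope. -/
theorem crossing_eq_zero {a b z z' : ℂ} (h : Disjoint (segment ℝ a b) (segment ℝ z z')) :
    crossing a b z z' = 0 := by
  obtain ⟨u, hu⟩ := exists_re_div_pos_of_disjoint (convex_segment z z')
    (isCompact_segment_complex z z') (convex_segment a b)
    (isCompact_segment_complex a b).isClosed h.symm
  have h1 := hu z (left_mem_segment _ _ _) a (left_mem_segment _ _ _)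
  have h2 := hu z (left_mem_segment _ _ _) b (right_mem_segment _ _ _)
  have h3 := hu z' (right_mem_segment _ _ _) a (left_mem_segment _ _ _)
  have h4 := hu z' (right_mem_segment _ _ _) b (right_mem_segment _ _ _)
  unfold crossing
  rw [symmArg_div_of_re_pos h2 h1, symmArg_div_of_re_pos h4 h3, symmArg_div_of_re_pos h2 h4,
    symmArg_div_of_re_pos h1 h3, div_eq_zero_iff]
  left
  ring

theorem symmArg_div_real_mul (x y : ℝ) (w : ℂ) : symmArg ((x * w) / (y * w)) = 0 := by
  rcases eq_or_ne w 0 with rfl | hw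
  · simp [symmArg_zero]
  · rw [mul_div_mul_right _ _ hw, ← Complex.ofReal_div, symmArg_ofReal]

/-- All four quotients are real; the value 0 given to negative reals makes every term vanish. -/
theorem crossing_eq_zero_of_collinear (a w : ℂ) (x y t : ℝ) :
    crossing a (a + x * w) (a + y * w) (a + t * w) = 0 := by
  have e1 : a + x * w - (a + y * w) = ((x - y : ℝ) : ℂ) * w := by push_cast; ring
  have e2 : a + x * w - (a + t * w) = ((x - t : ℝ) : ℂ) * w := by push_cast; ring
  have e3 : a - (a + y * w) = ((-y : ℝ) : ℂ) * w := by push_cast; ring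
  have e4 : a - (a + t * w) = ((-t : ℝ) : ℂ) * w := by push_cast; ring
  unfold crossing
  rw [e1, e2, e3, e4]
  simp only [symmArg_div_real_mul]
  simp

theorem mem_openSegment_complex {a b z : ℂ} (hz : z ∈ openSegment ℝ a b) :
    ∃ t : ℝ, 0 < t ∧ t < 1 ∧ z = a + t * (b - a) := by
  rw [openSegment_eq_image_lineMap] at hz
  obtain ⟨t, ht, rfl⟩ := hz
  refine ⟨t, ht.1, ht.2, ?_⟩
  simp [AffineMap.lineMap_apply]
  ring

theorem mem_segment_complex {a b z : ℂ} (hz : z ∈ segment ℝ a b) :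
    ∃ t : ℝ, z = a + t * (b - a) := by
  rw [segment_eq_image_lineMap] at hz
  obtain ⟨t, ht, rfl⟩ := hz
  refine ⟨t, ?_⟩
  simp [AffineMap.lineMap_apply]
  ring

theorem crossing_eq_zero_of_mem_segment {a b z z' : ℂ} (hz : z ∈ segment ℝ a b)
    (hz' : z' ∈ segment ℝ a b) : crossing a b z z' = 0 := by
  obtain ⟨y, rfl⟩ := mem_segment_complex hz
  obtain ⟨t, rfl⟩ := mem_segment_complex hz'
  have := crossing_eq_zero_of_collinear a (b - a) 1 y t
  simpa using this

/-- The test segment lies along one side of the corner and ends at its tip. The result depends only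
on the turning angle at v, not on the position of z. -/
theorem crossing_corner_first {b₁ v b₂ z : ℂ} (h : (b₂ - v) / (v - b₁) ∈ Complex.slitPlane)
    (hz : z ∈ openSegment ℝ v b₁) :
    crossing v b₂ z v = symmArg ((b₂ - v) / (v - b₁)) / (2 * Real.pi) := by
  obtain ⟨t, ht, -, rfl⟩ := mem_openSegment_complex hz
  have hv : v - b₁ ≠ 0 := by
    intro h'
    rw [h', div_zero] at h
    exact Complex.slitPlane_ne_zero h rfl
  have hb : b₂ - v ≠ 0 := by
    intro h'
    rw [h', zero_div] at h
    exact Complex.slitPlane_ne_zero h rfl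
  have ht0 : (t : ℂ) ≠ 0 := by exact_mod_cast ht.ne'
  set ζ := (b₂ - v) / (v - b₁) with hζ
  have hζ' : ((t⁻¹ : ℝ) : ℂ) * ζ ∈ Complex.slitPlane := by
    rw [Complex.mem_slitPlane_iff] at h ⊢
    rw [Complex.re_ofReal_mul, Complex.im_ofReal_mul]
    have : 0 < t⁻¹ := inv_pos.2 ht
    rcases h with h | h
    · exact Or.inl (mul_pos this h)
    · exact Or.inr (mul_ne_zero this.ne' h)
  have key := symmArg_one_add_add hζ'
  rw [symmArg_real_mul (inv_pos.2 ht)] at key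
  have h1 : 1 + ((t⁻¹ : ℝ) : ℂ) * ζ ≠ 0 := by
    intro h0
    rw [Complex.mem_slitPlane_iff] at hζ'
    have : ((t⁻¹ : ℝ) : ℂ) * ζ = -1 := by linear_combination h0
    rw [this] at hζ'
    norm_num at hζ'
  have e1 : (b₂ - (v + t * (b₁ - v))) / (v - (v + t * (b₁ - v)))
      = 1 + ((t⁻¹ : ℝ) : ℂ) * ζ := by
    have : v - (v + t * (b₁ - v)) = t * (v - b₁) := by ring
    rw [this, hζ]
    push_cast
    field_simp
    ring
  have e3 : b₂ - (v + t * (b₁ - v)) = t * (v - b₁) * (1 + ((t⁻¹ : ℝ) : ℂ) * ζ) := by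
    rw [hζ]
    push_cast
    field_simp
    ring
  have e2 : (b₂ - v) / (b₂ - (v + t * (b₁ - v)))
      = ((t⁻¹ : ℝ) : ℂ) * ζ / (1 + ((t⁻¹ : ℝ) : ℂ) * ζ) := by
    rw [e3, ← div_div, hζ]
    push_cast
    congr 1
    field_simp
  -- Since the tip is both an end of the side and an end of the test segment, two of the four
  -- quotients have denominator v - v and contribute 0.
  unfold crossing
  rw [e1, symmArg_div_swap (b₂ - v) (b₂ - (v + t * (b₁ - v))), e2, sub_self, div_zero, div_zero,
    symmArg_zero, ← key]
  ring

theorem crossing_corner_left {b₁ v b₂ z : ℂ} (h : (b₂ - v) / (v - b₁) ∈ Complex.slitPlane)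
    (hz : z ∈ openSegment ℝ b₁ v) :
    crossing b₁ v z v + crossing v b₂ z v = symmArg ((b₂ - v) / (v - b₁)) / (2 * Real.pi) := by
  rw [crossing_eq_zero_of_mem_segment (openSegment_subset_segment _ _ _ hz)
    (right_mem_segment _ _ _), zero_add]
  exact crossing_corner_first h (by rwa [openSegment_symm])

/-- Traversing the corner backwards inverts the turning quotient and changes the sign of the
crossing; the two signs cancel. The agreement with `crossing_corner_left` is what keeps the height
difference constant when a path turns at v. -/
theorem crossing_corner_right {b₁ v b₂ z : ℂ} (h : (b₂ - v) / (v - b₁) ∈ Complex.slitPlane)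
    (hz : z ∈ openSegment ℝ v b₂) :
    crossing b₁ v z v + crossing v b₂ z v = symmArg ((b₂ - v) / (v - b₁)) / (2 * Real.pi) := by
  rw [crossing_eq_zero_of_mem_segment (a := v) (b := b₂) (openSegment_subset_segment _ _ _ hz)
    (left_mem_segment _ _ _), add_zero]
  have e : (b₁ - v) / (v - b₂) = ((b₂ - v) / (v - b₁))⁻¹ := by
    rw [inv_div, ← neg_sub v b₁, ← neg_sub b₂ v, neg_div_neg_eq]
  have h' : (b₁ - v) / (v - b₂) ∈ Complex.slitPlane := by
    rw [e]
    rw [Complex.mem_slitPlane_iff_arg] at h ⊢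
    rw [Complex.arg_inv, if_neg h.1]
    exact ⟨fun h' => by linarith [Complex.neg_pi_lt_arg ((b₂ - v) / (v - b₁))], inv_ne_zero h.2⟩
  rw [crossing_reverse, crossing_corner_first h' hz, e, symmArg_inv]
  ring

/-- The turning quotient leaves the slit plane only when the path doubles back at v, and then the
two sides overlap beyond v. -/
theorem div_mem_slitPlane_of_segment_inter {b₁ v b₂ : ℂ} (h₁ : b₁ ≠ v) (h₂ : b₂ ≠ v)
    (h : segment ℝ b₁ v ∩ segment ℝ v b₂ ⊆ {v}) :
    (b₂ - v) / (v - b₁) ∈ Complex.slitPlane := by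
  by_contra hn
  rw [Complex.mem_slitPlane_iff, not_or, not_lt, not_ne_iff] at hn
  set ζ := (b₂ - v) / (v - b₁) with hζ
  have hv : v - b₁ ≠ 0 := sub_ne_zero.2 h₁.symm
  have hb : b₂ - v ≠ 0 := sub_ne_zero.2 h₂
  have hr : ζ = ((-(-ζ.re) : ℝ) : ℂ) := by
    apply Complex.ext <;> simp [hn.2]
  set r := -ζ.re with hrdef
  have hb2 : b₂ - v = r * (b₁ - v) := by
    have : b₂ - v = ζ * (v - b₁) := by rw [hζ]; field_simp
    rw [this, hr]; push_cast; ring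
  have hr0 : 0 < r := by
    rcases (show 0 ≤ r by linarith [hn.1]).lt_or_eq with h' | h'
    · exact h'
    · rw [← h'] at hb2; simp at hb2; exact absurd (sub_eq_zero.1 (by simpa using hb2)) h₂
  -- Here r is the ratio of the lengths of the overlapping sides, and this point is the end nearer
  -- to v.
  have hx : v + ((min r 1 : ℝ) : ℂ) * (b₁ - v) ∈ segment ℝ b₁ v ∩ segment ℝ v b₂ := by
    constructor
    · refine ⟨min r 1, 1 - min r 1, by positivity, by simp, by ring, ?_⟩
      simp only [Complex.real_smul]
      push_cast
      ring
    · have hm : min r 1 / r ≤ 1 := (div_le_one hr0).2 (min_le_left _ _)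
      refine ⟨1 - min r 1 / r, min r 1 / r, by linarith, by positivity, by ring, ?_⟩
      have e : b₂ = v + r * (b₁ - v) := by linear_combination hb2
      have hr' : (r : ℂ) ≠ 0 := by exact_mod_cast hr0.ne'
      simp only [Complex.real_smul]
      rw [e]
      push_cast
      field_simp
      ring
  have := h hx
  simp only [Set.mem_singleton_iff, add_eq_left, mul_eq_zero, Complex.ofReal_eq_zero] at this
  rcases this with h' | h'
  · have : 0 < min r 1 := by positivity
    linarith
  · exact h₁ (sub_eq_zero.1 h')

/-- Each of the four successive turns has positive imaginary part, hence an angle in (0, π). They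
sum to a multiple of 2π lying strictly between 0 and 4π, that is, to 2π. -/
theorem crossing_perp {a b x : ℂ} (hab : a ≠ b) (hx : x ∈ openSegment ℝ a b) {t : ℝ}
    (ht : 0 < t) :
    crossing a b (x + t * (Complex.I * (b - a))) (x - t * (Complex.I * (b - a))) = 1 := by
  obtain ⟨l, hl0, hl1, rfl⟩ := mem_openSegment_complex hx
  have hw : b - a ≠ 0 := sub_ne_zero.2 hab.symm
  set w := b - a with hwdef
  have hb : b = a + w := by rw [hwdef]; ring
  set p : ℂ := ⟨1 - l, -t⟩ with hp
  set q : ℂ := ⟨-l, -t⟩ with hq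
  set p' : ℂ := ⟨1 - l, t⟩ with hp'
  set q' : ℂ := ⟨-l, t⟩ with hq'
  have ep : b - (a + l * w + t * (Complex.I * w)) = p * w := by
    have : p = 1 - l - t * Complex.I := by apply Complex.ext <;> simp [hp]
    rw [this, hb]; ring
  have eq : a - (a + l * w + t * (Complex.I * w)) = q * w := by
    have : q = - l - t * Complex.I := by apply Complex.ext <;> simp [hq]
    rw [this]; ring
  have ep' : b - (a + l * w - t * (Complex.I * w)) = p' * w := by
    have : p' = 1 - l + t * Complex.I := by apply Complex.ext <;> simp [hp']
    rw [this, hb]; ring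
  have eq' : a - (a + l * w - t * (Complex.I * w)) = q' * w := by
    have : q' = - l + t * Complex.I := by apply Complex.ext <;> simp [hq']
    rw [this]; ring
  have p0 : p ≠ 0 := fun h => by have := congrArg Complex.im h; simp [hp] at this; linarith
  have q0 : q ≠ 0 := fun h => by have := congrArg Complex.im h; simp [hq] at this; linarith
  have p0' : p' ≠ 0 := fun h => by have := congrArg Complex.im h; simp [hp'] at this; linarith
  have q0' : q' ≠ 0 := fun h => by have := congrArg Complex.im h; simp [hq'] at this; linarith
  have pos : ∀ z : ℂ, 0 < z.im → symmArg z = z.arg ∧ 0 < z.arg ∧ z.arg < Real.pi := by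
    intro z hz
    have hs : z ∈ Complex.slitPlane := Complex.mem_slitPlane_iff.2 (Or.inr hz.ne')
    refine ⟨symmArg_eq_arg hs, ?_, lt_of_le_of_ne (Complex.arg_le_pi z)
      (Complex.slitPlane_arg_ne_pi hs)⟩
    refine lt_of_le_of_ne (Complex.arg_nonneg_iff.2 hz.le) fun h => ?_
    have := Complex.arg_eq_zero_iff.1 h.symm
    linarith [this.2]
  have i1 : 0 < (p / q).im := by
    rw [Complex.div_im, ← sub_div]
    apply div_pos _ (Complex.normSq_pos.2 q0)
    simp only [hp, hq]; nlinarith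
  have i2 : 0 < (q' / p').im := by
    rw [Complex.div_im, ← sub_div]
    apply div_pos _ (Complex.normSq_pos.2 p0')
    simp only [hp', hq']; nlinarith
  have i3 : 0 < (p' / p).im := by
    rw [Complex.div_im, ← sub_div]
    apply div_pos _ (Complex.normSq_pos.2 p0)
    simp only [hp', hp]; nlinarith
  have i4 : 0 < (q / q').im := by
    rw [Complex.div_im, ← sub_div]
    apply div_pos _ (Complex.normSq_pos.2 q0')
    simp only [hq', hq]; nlinarith
  obtain ⟨s1, l1, u1⟩ := pos _ i1
  obtain ⟨s2, l2, u2⟩ := pos _ i2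
  obtain ⟨s3, l3, u3⟩ := pos _ i3
  obtain ⟨s4, l4, u4⟩ := pos _ i4
  have hsum : (((p / q).arg + (q' / p').arg + (p' / p).arg + (q / q').arg : ℝ) : Real.Angle)
      = ((0 : ℝ) : Real.Angle) := by
    rw [Real.Angle.coe_add, Real.Angle.coe_add, Real.Angle.coe_add, Real.Angle.coe_zero,
      Complex.arg_div_coe_angle p0 q0, Complex.arg_div_coe_angle q0' p0',
      Complex.arg_div_coe_angle p0' p0, Complex.arg_div_coe_angle q0 q0']
    abel
  obtain ⟨k, hk⟩ := Real.Angle.angle_eq_iff_two_pi_dvd_sub.1 hsum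
  have hpi := Real.pi_pos
  have hk1 : k = 1 := by
    have a1 : (0 : ℝ) < k := by
      by_contra h; push Not at h; nlinarith
    have a2 : (k : ℝ) < 2 := by
      by_contra h; push Not at h; nlinarith
    have : 0 < k := by exact_mod_cast a1
    have : k < 2 := by exact_mod_cast a2
    omega
  unfold crossing
  rw [ep, eq, ep', eq', mul_div_mul_right _ _ hw, mul_div_mul_right _ _ hw,
    mul_div_mul_right _ _ hw, mul_div_mul_right _ _ hw, symmArg_div_swap q' p',
    symmArg_div_swap p' p, s1, s2, s3, s4, div_eq_one_iff_eq (by positivity)]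
  rw [hk1] at hk
  push_cast at hk
  linarith

theorem re_sub_div_pos {p z : ℂ} (h : ‖z‖ < ‖p‖) : 0 < ((p - z) / p).re := by
  have hp : 0 < ‖p‖ := (norm_nonneg z).trans_lt h
  have hp0 : p ≠ 0 := norm_pos_iff.1 hp
  rw [sub_div, div_self hp0, Complex.sub_re, Complex.one_re, sub_pos]
  calc (z / p).re ≤ ‖z / p‖ := Complex.re_le_norm _
    _ < 1 := by rw [norm_div, div_lt_one hp]; exact h

/-- Seen from a point p farther from the origin than z, z', z'', the differences all lie in the open
half-plane in direction p, so the three arguments telescope. -/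
theorem symmArg_cocycle_of_norm_lt {p z z' z'' : ℂ} (h : ‖z‖ < ‖p‖) (h' : ‖z'‖ < ‖p‖)
    (h'' : ‖z''‖ < ‖p‖) :
    symmArg ((p - z) / (p - z')) + symmArg ((p - z') / (p - z''))
      + symmArg ((p - z'') / (p - z)) = 0 := by
  rw [symmArg_div_of_re_pos (re_sub_div_pos h) (re_sub_div_pos h'),
    symmArg_div_of_re_pos (re_sub_div_pos h') (re_sub_div_pos h''),
    symmArg_div_of_re_pos (re_sub_div_pos h'') (re_sub_div_pos h)]
  ring

theorem symmArg_div_of_norm_lt {a b z : ℂ} (ha : ‖a‖ < ‖z‖) (hb : ‖b‖ < ‖z‖) :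
    symmArg ((b - z) / (a - z)) = ((z - b) / z).arg - ((z - a) / z).arg := by
  rw [← neg_sub z b, ← neg_sub z a, neg_div_neg_eq]
  exact symmArg_div_of_re_pos (re_sub_div_pos hb) (re_sub_div_pos ha)

/-! ### Straight pieces, turning and crossings of polygonal lines -/

/-- The list of the oriented straight pieces of the polygonal line `e`. -/
def segmentList (e : List ℂ) : List (ℂ × ℂ) := e.zip e.tail

theorem mem_segmentList {e : List ℂ} {s : ℂ × ℂ} : s ∈ segmentList e ↔ s ∈ polySegments e := by
  unfold segmentList polySegments
  rw [Set.mem_ofPred_eq]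
  induction e with
  | nil => simp
  | cons a l ih =>
    cases l with
    | nil =>
      simp only [List.tail_cons, List.zip_nil_right, List.not_mem_nil, false_iff]
      intro h
      have := h.length_le
      simp at this
    | cons b l =>
      rw [List.infix_cons_iff, ← ih]
      simp [List.zip_cons_cons, Prod.ext_iff]

theorem mem_polyCarrier {e : List ℂ} {z : ℂ} :
    z ∈ polyCarrier e ↔ ∃ s ∈ segmentList e, z ∈ segment ℝ s.1 s.2 := by
  simp [polyCarrier, mem_segmentList]

theorem segment_subset_polyCarrier {e : List ℂ} {s : ℂ × ℂ} (hs : s ∈ segmentList e) :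
    segment ℝ s.1 s.2 ⊆ polyCarrier e := fun _ hz => mem_polyCarrier.2 ⟨s, hs, hz⟩

theorem fst_mem_of_mem_segmentList {e : List ℂ} {s : ℂ × ℂ} (hs : s ∈ segmentList e) :
    s.1 ∈ e := (List.of_mem_zip (a := s.1) (b := s.2) hs).1

theorem snd_mem_of_mem_segmentList {e : List ℂ} {s : ℂ × ℂ} (hs : s ∈ segmentList e) :
    s.2 ∈ e := List.mem_of_mem_tail (List.of_mem_zip (a := s.1) (b := s.2) hs).2

theorem segmentList_nodup {e : List ℂ} (he : e.Nodup) : (segmentList e).Nodup := by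
  unfold segmentList
  induction e with
  | nil => simp
  | cons a l ih =>
    cases l with
    | nil => simp
    | cons b l =>
      simp only [List.tail_cons, List.zip_cons_cons, List.nodup_cons]
      refine ⟨fun h => ?_, ih he.of_cons⟩
      exact (List.nodup_cons.1 he).1 (List.of_mem_zip h).1

theorem length_segmentList_le (e : List ℂ) : (segmentList e).length ≤ e.length := by
  simp [segmentList]

theorem segmentList_ne_nil {e : List ℂ} (he : 2 ≤ e.length) : segmentList e ≠ [] := by
  rcases e with _ | ⟨a, _ | ⟨b, l⟩⟩ <;> simp_all [segmentList]

theorem segmentList_shiftEdge (τ : ℂ) (e : List ℂ) :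
    segmentList (shiftEdge τ e) = (segmentList e).map (Prod.map (· + τ) (· + τ)) := by
  unfold segmentList shiftEdge
  rw [← List.map_tail, List.zip_map]

theorem sum_segmentList_sub (g : ℂ → ℝ) {e : List ℂ} {a b : ℂ} (ha : e.head? = some a)
    (hb : e.getLast? = some b) :
    ((segmentList e).map fun s => g s.2 - g s.1).sum = g b - g a := by
  unfold segmentList
  induction e generalizing a with
  | nil => simp at ha
  | cons x l ih =>
    cases l with
    | nil => simp_all
    | cons y l =>
      simp only [List.head?_cons, Option.some.injEq] at ha
      rw [List.getLast?_cons_cons] at hb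
      have := ih (a := y) (by simp) hb
      simp only [List.tail_cons] at this
      simp only [List.tail_cons, List.zip_cons_cons, List.map_cons, List.sum_cons, this, ha]
      ring

/-- The total angle under which the polygonal line `e` is seen from `z`. -/
noncomputable def edgeTurn (e : List ℂ) (z : ℂ) : ℝ :=
  ((segmentList e).map fun s => symmArg ((s.2 - z) / (s.1 - z))).sum

/-- The signed number of crossings of the polygonal line `e` by the segment from `z'` to `z`. -/
noncomputable def edgeCrossing (e : List ℂ) (z z' : ℂ) : ℝ :=
  ((segmentList e).map fun s => crossing s.1 s.2 z z').sum

theorem edgeCrossing_eq_zero {e : List ℂ} {z z' : ℂ}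
    (h : Disjoint (polyCarrier e) (segment ℝ z z')) : edgeCrossing e z z' = 0 := by
  unfold edgeCrossing
  apply List.sum_eq_zero
  intro x hx
  obtain ⟨s, hs, rfl⟩ := List.mem_map.1 hx
  exact crossing_eq_zero (h.mono_left (segment_subset_polyCarrier hs))

theorem abs_edgeCrossing_le (e : List ℂ) (z z' : ℂ) :
    |edgeCrossing e z z'| ≤ 2 * e.length := by
  have key : ∀ l : List (ℂ × ℂ),
      |(l.map fun s => crossing s.1 s.2 z z').sum| ≤ 2 * l.length := by
    intro l
    induction l with
    | nil => simp
    | cons s l ih =>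
      simp only [List.map_cons, List.sum_cons, List.length_cons]
      push_cast
      have := abs_add_le (crossing s.1 s.2 z z') (l.map fun s => crossing s.1 s.2 z z').sum
      linarith [abs_crossing_le s.1 s.2 z z']
  refine (key _).trans ?_
  have : ((segmentList e).length : ℝ) ≤ e.length := by exact_mod_cast length_segmentList_le e
  linarith

theorem edgeCrossing_symm (e : List ℂ) (z z' : ℂ) :
    edgeCrossing e z' z = -edgeCrossing e z z' := by
  unfold edgeCrossing
  generalize segmentList e = l
  induction l with
  | nil => simp
  | cons s l ih => simp only [List.map_cons, List.sum_cons, ih, crossing_symm s.1 s.2 z z', neg_add]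

theorem edgeCrossing_shiftEdge (e : List ℂ) (z z' τ : ℂ) :
    edgeCrossing (shiftEdge τ e) (z + τ) (z' + τ) = edgeCrossing e z z' := by
  unfold edgeCrossing
  rw [segmentList_shiftEdge, List.map_map]
  congr 1
  apply List.map_congr_left
  intro s _
  exact crossing_add _ _ _ _ _

/-- In the sum over the pieces, the terms attached to a single corner telescope. Crossings thus
become the increment of a potential plus a term that sees only the two ends of the edge. -/
theorem edgeCrossing_eq_edgeTurn {e : List ℂ} {a b : ℂ} (ha : e.head? = some a)
    (hb : e.getLast? = some b) (z z' : ℂ) :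
    edgeCrossing e z z' * (2 * Real.pi) = edgeTurn e z - edgeTurn e z'
      - (symmArg ((b - z) / (b - z')) - symmArg ((a - z) / (a - z'))) := by
  rw [← sum_segmentList_sub (fun p => symmArg ((p - z) / (p - z'))) ha hb]
  unfold edgeCrossing edgeTurn
  have hpi := Real.pi_pos
  generalize segmentList e = l
  induction l with
  | nil => simp
  | cons s l ih =>
    simp only [List.map_cons, List.sum_cons, add_mul, ih]
    unfold crossing
    field_simp
    ring

theorem edgeCrossing_eq_sum {e : List ℂ} (he : e.Nodup) {z z' : ℂ} (F : Finset (ℂ × ℂ))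
    (hF : ∀ s ∈ F, s ∈ segmentList e)
    (h : ∀ s ∈ segmentList e, s ∉ F → Disjoint (segment ℝ s.1 s.2) (segment ℝ z z')) :
    edgeCrossing e z z' = ∑ s ∈ F, crossing s.1 s.2 z z' := by
  classical
  unfold edgeCrossing
  rw [← List.sum_toFinset _ (segmentList_nodup he)]
  symm
  apply Finset.sum_subset
  · intro s hs
    exact List.mem_toFinset.2 (hF s hs)
  · intro s hs hn
    exact crossing_eq_zero (h s (List.mem_toFinset.1 hs) hn)

/-! ### Height differences of two configurations and their path independence -/

namespace PlaneBipartiteGraph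

variable (G : PlaneBipartiteGraph)

theorem flow_eq_zero_of_notMem {G : PlaneBipartiteGraph} {N : G.Config} {e : List ℂ}
    (h : e ∉ N.1) : G.flow N e = 0 := if_neg h

theorem flow_eq_one_of_mem {G : PlaneBipartiteGraph} {N : G.Config} {e : List ℂ}
    (h : e ∈ N.1) : G.flow N e = 1 := if_pos h

theorem flow_eq_flow_iff {G : PlaneBipartiteGraph} {N₁ N₂ : G.Config} {e : List ℂ} :
    G.flow N₁ e = G.flow N₂ e ↔ (e ∈ N₁.1 ↔ e ∈ N₂.1) := by
  unfold flow
  split_ifs <;> simp_all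

theorem mem_edges_of_flow_ne {G : PlaneBipartiteGraph} {N₁ N₂ : G.Config} {e : List ℂ}
    (h : G.flow N₁ e ≠ G.flow N₂ e) : e ∈ G.edges := by
  by_contra he
  exact h (flow_eq_flow_iff.2 ⟨fun h' => absurd (N₁.2.1 h') he, fun h' => absurd (N₂.2.1 h') he⟩)

theorem abs_flow_sub_flow_le (N₁ N₂ : G.Config) (e : List ℂ) :
    |G.flow N₁ e - G.flow N₂ e| ≤ 1 := by
  unfold flow
  split_ifs <;> simp

/-- The increment from `z'` to `z` of the height difference of two dimer configurations, that is,
the signed number of edges of the first minus that of the second which are crossed by the segment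
from `z'` to `z`. -/
noncomputable def heightDiff (N₁ N₂ : G.Config) (z z' : ℂ) : ℝ :=
  ∑ᶠ e, (G.flow N₁ e - G.flow N₂ e) * edgeCrossing e z z'

/-- The finitely many edges that meet the closed ball of radius `ρ`. -/
noncomputable def edgesMeeting (ρ : ℝ) : Finset (List ℂ) := (G.finite_edges ρ).toFinset

theorem mem_edgesMeeting {ρ : ℝ} {e : List ℂ} : e ∈ G.edgesMeeting ρ ↔
    e ∈ G.edges ∧ (polyCarrier e ∩ Metric.closedBall 0 ρ).Nonempty := by
  simp [edgesMeeting]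

variable {G}

theorem heightDiff_eq_sum {N₁ N₂ : G.Config} {z z' : ℂ} (E : Finset (List ℂ))
    (h : ∀ e, G.flow N₁ e ≠ G.flow N₂ e → (polyCarrier e ∩ segment ℝ z z').Nonempty → e ∈ E) :
    G.heightDiff N₁ N₂ z z' = ∑ e ∈ E, (G.flow N₁ e - G.flow N₂ e) * edgeCrossing e z z' := by
  apply finsum_eq_sum_of_support_subset
  intro e he
  rw [Function.mem_support] at he
  refine h e (sub_ne_zero.1 (left_ne_zero_of_mul he)) ?_
  by_contra hn
  rw [Set.not_nonempty_iff_eq_empty, ← Set.disjoint_iff_inter_eq_empty] at hn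
  exact right_ne_zero_of_mul he (edgeCrossing_eq_zero hn)

theorem segment_subset_closedBall {z z' : ℂ} {ρ : ℝ} (hz : ‖z‖ ≤ ρ) (hz' : ‖z'‖ ≤ ρ) :
    segment ℝ z z' ⊆ Metric.closedBall 0 ρ :=
  (convex_closedBall (0 : ℂ) ρ).segment_subset (by simpa using hz) (by simpa using hz')

theorem heightDiff_eq_sum_edgesMeeting (N₁ N₂ : G.Config) {z z' : ℂ} {ρ : ℝ} (hz : ‖z‖ ≤ ρ)
    (hz' : ‖z'‖ ≤ ρ) : G.heightDiff N₁ N₂ z z'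
      = ∑ e ∈ G.edgesMeeting ρ, (G.flow N₁ e - G.flow N₂ e) * edgeCrossing e z z' :=
  heightDiff_eq_sum _ fun _ he hn => (G.mem_edgesMeeting).2 ⟨mem_edges_of_flow_ne he,
    hn.mono (Set.inter_subset_inter_right _ (segment_subset_closedBall hz hz'))⟩

variable (G) in
/-- A bound for height differences between points of the closed ball of radius `ρ`. -/
noncomputable def heightBound (ρ : ℝ) : ℝ := ∑ e ∈ G.edgesMeeting ρ, 2 * (e.length : ℝ)

/-- The bound involves only the edges near the origin, not the configurations; this uniformity is
used both near S and for the iterated translates. -/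
theorem abs_heightDiff_le (N₁ N₂ : G.Config) {z z' : ℂ} {ρ : ℝ} (hz : ‖z‖ ≤ ρ)
    (hz' : ‖z'‖ ≤ ρ) : |G.heightDiff N₁ N₂ z z'| ≤ G.heightBound ρ := by
  rw [heightDiff_eq_sum_edgesMeeting N₁ N₂ hz hz']
  refine (Finset.abs_sum_le_sum_abs _ _).trans (Finset.sum_le_sum fun e _ => ?_)
  rw [abs_mul]
  calc _ ≤ 1 * |edgeCrossing e z z'| :=
        mul_le_mul_of_nonneg_right (G.abs_flow_sub_flow_le N₁ N₂ e) (abs_nonneg _)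
    _ ≤ _ := by rw [one_mul]; exact abs_edgeCrossing_le e z z'

theorem heightDiff_add (N₁ N₂ N₃ : G.Config) (z z' : ℂ) :
    G.heightDiff N₁ N₂ z z' + G.heightDiff N₂ N₃ z z' = G.heightDiff N₁ N₃ z z' := by
  have hz := le_max_left ‖z‖ ‖z'‖
  have hz' := le_max_right ‖z‖ ‖z'‖
  rw [heightDiff_eq_sum_edgesMeeting N₁ N₂ hz hz', heightDiff_eq_sum_edgesMeeting N₂ N₃ hz hz',
    heightDiff_eq_sum_edgesMeeting N₁ N₃ hz hz', ← Finset.sum_add_distrib]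
  exact Finset.sum_congr rfl fun e _ => by ring

theorem heightDiff_symm (N₁ N₂ : G.Config) (z z' : ℂ) :
    G.heightDiff N₁ N₂ z' z = -G.heightDiff N₁ N₂ z z' := by
  unfold heightDiff
  rw [← finsum_neg_distrib]
  exact finsum_congr fun e => by rw [edgeCrossing_symm e z z']; ring

theorem heightDiff_neg (N₁ N₂ : G.Config) (z z' : ℂ) :
    G.heightDiff N₂ N₁ z z' = -G.heightDiff N₁ N₂ z z' := by
  unfold heightDiff
  rw [← finsum_neg_distrib]
  exact finsum_congr fun e => by ring

theorem shiftEdge_neg_shiftEdge (τ : ℂ) (e : List ℂ) : shiftEdge (-τ) (shiftEdge τ e) = e := by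
  simp [shiftEdge, Function.comp_def]

theorem shiftEdge_shiftEdge_neg (τ : ℂ) (e : List ℂ) : shiftEdge τ (shiftEdge (-τ) e) = e := by
  simp [shiftEdge, Function.comp_def]

/-- Translation of polygonal lines as a permutation. -/
def shiftEquiv (τ : ℂ) : List ℂ ≃ List ℂ where
  toFun := shiftEdge τ
  invFun := shiftEdge (-τ)
  left_inv := shiftEdge_neg_shiftEdge τ
  right_inv := shiftEdge_shiftEdge_neg τ

theorem shiftEdge_mem_translate {τ : ℂ} (hτ : G.IsPeriod τ) (N : G.Config) (e : List ℂ) :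
    shiftEdge τ e ∈ (G.translate hτ N).1 ↔ e ∈ N.1 := by
  unfold translate
  exact (shiftEdge_injective τ).mem_set_image

theorem flow_translate {τ : ℂ} (hτ : G.IsPeriod τ) (N : G.Config) (e : List ℂ) :
    G.flow (G.translate hτ N) (shiftEdge τ e) = G.flow N e := by
  by_cases h : e ∈ N.1
  · rw [flow_eq_one_of_mem h, flow_eq_one_of_mem ((shiftEdge_mem_translate hτ N e).2 h)]
  · rw [flow_eq_zero_of_notMem h,
      flow_eq_zero_of_notMem (mt (shiftEdge_mem_translate hτ N e).1 h)]

theorem heightDiff_translate {τ : ℂ} (hτ : G.IsPeriod τ) (N₁ N₂ : G.Config) (z z' : ℂ) :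
    G.heightDiff (G.translate hτ N₁) (G.translate hτ N₂) (z + τ) (z' + τ)
      = G.heightDiff N₁ N₂ z z' := by
  unfold heightDiff
  rw [← finsum_comp_equiv (shiftEquiv τ)]
  refine finsum_congr fun e => ?_
  change (G.flow _ (shiftEdge τ e) - G.flow _ (shiftEdge τ e)) * edgeCrossing (shiftEdge τ e) _ _ = _
  rw [flow_translate, flow_translate, edgeCrossing_shiftEdge]

theorem head_mem_polyCarrier {e : List ℂ} (he : e ∈ G.edges) {v : ℂ} (hv : e.head? = some v) :
    v ∈ polyCarrier e := by
  have h2 := (G.arc e he).two_le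
  rcases e with _ | ⟨a, _ | ⟨b, l⟩⟩
  · simp at h2
  · simp at h2
  · simp only [List.head?_cons, Option.some.injEq] at hv
    exact mem_polyCarrier.2 ⟨(a, b), by simp [segmentList], hv ▸ left_mem_segment _ _ _⟩

theorem getLast_mem_polyCarrier {e : List ℂ} (he : e ∈ G.edges) {v : ℂ}
    (hv : e.getLast? = some v) : v ∈ polyCarrier e := by
  have h2 := (G.arc e he).two_le
  clear he
  induction e with
  | nil => simp at h2
  | cons a l ih =>
    rcases l with _ | ⟨b, _ | ⟨c, l⟩⟩
    · simp at h2
    · simp only [List.getLast?_cons_cons, List.getLast?_singleton, Option.some.injEq] at hv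
      exact mem_polyCarrier.2 ⟨(a, b), by simp [segmentList], hv ▸ right_mem_segment _ _ _⟩
    · rw [List.getLast?_cons_cons] at hv
      obtain ⟨s, hs, h⟩ := mem_polyCarrier.1 (ih hv (by simp))
      refine mem_polyCarrier.2 ⟨s, ?_, h⟩
      simp only [segmentList, List.tail_cons, List.zip_cons_cons] at hs ⊢
      exact List.mem_cons_of_mem _ hs

theorem mem_polyCarrier_of_isEndpoint {e : List ℂ} (he : e ∈ G.edges) {v : ℂ}
    (hv : IsEndpoint v e) : v ∈ polyCarrier e :=
  hv.elim (head_mem_polyCarrier he) (getLast_mem_polyCarrier he)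

/-- The black endpoint of an edge. -/
noncomputable def blackEnd (e : List ℂ) : ℂ := e.head?.getD 0

/-- The white endpoint of an edge. -/
noncomputable def whiteEnd (e : List ℂ) : ℂ := e.getLast?.getD 0

theorem head?_eq_blackEnd {e : List ℂ} (he : e ∈ G.edges) : e.head? = some (blackEnd e) := by
  obtain ⟨b, -, h⟩ := G.head_black e he
  simp [blackEnd, h]

theorem getLast?_eq_whiteEnd {e : List ℂ} (he : e ∈ G.edges) :
    e.getLast? = some (whiteEnd e) := by
  obtain ⟨b, -, h⟩ := G.last_white e he
  simp [whiteEnd, h]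

theorem blackEnd_mem {e : List ℂ} (he : e ∈ G.edges) : blackEnd e ∈ G.black := by
  obtain ⟨b, hb, h⟩ := G.head_black e he
  simpa [blackEnd, h] using hb

theorem whiteEnd_mem {e : List ℂ} (he : e ∈ G.edges) : whiteEnd e ∈ G.white := by
  obtain ⟨b, hb, h⟩ := G.last_white e he
  simpa [whiteEnd, h] using hb

theorem blackEnd_eq_of_isEndpoint {e : List ℂ} (he : e ∈ G.edges) {v : ℂ} (hv : v ∈ G.black)
    (h : IsEndpoint v e) : blackEnd e = v := by
  rcases h with h | h
  · simp [blackEnd, h]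
  · have := whiteEnd_mem he
    rw [show whiteEnd e = v by simp [whiteEnd, h]] at this
    exact absurd this (Set.disjoint_left.1 G.disjoint_colors hv)

theorem whiteEnd_eq_of_isEndpoint {e : List ℂ} (he : e ∈ G.edges) {v : ℂ} (hv : v ∈ G.white)
    (h : IsEndpoint v e) : whiteEnd e = v := by
  rcases h with h | h
  · have := blackEnd_mem he
    rw [show blackEnd e = v by simp [blackEnd, h]] at this
    exact absurd hv (Set.disjoint_left.1 G.disjoint_colors this)
  · simp [whiteEnd, h]

theorem isEndpoint_blackEnd {e : List ℂ} (he : e ∈ G.edges) : IsEndpoint (blackEnd e) e :=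
  Or.inl (head?_eq_blackEnd he)

theorem isEndpoint_whiteEnd {e : List ℂ} (he : e ∈ G.edges) : IsEndpoint (whiteEnd e) e :=
  Or.inr (getLast?_eq_whiteEnd he)

/-- The flow of the difference of two dimer configurations has no divergence at the vertices
of a given colour. -/
theorem sum_flow_sub_flow_mul_eq_zero (N₁ N₂ : G.Config) (E : Finset (List ℂ)) (T : ℂ → ℝ)
    (p : List ℂ → ℂ) (C : Set ℂ) (hC : C ⊆ G.black ∪ G.white)
    (hp : ∀ e ∈ G.edges, p e ∈ C ∧ IsEndpoint (p e) e)
    (hp' : ∀ e ∈ G.edges, ∀ v ∈ C, IsEndpoint v e → p e = v) (hE' : ↑E ⊆ G.edges)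
    (hE : ∀ v ∈ C, T v ≠ 0 → ∀ e, G.flow N₁ e ≠ G.flow N₂ e → IsEndpoint v e → e ∈ E) :
    ∑ e ∈ E, (G.flow N₁ e - G.flow N₂ e) * T (p e) = 0 := by
  classical
  rw [← Finset.sum_fiberwise_of_maps_to (t := E.image p) (g := p)
    fun e he => Finset.mem_image_of_mem _ he]
  refine Finset.sum_eq_zero fun v hv => ?_
  obtain ⟨e₀, he₀, rfl⟩ := Finset.mem_image.1 hv
  set v := p e₀ with hvdef
  have hvC : v ∈ C := (hp e₀ (hE' he₀)).1
  have e1 : ∑ e ∈ E with p e = v, (G.flow N₁ e - G.flow N₂ e) * T (p e)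
      = (∑ e ∈ E with p e = v, (G.flow N₁ e - G.flow N₂ e)) * T v := by
    rw [Finset.sum_mul]
    refine Finset.sum_congr rfl fun e he => ?_
    rw [(Finset.mem_filter.1 he).2]
  rw [e1]
  by_cases hT : T v = 0
  · rw [hT, mul_zero]
  -- Each configuration uses exactly one edge at v. If the two edges coincide their contributions
  -- cancel; otherwise both belong to the symmetric difference, so `hE` puts both in E and the sums
  -- are 1 - 1.
  have hsum : ∀ N : G.Config, ∀ e', e' ∈ N.1 → IsEndpoint v e' →
      ∑ e ∈ E with p e = v, G.flow N e = if e' ∈ E then 1 else 0 := by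
    intro N e' he' hv'
    have hpe : p e' = v := hp' e' (N.2.1 he') v hvC hv'
    have huniq : ∀ e ∈ E.filter (fun e => p e = v), e ≠ e' → G.flow N e = 0 := by
      intro e he hne
      rw [Finset.mem_filter] at he
      refine flow_eq_zero_of_notMem fun h => hne ?_
      have hve : IsEndpoint v e := he.2 ▸ (hp e (hE' he.1)).2
      exact (N.2.2 v (hC hvC)).unique ⟨h, hve⟩ ⟨he', hv'⟩
    split_ifs with hmem
    · rw [Finset.sum_eq_single_of_mem e' (Finset.mem_filter.2 ⟨hmem, hpe⟩) huniq,
        flow_eq_one_of_mem he']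
    · exact Finset.sum_eq_zero fun e he => huniq e he fun h =>
        hmem (h ▸ (Finset.mem_filter.1 he).1)
  obtain ⟨e₁, ⟨h₁, hv₁⟩, -⟩ := N₁.2.2 v (hC hvC)
  obtain ⟨e₂, ⟨h₂, hv₂⟩, -⟩ := N₂.2.2 v (hC hvC)
  rw [Finset.sum_sub_distrib, hsum N₁ e₁ h₁ hv₁, hsum N₂ e₂ h₂ hv₂]
  by_cases h : e₁ = e₂
  · simp [h]
  have g₁ : e₁ ∈ E := by
    refine hE v hvC hT e₁ (fun hf => h ?_) hv₁
    exact (N₂.2.2 v (hC hvC)).unique ⟨(flow_eq_flow_iff.1 hf).1 h₁, hv₁⟩ ⟨h₂, hv₂⟩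
  have g₂ : e₂ ∈ E := by
    refine hE v hvC hT e₂ (fun hf => h ?_) hv₂
    exact (N₁.2.2 v (hC hvC)).unique ⟨h₁, hv₁⟩ ⟨(flow_eq_flow_iff.1 hf).2 h₂, hv₂⟩
  simp [g₁, g₂]

theorem sum_flow_sub_flow_mul_ends_eq_zero (N₁ N₂ : G.Config) (E : Finset (List ℂ)) (T : ℂ → ℝ)
    (hE' : ↑E ⊆ G.edges) (hE : ∀ v ∈ G.black ∪ G.white, T v ≠ 0 → ∀ e,
      G.flow N₁ e ≠ G.flow N₂ e → IsEndpoint v e → e ∈ E) :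
    ∑ e ∈ E, (G.flow N₁ e - G.flow N₂ e) * (T (whiteEnd e) - T (blackEnd e)) = 0 := by
  simp only [mul_sub, Finset.sum_sub_distrib]
  rw [sum_flow_sub_flow_mul_eq_zero N₁ N₂ E T whiteEnd G.white Set.subset_union_right
      (fun e he => ⟨whiteEnd_mem he, isEndpoint_whiteEnd he⟩)
      (fun e he v hv h => whiteEnd_eq_of_isEndpoint he hv h) hE'
      (fun v hv => hE v (Or.inr hv)),
    sum_flow_sub_flow_mul_eq_zero N₁ N₂ E T blackEnd G.black Set.subset_union_left
      (fun e he => ⟨blackEnd_mem he, isEndpoint_blackEnd he⟩)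
      (fun e he v hv h => blackEnd_eq_of_isEndpoint he hv h) hE'
      (fun v hv => hE v (Or.inl hv)), sub_zero]

/-- Around a triangle the turning terms cancel and only the function T of the end vertices remains,
which the divergence-free flow kills. T vanishes at vertices farther out than the corners of the
triangle, so the finite set of edges meeting the ball contains every relevant edge at the other
vertices. -/
theorem heightDiff_cocycle (N₁ N₂ : G.Config) (z z' z'' : ℂ) :
    G.heightDiff N₁ N₂ z z' + G.heightDiff N₁ N₂ z' z'' + G.heightDiff N₁ N₂ z'' z = 0 := by
  set ρ := max ‖z‖ (max ‖z'‖ ‖z''‖) with hρ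
  have h1 : ‖z‖ ≤ ρ := le_max_left _ _
  have h2 : ‖z'‖ ≤ ρ := (le_max_left _ _).trans (le_max_right _ _)
  have h3 : ‖z''‖ ≤ ρ := (le_max_right _ _).trans (le_max_right _ _)
  set T : ℂ → ℝ := fun p => symmArg ((p - z) / (p - z')) + symmArg ((p - z') / (p - z''))
      + symmArg ((p - z'') / (p - z)) with hT
  have hsub : ↑(G.edgesMeeting ρ) ⊆ G.edges := fun e he => ((G.mem_edgesMeeting).1 he).1
  have key := sum_flow_sub_flow_mul_ends_eq_zero N₁ N₂ (G.edgesMeeting ρ) T hsub (by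
    intro v _ hTv e he hve
    have heG := mem_edges_of_flow_ne he
    refine (G.mem_edgesMeeting).2 ⟨heG, v, mem_polyCarrier_of_isEndpoint heG hve, ?_⟩
    rw [mem_closedBall_zero_iff]
    by_contra! hlt
    exact hTv (symmArg_cocycle_of_norm_lt (h1.trans_lt hlt) (h2.trans_lt hlt) (h3.trans_lt hlt)))
  rw [heightDiff_eq_sum_edgesMeeting N₁ N₂ h1 h2, heightDiff_eq_sum_edgesMeeting N₁ N₂ h2 h3,
    heightDiff_eq_sum_edgesMeeting N₁ N₂ h3 h1, ← Finset.sum_add_distrib,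
    ← Finset.sum_add_distrib]
  have hpi : (2 * Real.pi) ≠ 0 := by positivity
  refine (mul_eq_zero.1 ?_).resolve_right hpi
  rw [Finset.sum_mul, ← neg_eq_zero, ← Finset.sum_neg_distrib, ← key]
  refine Finset.sum_congr rfl fun e he => ?_
  have hb := head?_eq_blackEnd (hsub he)
  have hw := getLast?_eq_whiteEnd (hsub he)
  have c1 := edgeCrossing_eq_edgeTurn hb hw z z'
  have c2 := edgeCrossing_eq_edgeTurn hb hw z' z''
  have c3 := edgeCrossing_eq_edgeTurn hb hw z'' z
  simp only [hT]
  linear_combination (-(G.flow N₁ e - G.flow N₂ e)) * (c1 + c2 + c3)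

theorem heightDiff_trans (N₁ N₂ : G.Config) (z z' z'' : ℂ) :
    G.heightDiff N₁ N₂ z z' + G.heightDiff N₁ N₂ z' z'' = G.heightDiff N₁ N₂ z z'' := by
  have h := heightDiff_cocycle N₁ N₂ z z' z''
  rw [heightDiff_symm N₁ N₂ z z''] at h
  linarith

end PlaneBipartiteGraph

/-! ### Pieces of a polygonal arc around a corner -/

theorem mem_segmentList_iff_getElem {e : List ℂ} {s : ℂ × ℂ} :
    s ∈ segmentList e ↔ ∃ i, ∃ h : i + 1 < e.length, s = (e[i], e[i + 1]) := by
  unfold segmentList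
  rw [List.mem_iff_getElem]
  constructor
  · rintro ⟨i, hi, rfl⟩
    simp only [List.length_zip, List.length_tail, lt_inf_iff] at hi
    exact ⟨i, by omega, by simp⟩
  · rintro ⟨i, hi, rfl⟩
    exact ⟨i, by simp; omega, by simp⟩

theorem idxOf_snd_eq {e : List ℂ} (he : e.Nodup) {s : ℂ × ℂ} (hs : s ∈ segmentList e) :
    e.idxOf s.2 = e.idxOf s.1 + 1 := by
  obtain ⟨i, hi, rfl⟩ := mem_segmentList_iff_getElem.1 hs
  simp only
  rw [he.idxOf_getElem, he.idxOf_getElem]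

theorem segment_ext_of_snd_eq {e : List ℂ} (he : e.Nodup) {s t : ℂ × ℂ} (hs : s ∈ segmentList e)
    (ht : t ∈ segmentList e) (h : s.2 = t.2) : s = t := by
  have h1 := idxOf_snd_eq he hs
  have h2 := idxOf_snd_eq he ht
  rw [h] at h1
  exact Prod.ext ((List.idxOf_inj (fst_mem_of_mem_segmentList hs)).1 (by omega)) h

theorem segment_ext_of_fst_eq {e : List ℂ} (he : e.Nodup) {s t : ℂ × ℂ} (hs : s ∈ segmentList e)
    (ht : t ∈ segmentList e) (h : s.1 = t.1) : s = t := by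
  have h1 := idxOf_snd_eq he hs
  have h2 := idxOf_snd_eq he ht
  rw [h] at h1
  exact Prod.ext h ((List.idxOf_inj (snd_mem_of_mem_segmentList hs)).1 (by omega))

theorem fst_ne_snd_of_mem {e : List ℂ} (he : e.Nodup) {s : ℂ × ℂ} (hs : s ∈ segmentList e) :
    s.1 ≠ s.2 := by
  intro h
  have := idxOf_snd_eq he hs
  rw [h] at this
  omega

theorem snd_ne_of_head {e : List ℂ} (he : e.Nodup) {v : ℂ} (hv : e.head? = some v) {s : ℂ × ℂ}
    (hs : s ∈ segmentList e) : s.2 ≠ v := by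
  intro h
  have := idxOf_snd_eq he hs
  rw [h] at this
  cases e with
  | nil => simp at hv
  | cons a l =>
    simp only [List.head?_cons, Option.some.injEq] at hv
    subst hv
    simp at this

theorem fst_ne_of_getLast {e : List ℂ} (he : e.Nodup) {v : ℂ} (hv : e.getLast? = some v)
    {s : ℂ × ℂ} (hs : s ∈ segmentList e) : s.1 ≠ v := by
  intro h
  obtain ⟨i, hi, rfl⟩ := mem_segmentList_iff_getElem.1 hs
  rw [List.getLast?_eq_getElem?] at hv
  obtain ⟨h', hv⟩ := List.getElem?_eq_some_iff.1 hv
  have := (he.getElem_inj_iff).1 (h.trans hv.symm)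
  omega

theorem exists_mem_segmentList_fst {e : List ℂ} (h2 : 2 ≤ e.length) {v : ℂ}
    (hv : e.head? = some v) : ∃ b, (v, b) ∈ segmentList e := by
  rcases e with _ | ⟨a, _ | ⟨b, l⟩⟩
  · simp at h2
  · simp at h2
  · simp only [List.head?_cons, Option.some.injEq] at hv
    exact ⟨b, by simp [segmentList, hv]⟩

theorem exists_mem_segmentList_snd {e : List ℂ} (h2 : 2 ≤ e.length) {v : ℂ}
    (hv : e.getLast? = some v) : ∃ b, (b, v) ∈ segmentList e := by
  rw [List.getLast?_eq_getElem?] at hv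
  obtain ⟨h', hv⟩ := List.getElem?_eq_some_iff.1 hv
  refine ⟨e[e.length - 2], mem_segmentList_iff_getElem.2 ⟨e.length - 2, by omega, ?_⟩⟩
  rw [← hv]
  congr 2
  omega

theorem exists_segments_of_interior {e : List ℂ} {v : ℂ} (hv : v ∈ e) (hn : ¬ IsEndpoint v e) :
    ∃ b₁ b₂, (b₁, v) ∈ segmentList e ∧ (v, b₂) ∈ segmentList e := by
  obtain ⟨i, hi, rfl⟩ := List.mem_iff_getElem.1 hv
  unfold IsEndpoint at hn
  rw [not_or, List.head?_eq_getElem?, List.getLast?_eq_getElem?] at hn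
  have h0 : i ≠ 0 := by
    rintro rfl
    exact hn.1 (List.getElem?_eq_getElem hi)
  have h1 : i ≠ e.length - 1 := by
    intro h
    apply hn.2
    rw [List.getElem?_eq_getElem (by omega)]
    simp [h]
  obtain ⟨j, rfl⟩ : ∃ j, i = j + 1 := ⟨i - 1, by omega⟩
  exact ⟨e[j], e[j + 1 + 1], mem_segmentList_iff_getElem.2 ⟨j, by omega, rfl⟩,
    mem_segmentList_iff_getElem.2 ⟨j + 1, by omega, rfl⟩⟩

theorem mem_of_isEndpoint {e : List ℂ} {v : ℂ} (h : IsEndpoint v e) : v ∈ e :=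
  h.elim List.mem_of_head? List.mem_of_getLast?

theorem exists_segment_at {e : List ℂ} (h2 : 2 ≤ e.length) {v : ℂ} (hv : v ∈ e) :
    ∃ s ∈ segmentList e, v = s.1 ∨ v = s.2 := by
  by_cases h : IsEndpoint v e
  · rcases h with h | h
    · obtain ⟨b, hb⟩ := exists_mem_segmentList_fst h2 h
      exact ⟨_, hb, Or.inl rfl⟩
    · obtain ⟨b, hb⟩ := exists_mem_segmentList_snd h2 h
      exact ⟨_, hb, Or.inr rfl⟩
  · obtain ⟨b, -, hb, -⟩ := exists_segments_of_interior hv h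
    exact ⟨_, hb, Or.inr rfl⟩

theorem mem_ends_of_mem_segment {e : List ℂ} (he : IsPolyArc e) {v : ℂ} (hv : v ∈ e)
    {s : ℂ × ℂ} (hs : s ∈ segmentList e) (h : v ∈ segment ℝ s.1 s.2) : v = s.1 ∨ v = s.2 := by
  obtain ⟨t, ht, hvt⟩ := exists_segment_at he.two_le hv
  by_cases hst : s = t
  · exact hst ▸ hvt
  · have hv' : v ∈ segment ℝ t.1 t.2 := by
      rcases hvt with h | h <;> rw [h]
      · exact left_mem_segment _ _ _
      · exact right_mem_segment _ _ _
    simpa using (he.simple s (mem_segmentList.1 hs) t (mem_segmentList.1 ht) hst ⟨h, hv'⟩).1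

theorem notMem_segment_of_mem_openSegment {a v z : ℂ} (h : a ≠ v)
    (hz : z ∈ openSegment ℝ a v) : a ∉ segment ℝ z v := by
  obtain ⟨t, ht0, ht1, rfl⟩ := mem_openSegment_complex hz
  rintro ⟨x, y, hx, hy, hxy, he⟩
  simp only [Complex.real_smul] at he
  have hy' : (y : ℂ) = 1 - x := by
    rw [eq_sub_iff_add_eq, add_comm]; exact_mod_cast hxy
  have : ((1 - x * (1 - t) : ℝ) : ℂ) * (v - a) = 0 := by
    push_cast
    linear_combination he - v * hy'
  rcases mul_eq_zero.1 this with h' | h'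
  · have : 1 - x * (1 - t) = 0 := by exact_mod_cast h'
    nlinarith
  · exact h (sub_eq_zero.1 h').symm

/-- A point of the open straight piece `s`. -/
noncomputable def segmentMid (s : ℂ × ℂ) : ℂ := midpoint ℝ s.1 s.2

theorem segmentMid_mem (s : ℂ × ℂ) : segmentMid s ∈ openSegment ℝ s.1 s.2 :=
  midpoint_mem_openSegment _ _

/-! ### Constancy of the height difference along the symmetric difference -/

namespace PlaneBipartiteGraph

variable {G : PlaneBipartiteGraph}

/-- Half a piece, from its midpoint to its end v, can meet the other pieces only at v, because arcs
are simple and edges meet only at vertices. Only pieces ending at v are therefore crossed by it. -/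
theorem snd_or_fst_of_meets_half {e e' : List ℂ} (he : e ∈ G.edges) (he' : e' ∈ G.edges)
    {s t : ℂ × ℂ} (hs : s ∈ segmentList e) (ht : t ∈ segmentList e') {v : ℂ}
    (hv : v = s.1 ∨ v = s.2)
    (h : (segment ℝ t.1 t.2 ∩ segment ℝ (segmentMid s) v).Nonempty) : v = t.1 ∨ v = t.2 := by
  obtain ⟨x, hxt, hx⟩ := h
  have arc := G.arc e he
  have arc' := G.arc e' he'
  have hne := fst_ne_snd_of_mem arc.nodup hs
  have hmid := segmentMid_mem s
  have hvs : v ∈ segment ℝ s.1 s.2 := by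
    rcases hv with rfl | rfl
    exacts [left_mem_segment _ _ _, right_mem_segment _ _ _]
  have hxs : x ∈ segment ℝ s.1 s.2 := (convex_segment s.1 s.2).segment_subset
    (openSegment_subset_segment _ _ _ hmid) hvs hx
  have hxv : x = s.1 ∨ x = s.2 → x = v := by
    rcases hv with rfl | rfl
    · rintro (h | h)
      · exact h
      · rw [openSegment_symm] at hmid
        exact absurd (h ▸ hx) (notMem_segment_of_mem_openSegment hne.symm hmid)
    · rintro (h | h)
      · exact absurd (h ▸ hx) (notMem_segment_of_mem_openSegment hne hmid)
      · exact h
  by_cases hee : e' = e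
  · subst hee
    by_cases hst : t = s
    · rw [hst]; exact hv
    · have := arc.simple t (mem_segmentList.1 ht) s (mem_segmentList.1 hs) hst ⟨hxt, hxs⟩
      have h1 : x = v := hxv (by simpa using this.2)
      rw [← h1]
      simpa using this.1
  · have hxe := segment_subset_polyCarrier hs hxs
    have hxe' := segment_subset_polyCarrier ht hxt
    have hV := G.edges_inter e' he' e he hee ⟨hxe', hxe⟩
    have h1 : x = v := hxv (mem_ends_of_mem_segment arc
      (mem_of_isEndpoint (G.vertex_on_edge e he x hV hxe)) hs hxs)
    rw [← h1]
    exact mem_ends_of_mem_segment arc'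
      (mem_of_isEndpoint (G.vertex_on_edge e' he' x hV hxe')) ht hxt

theorem heightDiff_mid_eq_sum {N₁ N₂ : G.Config} {e : List ℂ} (he : e ∈ G.edges) {s : ℂ × ℂ}
    (hs : s ∈ segmentList e) {v : ℂ} (hv : v = s.1 ∨ v = s.2) (E : Finset (List ℂ))
    (hE : ↑E ⊆ G.edges) (F : List ℂ → Finset (ℂ × ℂ))
    (hF : ∀ e' ∈ E, ∀ t ∈ F e', t ∈ segmentList e')
    (h : ∀ e' ∈ G.edges, G.flow N₁ e' ≠ G.flow N₂ e' → ∀ t ∈ segmentList e', v = t.1 ∨ v = t.2 →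
      e' ∈ E)
    (h' : ∀ e' ∈ E, ∀ t ∈ segmentList e', v = t.1 ∨ v = t.2 → t ∈ F e') :
    G.heightDiff N₁ N₂ (segmentMid s) v = ∑ e' ∈ E, (G.flow N₁ e' - G.flow N₂ e')
      * ∑ t ∈ F e', crossing t.1 t.2 (segmentMid s) v := by
  rw [heightDiff_eq_sum E]
  · refine Finset.sum_congr rfl fun e' he' => ?_
    rw [edgeCrossing_eq_sum (G.arc e' (hE he')).nodup (F e') (hF e' he')]
    intro t ht htF
    rw [Set.disjoint_iff_inter_eq_empty, ← Set.not_nonempty_iff_eq_empty]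
    exact fun hn => htF (h' e' he' t ht (snd_or_fst_of_meets_half he (hE he') hs ht hv hn))
  · rintro e' hf ⟨x, hx, hxs⟩
    have he' := mem_edges_of_flow_ne hf
    obtain ⟨t, ht, hxt⟩ := mem_polyCarrier.1 hx
    exact h e' he' hf t ht (snd_or_fst_of_meets_half he he' hs ht hv ⟨x, hxt, hxs⟩)

theorem mem_polyCarrier_of_mem {e : List ℂ} (he : e ∈ G.edges) {v : ℂ} (hv : v ∈ e) :
    v ∈ polyCarrier e := by
  obtain ⟨s, hs, h⟩ := exists_segment_at (G.arc e he).two_le hv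
  refine mem_polyCarrier.2 ⟨s, hs, ?_⟩
  rcases h with rfl | rfl
  exacts [left_mem_segment _ _ _, right_mem_segment _ _ _]

theorem mem_of_eq_or_eq {e : List ℂ} {s : ℂ × ℂ} (hs : s ∈ segmentList e) {v : ℂ}
    (hv : v = s.1 ∨ v = s.2) : v ∈ e := by
  rcases hv with rfl | rfl
  exacts [fst_mem_of_mem_segmentList hs, snd_mem_of_mem_segmentList hs]

theorem isEndpoint_mem_vertices {e : List ℂ} (he : e ∈ G.edges) {v : ℂ} (h : IsEndpoint v e) :
    v ∈ G.black ∪ G.white := by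
  rcases h with h | h
  · obtain ⟨b, hb, h'⟩ := G.head_black e he
    rw [h] at h'
    exact Or.inl (Option.some_injective _ h' ▸ hb)
  · obtain ⟨b, hb, h'⟩ := G.last_white e he
    rw [h] at h'
    exact Or.inr (Option.some_injective _ h' ▸ hb)

theorem abs_symmArg_div_two_pi_le (q : ℂ) : |symmArg q / (2 * Real.pi)| ≤ 1 := by
  have hp := Real.pi_pos
  rw [abs_div, abs_of_pos (by positivity : (0 : ℝ) < 2 * Real.pi), div_le_one (by positivity)]
  linarith [abs_symmArg_le q]

/-- At a bend that is not a vertex, just two pieces of one edge meet, and the corner computation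
gives the same value from either side. -/
theorem exists_heightDiff_mid_eq_of_interior {N₁ N₂ : G.Config} {e : List ℂ} (he : e ∈ G.edges)
    {v : ℂ} (hv : v ∈ e) (hend : ¬ IsEndpoint v e) :
    ∃ k : ℝ, |k| ≤ 1 ∧ ∀ e', G.flow N₁ e' ≠ G.flow N₂ e' → ∀ s ∈ segmentList e',
      v = s.1 ∨ v = s.2 → G.heightDiff N₁ N₂ (segmentMid s) v = k := by
  obtain ⟨b₁, b₂, h₁, h₂⟩ := exists_segments_of_interior hv hend
  have arc := G.arc e he
  have hslit : (b₂ - v) / (v - b₁) ∈ Complex.slitPlane := by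
    apply div_mem_slitPlane_of_segment_inter (fst_ne_snd_of_mem arc.nodup h₁)
      (fst_ne_snd_of_mem arc.nodup h₂).symm
    have hne : ((b₁, v) : ℂ × ℂ) ≠ (v, b₂) := fun h =>
      fst_ne_snd_of_mem arc.nodup h₁ (congrArg Prod.fst h)
    refine (arc.simple _ (mem_segmentList.1 h₁) _ (mem_segmentList.1 h₂) hne).trans ?_
    rintro x ⟨hx, hx'⟩
    simp only [Set.mem_insert_iff, Set.mem_singleton_iff] at hx hx' ⊢
    rcases hx with rfl | hx
    · rcases hx' with hx' | rfl
      · exact hx'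
      · have i1 := idxOf_snd_eq arc.nodup h₁
        have i2 := idxOf_snd_eq arc.nodup h₂
        simp only at i1 i2
        omega
    · exact hx
  have hall : ∀ e', e' ∈ G.edges → ∀ s ∈ segmentList e', v = s.1 ∨ v = s.2 → e' = e := by
    intro e' he' s hs hvs
    by_contra hne
    have hvc := mem_polyCarrier_of_mem he hv
    have := G.edges_inter e' he' e he hne
      ⟨mem_polyCarrier_of_mem he' (mem_of_eq_or_eq hs hvs), hvc⟩
    exact hend (G.vertex_on_edge e he v this hvc)
  have hseg : ∀ s ∈ segmentList e, v = s.1 ∨ v = s.2 → s = (b₁, v) ∨ s = (v, b₂) := by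
    rintro s hs (h | h)
    · exact Or.inr (segment_ext_of_fst_eq arc.nodup hs h₂ h.symm)
    · exact Or.inl (segment_ext_of_snd_eq arc.nodup hs h₁ h.symm)
  refine ⟨(G.flow N₁ e - G.flow N₂ e) * (symmArg ((b₂ - v) / (v - b₁)) / (2 * Real.pi)), ?_, ?_⟩
  · rw [abs_mul]
    exact mul_le_one₀ (G.abs_flow_sub_flow_le N₁ N₂ e) (abs_nonneg _)
      (abs_symmArg_div_two_pi_le _)
  · intro e' hf s hs hvs
    obtain rfl := hall e' (mem_edges_of_flow_ne hf) s hs hvs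
    classical
    rw [heightDiff_mid_eq_sum he hs hvs {e'} (by simpa using he)
      (fun _ => {(b₁, v), (v, b₂)})
      (by
        intro e'' he'' t ht
        rw [Finset.mem_singleton] at he''
        subst he''
        simp only [Finset.mem_insert, Finset.mem_singleton] at ht
        rcases ht with rfl | rfl <;> assumption)
      (by
        intro e'' he'' _ t ht hvt
        rw [Finset.mem_singleton]
        exact hall e'' he'' t ht hvt)
      (by
        intro e'' he'' t ht hvt
        rw [Finset.mem_singleton] at he''
        subst he''
        simpa using hseg t ht hvt)]
    have hne : ((b₁, v) : ℂ × ℂ) ≠ (v, b₂) := fun h =>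
      fst_ne_snd_of_mem arc.nodup h₁ (congrArg Prod.fst h)
    rw [Finset.sum_singleton, Finset.sum_pair hne]
    congr 1
    rcases hseg s hs hvs with rfl | rfl
    · exact crossing_corner_left hslit (segmentMid_mem (b₁, v))
    · exact crossing_corner_right hslit (segmentMid_mem (v, b₂))

/-- At a vertex the symmetric difference consists of exactly one edge of each configuration. They
carry opposite signs but also have the same orientation relative to v, so together they behave like
one path turning at v. -/
theorem exists_heightDiff_mid_eq_of_isEndpoint {N₁ N₂ : G.Config} {e : List ℂ}
    (hf : G.flow N₁ e ≠ G.flow N₂ e) {v : ℂ} (hend : IsEndpoint v e) :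
    ∃ k : ℝ, |k| ≤ 1 ∧ ∀ e', G.flow N₁ e' ≠ G.flow N₂ e' → ∀ s ∈ segmentList e',
      v = s.1 ∨ v = s.2 → G.heightDiff N₁ N₂ (segmentMid s) v = k := by
  classical
  have he := mem_edges_of_flow_ne hf
  have hV := isEndpoint_mem_vertices he hend
  obtain ⟨e₁, ⟨h₁, hv₁⟩, hu₁⟩ := N₁.2.2 v hV
  obtain ⟨e₂, ⟨h₂, hv₂⟩, hu₂⟩ := N₂.2.2 v hV
  have hall : ∀ e', G.flow N₁ e' ≠ G.flow N₂ e' → IsEndpoint v e' → e' = e₁ ∨ e' = e₂ := by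
    intro e' hf' hv'
    by_cases h : e' ∈ N₁.1
    · exact Or.inl (hu₁ e' ⟨h, hv'⟩)
    · by_cases h' : e' ∈ N₂.1
      · exact Or.inr (hu₂ e' ⟨h', hv'⟩)
      · exact absurd (flow_eq_flow_iff.2 (by tauto)) hf'
  have hne : e₁ ≠ e₂ := by
    rintro rfl
    have : e = e₁ := by rcases hall e hf hend with h | h <;> exact h
    subst this
    exact hf (flow_eq_flow_iff.2 (by tauto))
  have hn₁ : e₁ ∉ N₂.1 := fun h => hne (hu₂ e₁ ⟨h, hv₁⟩)
  have hn₂ : e₂ ∉ N₁.1 := fun h => hne (hu₁ e₂ ⟨h, hv₂⟩).symm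
  have g₁ := N₁.2.1 h₁
  have g₂ := N₂.2.1 h₂
  have arc₁ := G.arc e₁ g₁
  have arc₂ := G.arc e₂ g₂
  -- the general conclusion once the end pieces at `v` are known
  have main : ∀ (b₁ b₂ : ℂ) (s₁ s₂ : ℂ × ℂ) (c : ℝ), |c| ≤ 1 →
      (s₁ ∈ segmentList e₁) → (s₂ ∈ segmentList e₂) →
      (b₁ = s₁.1 ∧ v = s₁.2 ∨ v = s₁.1 ∧ b₁ = s₁.2) →
      (b₂ = s₂.1 ∧ v = s₂.2 ∨ v = s₂.1 ∧ b₂ = s₂.2) →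
      (∀ s ∈ segmentList e₁, v = s.1 ∨ v = s.2 → s = s₁) →
      (∀ s ∈ segmentList e₂, v = s.1 ∨ v = s.2 → s = s₂) →
      (∀ z, crossing s₁.1 s₁.2 z v - crossing s₂.1 s₂.2 z v
        = c * (crossing b₁ v z v + crossing v b₂ z v)) →
      ∃ k : ℝ, |k| ≤ 1 ∧ ∀ e', G.flow N₁ e' ≠ G.flow N₂ e' → ∀ s ∈ segmentList e',
        v = s.1 ∨ v = s.2 → G.heightDiff N₁ N₂ (segmentMid s) v = k := by
    intro b₁ b₂ s₁ s₂ c hc hs₁ hs₂ hb₁ hb₂ hu₁ hu₂ hcr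
    have hS₁ : segment ℝ b₁ v = segment ℝ s₁.1 s₁.2 := by
      rcases hb₁ with ⟨rfl, rfl⟩ | ⟨rfl, rfl⟩
      · rfl
      · exact segment_symm _ _ _
    have hS₂ : segment ℝ v b₂ = segment ℝ s₂.1 s₂.2 := by
      rcases hb₂ with ⟨rfl, rfl⟩ | ⟨rfl, rfl⟩
      · exact segment_symm _ _ _
      · rfl
    have hO₁ : openSegment ℝ b₁ v = openSegment ℝ s₁.1 s₁.2 := by
      rcases hb₁ with ⟨rfl, rfl⟩ | ⟨rfl, rfl⟩
      · rfl
      · exact openSegment_symm _ _ _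
    have hO₂ : openSegment ℝ v b₂ = openSegment ℝ s₂.1 s₂.2 := by
      rcases hb₂ with ⟨rfl, rfl⟩ | ⟨rfl, rfl⟩
      · exact openSegment_symm _ _ _
      · rfl
    have hbv₁ : b₁ ≠ v := by
      have := fst_ne_snd_of_mem arc₁.nodup hs₁
      rcases hb₁ with ⟨rfl, rfl⟩ | ⟨rfl, rfl⟩
      exacts [this, this.symm]
    have hbv₂ : b₂ ≠ v := by
      have := fst_ne_snd_of_mem arc₂.nodup hs₂
      rcases hb₂ with ⟨rfl, rfl⟩ | ⟨rfl, rfl⟩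
      exacts [this, this.symm]
    have hends : ∀ x ∈ segment ℝ b₁ v ∩ segment ℝ v b₂, (x = b₁ ∨ x = v) ∧ (x = b₂ ∨ x = v) := by
      rintro x ⟨hx₁, hx₂⟩
      rw [hS₁] at hx₁
      rw [hS₂] at hx₂
      have hc₁ := segment_subset_polyCarrier hs₁ hx₁
      have hc₂ := segment_subset_polyCarrier hs₂ hx₂
      have hxV := G.edges_inter e₁ g₁ e₂ g₂ hne ⟨hc₁, hc₂⟩
      have m₁ := mem_ends_of_mem_segment arc₁
        (mem_of_isEndpoint (G.vertex_on_edge e₁ g₁ x hxV hc₁)) hs₁ hx₁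
      have m₂ := mem_ends_of_mem_segment arc₂
        (mem_of_isEndpoint (G.vertex_on_edge e₂ g₂ x hxV hc₂)) hs₂ hx₂
      constructor
      · rcases hb₁ with ⟨rfl, rfl⟩ | ⟨rfl, rfl⟩ <;> tauto
      · rcases hb₂ with ⟨rfl, rfl⟩ | ⟨rfl, rfl⟩ <;> tauto
    have hslit : (b₂ - v) / (v - b₁) ∈ Complex.slitPlane := by
      apply div_mem_slitPlane_of_segment_inter hbv₁ hbv₂
      intro x hx
      obtain ⟨h, h'⟩ := hends x hx
      rw [Set.mem_singleton_iff]
      rcases h with rfl | h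
      · rcases h' with rfl | h'
        -- If both pieces ended at the same second point, their common midpoint would lie on both
        -- edges and so be an end, which forces the piece to be degenerate.
        · have hm : midpoint ℝ x v ∈ segment ℝ x v ∩ segment ℝ v x := by
            rw [segment_symm ℝ v x, Set.inter_self]
            exact midpoint_mem_segment _ _
          rcases (hends _ hm).1 with h | h
          · exact (midpoint_eq_left_iff ℝ).1 h
          · exact (midpoint_eq_right_iff ℝ).1 h
        · exact h'
      · exact h
    refine ⟨c * (symmArg ((b₂ - v) / (v - b₁)) / (2 * Real.pi)), ?_, ?_⟩
    · rw [abs_mul]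
      exact mul_le_one₀ hc (abs_nonneg _) (abs_symmArg_div_two_pi_le _)
    · intro e' hf' s hs hvs
      have he' := mem_edges_of_flow_ne hf'
      have hend' : ∀ e'' ∈ G.edges, ∀ t ∈ segmentList e'', v = t.1 ∨ v = t.2 →
          IsEndpoint v e'' := fun e'' he'' t ht hvt =>
        G.vertex_on_edge e'' he'' v hV (mem_polyCarrier_of_mem he'' (mem_of_eq_or_eq ht hvt))
      have hD := heightDiff_mid_eq_sum (N₁ := N₁) (N₂ := N₂) he' hs hvs {e₁, e₂}
        (by
          intro e'' he''
          simp only [Finset.coe_insert, Finset.coe_singleton, Set.mem_insert_iff,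
            Set.mem_singleton_iff] at he''
          rcases he'' with rfl | rfl <;> assumption)
        (fun e'' => if e'' = e₁ then {s₁} else {s₂})
        (by
          intro e'' he'' t ht
          simp only [Finset.mem_insert, Finset.mem_singleton] at he''
          rcases he'' with rfl | rfl
          · simp only [if_true, Finset.mem_singleton] at ht
            rwa [ht]
          · simp only [hne.symm, if_false, Finset.mem_singleton] at ht
            rwa [ht])
        (by
          intro e'' he'' hf'' t ht hvt
          simpa using hall e'' hf'' (hend' e'' he'' t ht hvt))
        (by
          intro e'' he'' t ht hvt
          simp only [Finset.mem_insert, Finset.mem_singleton] at he''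
          rcases he'' with rfl | rfl
          · simpa using hu₁ t ht hvt
          · simpa [hne.symm] using hu₂ t ht hvt)
      rw [hD, Finset.sum_pair hne, if_pos rfl, if_neg hne.symm, Finset.sum_singleton,
        Finset.sum_singleton, flow_eq_one_of_mem h₁, flow_eq_zero_of_notMem hn₁,
        flow_eq_zero_of_notMem hn₂, flow_eq_one_of_mem h₂]
      have e1 : ∀ x y : ℝ, (1 - 0) * x + (0 - 1) * y = x - y := fun x y => by ring
      rw [e1, hcr]
      congr 1
      rcases hall e' hf' (hend' e' he' s hs hvs) with rfl | rfl
      · exact crossing_corner_left hslit (by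
          rw [hO₁, ← hu₁ s hs hvs]; exact segmentMid_mem _)
      · exact crossing_corner_right hslit (by
          rw [hO₂, ← hu₂ s hs hvs]; exact segmentMid_mem _)
  rcases hV with hV | hV
  · have k₁ : e₁.head? = some v := by
      rw [head?_eq_blackEnd g₁, blackEnd_eq_of_isEndpoint g₁ hV hv₁]
    have k₂ : e₂.head? = some v := by
      rw [head?_eq_blackEnd g₂, blackEnd_eq_of_isEndpoint g₂ hV hv₂]
    obtain ⟨b₁, hb₁⟩ := exists_mem_segmentList_fst arc₁.two_le k₁
    obtain ⟨b₂, hb₂⟩ := exists_mem_segmentList_fst arc₂.two_le k₂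
    -- At a black vertex both edges leave v, so traversing through v reverses the edge of the first
    -- configuration: the factor is -1. At a white vertex the reversed edge is the one of the
    -- second, and the factor is 1.
    refine main b₁ b₂ (v, b₁) (v, b₂) (-1) (by simp) hb₁ hb₂ (Or.inr ⟨rfl, rfl⟩)
      (Or.inr ⟨rfl, rfl⟩) ?_ ?_ ?_
    · rintro s hs (h | h)
      · exact segment_ext_of_fst_eq arc₁.nodup hs hb₁ h.symm
      · exact absurd h.symm (snd_ne_of_head arc₁.nodup k₁ hs)
    · rintro s hs (h | h)
      · exact segment_ext_of_fst_eq arc₂.nodup hs hb₂ h.symm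
      · exact absurd h.symm (snd_ne_of_head arc₂.nodup k₂ hs)
    · intro z
      simp only
      rw [crossing_reverse b₁ v]
      ring
  · have k₁ : e₁.getLast? = some v := by
      rw [getLast?_eq_whiteEnd g₁, whiteEnd_eq_of_isEndpoint g₁ hV hv₁]
    have k₂ : e₂.getLast? = some v := by
      rw [getLast?_eq_whiteEnd g₂, whiteEnd_eq_of_isEndpoint g₂ hV hv₂]
    obtain ⟨b₁, hb₁⟩ := exists_mem_segmentList_snd arc₁.two_le k₁
    obtain ⟨b₂, hb₂⟩ := exists_mem_segmentList_snd arc₂.two_le k₂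
    refine main b₁ b₂ (b₁, v) (b₂, v) 1 (by simp) hb₁ hb₂ (Or.inl ⟨rfl, rfl⟩)
      (Or.inl ⟨rfl, rfl⟩) ?_ ?_ ?_
    · rintro s hs (h | h)
      · exact absurd h.symm (fst_ne_of_getLast arc₁.nodup k₁ hs)
      · exact segment_ext_of_snd_eq arc₁.nodup hs hb₁ h.symm
    · rintro s hs (h | h)
      · exact absurd h.symm (fst_ne_of_getLast arc₂.nodup k₂ hs)
      · exact segment_ext_of_snd_eq arc₂.nodup hs hb₂ h.symm
    · intro z
      simp only
      rw [crossing_reverse v b₂]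
      ring

/-- At each corner `v` of the polygonal lines that make up the symmetric difference of two dimer
configurations, the height difference is the same on the pieces that end at `v`. -/
theorem exists_heightDiff_mid_eq {N₁ N₂ : G.Config} {e : List ℂ}
    (hf : G.flow N₁ e ≠ G.flow N₂ e) {v : ℂ} (hv : v ∈ e) :
    ∃ k : ℝ, |k| ≤ 1 ∧ ∀ e', G.flow N₁ e' ≠ G.flow N₂ e' → ∀ s ∈ segmentList e',
      v = s.1 ∨ v = s.2 → G.heightDiff N₁ N₂ (segmentMid s) v = k := by
  by_cases h : IsEndpoint v e
  · exact exists_heightDiff_mid_eq_of_isEndpoint hf h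
  · exact exists_heightDiff_mid_eq_of_interior (mem_edges_of_flow_ne hf) hv h

theorem heightDiff_mid_mid_of_common {N₁ N₂ : G.Config} {e e' : List ℂ}
    (hf : G.flow N₁ e ≠ G.flow N₂ e) (hf' : G.flow N₁ e' ≠ G.flow N₂ e') {s t : ℂ × ℂ}
    (hs : s ∈ segmentList e) (ht : t ∈ segmentList e') {v : ℂ} (hvs : v = s.1 ∨ v = s.2)
    (hvt : v = t.1 ∨ v = t.2) :
    G.heightDiff N₁ N₂ (segmentMid s) (segmentMid t) = 0 := by
  obtain ⟨k, -, hk⟩ := exists_heightDiff_mid_eq hf (mem_of_eq_or_eq hs hvs)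
  rw [← heightDiff_trans N₁ N₂ _ v _, heightDiff_symm N₁ N₂ (segmentMid t) v,
    hk e hf s hs hvs, hk e' hf' t ht hvt, add_neg_cancel]

/-- Consecutive pieces share a corner, so the constancy at corners propagates from the first piece
to all others. -/
theorem heightDiff_mid_mid_of_same {N₁ N₂ : G.Config} {e : List ℂ}
    (hf : G.flow N₁ e ≠ G.flow N₂ e) {s t : ℂ × ℂ} (hs : s ∈ segmentList e)
    (ht : t ∈ segmentList e) : G.heightDiff N₁ N₂ (segmentMid s) (segmentMid t) = 0 := by
  have key : ∀ i (hi : i + 1 < e.length) (h0 : 0 + 1 < e.length),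
      G.heightDiff N₁ N₂ (segmentMid (e[0], e[0 + 1])) (segmentMid (e[i], e[i + 1])) = 0 := by
    intro i
    induction i with
    | zero =>
      intro _ h0
      exact heightDiff_mid_mid_of_common hf hf (mem_segmentList_iff_getElem.2 ⟨0, h0, rfl⟩)
        (mem_segmentList_iff_getElem.2 ⟨0, h0, rfl⟩) (Or.inl rfl) (Or.inl rfl)
    | succ i ih =>
      intro hi h0
      rw [← heightDiff_trans N₁ N₂ _ (segmentMid (e[i], e[i + 1])) _, ih (by omega) h0, zero_add]
      exact heightDiff_mid_mid_of_common hf hf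
        (mem_segmentList_iff_getElem.2 ⟨i, by omega, rfl⟩)
        (mem_segmentList_iff_getElem.2 ⟨i + 1, hi, rfl⟩) (v := e[i + 1]) (Or.inr rfl) (Or.inl rfl)
  obtain ⟨i, hi, rfl⟩ := mem_segmentList_iff_getElem.1 hs
  obtain ⟨j, hj, rfl⟩ := mem_segmentList_iff_getElem.1 ht
  rw [← heightDiff_trans N₁ N₂ _ (segmentMid (e[0], e[0 + 1])) _,
    heightDiff_symm N₁ N₂ (segmentMid (e[0], e[0 + 1])), key i hi (by omega), key j hj (by omega), neg_zero, zero_add]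

/-- Adjacency of edges within the set `S` of edges. -/
def EdgeAdj (G : PlaneBipartiteGraph) (S : Set (List ℂ)) (e e' : List ℂ) : Prop :=
  e ∈ S ∧ e' ∈ S ∧ ∃ v ∈ G.black ∪ G.white, IsEndpoint v e ∧ IsEndpoint v e'

theorem mem_symmDiff_iff_flow_ne {N₁ N₂ : G.Config} {e : List ℂ} :
    e ∈ symmDiff N₁.1 N₂.1 ↔ G.flow N₁ e ≠ G.flow N₂ e := by
  rw [Ne, flow_eq_flow_iff, Set.mem_symmDiff]
  tauto

/-- The height difference is constant along the paths of the symmetric difference. -/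
theorem heightDiff_mid_mid_of_connected {N₁ N₂ : G.Config} {e e' : List ℂ}
    (he : e ∈ symmDiff N₁.1 N₂.1)
    (h : Relation.ReflTransGen (G.EdgeAdj (symmDiff N₁.1 N₂.1)) e e') {s t : ℂ × ℂ}
    (hs : s ∈ segmentList e) (ht : t ∈ segmentList e') :
    G.heightDiff N₁ N₂ (segmentMid s) (segmentMid t) = 0 := by
  induction h generalizing t with
  | refl => exact heightDiff_mid_mid_of_same (mem_symmDiff_iff_flow_ne.1 he) hs ht
  | @tail e₁ e₂ _ h₂ ih =>
    obtain ⟨m₁, m₂, v, -, hv₁, hv₂⟩ := h₂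
    have f₁ := mem_symmDiff_iff_flow_ne.1 m₁
    have f₂ := mem_symmDiff_iff_flow_ne.1 m₂
    have g₁ := mem_edges_of_flow_ne f₁
    have g₂ := mem_edges_of_flow_ne f₂
    obtain ⟨s₁, hs₁, hvs₁⟩ := exists_segment_at (G.arc e₁ g₁).two_le (mem_of_isEndpoint hv₁)
    obtain ⟨s₂, hs₂, hvs₂⟩ := exists_segment_at (G.arc e₂ g₂).two_le (mem_of_isEndpoint hv₂)
    rw [← heightDiff_trans N₁ N₂ _ (segmentMid s₁) _, ih hs₁, zero_add,
      ← heightDiff_trans N₁ N₂ _ (segmentMid s₂) _,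
      heightDiff_mid_mid_of_common f₁ f₂ hs₁ hs₂ hvs₁ hvs₂,
      heightDiff_mid_mid_of_same f₂ hs₂ ht, zero_add]

/-! ### The local height function, zero outside the ball -/

theorem polyCarrier_nonempty {e : List ℂ} (he : e ∈ G.edges) : (polyCarrier e).Nonempty :=
  ⟨_, mem_polyCarrier_of_isEndpoint he (isEndpoint_blackEnd he)⟩

theorem finite_innerEdges (G : PlaneBipartiteGraph) (R : ℝ) : (G.innerEdges R).Finite := by
  refine (G.finite_edges R).subset fun e he => ⟨he.1, ?_⟩
  obtain ⟨x, hx⟩ := polyCarrier_nonempty he.1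
  exact ⟨x, hx, Metric.ball_subset_closedBall (he.2 hx)⟩

/-- The height function of `N` with reference flow that of `m`, for configurations that differ
only on `Λ`. -/
noncomputable def localHeight (G : PlaneBipartiteGraph) (Λ : Finset (List ℂ)) (m N : G.Config)
    (z : ℂ) : ℝ :=
  (∑ e ∈ Λ, (G.flow N e - G.flow m e) * edgeTurn e z) / (2 * Real.pi)

theorem flow_eq_of_sdiff_eq {N m : G.Config} {Λ : Set (List ℂ)} (h : N.1 \ Λ = m.1 \ Λ)
    {e : List ℂ} (he : e ∉ Λ) : G.flow N e = G.flow m e := by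
  rw [flow_eq_flow_iff]
  have := Set.ext_iff.1 h e
  simpa [he] using this

/-- Crossings and turnings differ by a function of the ends of the edge, and this sums to 0 over Λ
since the two configurations agree elsewhere. -/
theorem heightDiff_eq_localHeight_sub {Λ : Finset (List ℂ)} (hΛ : ↑Λ ⊆ G.edges)
    {N m : G.Config} (h : N.1 \ Λ = m.1 \ Λ) (z z' : ℂ) :
    G.heightDiff N m z z' = G.localHeight Λ m N z - G.localHeight Λ m N z' := by
  have hmem : ∀ e, G.flow N e ≠ G.flow m e → e ∈ Λ := fun e he => by
    by_contra hn
    exact he (flow_eq_of_sdiff_eq h (by simpa using hn))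
  rw [heightDiff_eq_sum Λ fun e he _ => hmem e he]
  have key := sum_flow_sub_flow_mul_ends_eq_zero N m Λ (fun p => symmArg ((p - z) / (p - z'))) hΛ
    fun v _ _ e he _ => hmem e he
  have hpi : (2 * Real.pi) ≠ 0 := by positivity
  unfold localHeight
  rw [← sub_div, eq_div_iff hpi, ← sub_zero (_ - _), ← key, Finset.sum_mul,
    ← Finset.sum_sub_distrib, ← Finset.sum_sub_distrib]
  refine Finset.sum_congr rfl fun e he => ?_
  have c := edgeCrossing_eq_edgeTurn (head?_eq_blackEnd (hΛ he)) (getLast?_eq_whiteEnd (hΛ he)) z z'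
  linear_combination (G.flow N e - G.flow m e) * c

theorem mem_polyCarrier_of_mem_segmentList {e : List ℂ} {s : ℂ × ℂ} (hs : s ∈ segmentList e) :
    s.1 ∈ polyCarrier e ∧ s.2 ∈ polyCarrier e :=
  ⟨segment_subset_polyCarrier hs (left_mem_segment _ _ _),
    segment_subset_polyCarrier hs (right_mem_segment _ _ _)⟩

/-- From a point not in the ball, the angle of each piece is the difference of a single-valued
argument at its ends. The sum over an edge depends only on its end vertices and vanishes by absence
of divergence. -/
theorem localHeight_eq_zero {Λ : Finset (List ℂ)} (hΛ : ↑Λ ⊆ G.edges) {N m : G.Config}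
    (h : N.1 \ Λ = m.1 \ Λ) {R : ℝ} (hR : ∀ e ∈ Λ, polyCarrier e ⊆ Metric.ball 0 R) {z : ℂ}
    (hz : R ≤ ‖z‖) : G.localHeight Λ m N z = 0 := by
  have hmem : ∀ e, G.flow N e ≠ G.flow m e → e ∈ Λ := fun e he => by
    by_contra hn
    exact he (flow_eq_of_sdiff_eq h (by simpa using hn))
  have key := sum_flow_sub_flow_mul_ends_eq_zero N m Λ (fun p => ((z - p) / z).arg) hΛ
    fun v _ _ e he _ => hmem e he
  unfold localHeight
  rw [div_eq_zero_iff]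
  left
  rw [← key]
  refine Finset.sum_congr rfl fun e he => ?_
  rw [← sum_segmentList_sub (fun p => ((z - p) / z).arg) (head?_eq_blackEnd (hΛ he))
    (getLast?_eq_whiteEnd (hΛ he))]
  unfold edgeTurn
  congr 2
  refine List.map_congr_left fun s hs => ?_
  have h1 := hR e he (mem_polyCarrier_of_mem_segmentList hs).1
  have h2 := hR e he (mem_polyCarrier_of_mem_segmentList hs).2
  rw [mem_ball_zero_iff] at h1 h2
  exact symmArg_div_of_norm_lt (h1.trans_le hz) (h2.trans_le hz)

theorem exists_ball_disjoint_segments (x : ℂ) (Q : List ℂ → ℂ × ℂ → Prop)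
    (h : ∀ e ∈ G.edges, ∀ t ∈ segmentList e, Q e t → x ∉ segment ℝ t.1 t.2) :
    ∃ δ > 0, ∀ e ∈ G.edges, ∀ t ∈ segmentList e, Q e t →
      Disjoint (segment ℝ t.1 t.2) (Metric.ball x δ) := by
  classical
  -- The radius ‖x‖ + 1 captures every edge that meets the unit ball around x, reducing the claim to
  -- finitely many closed pieces.
  have h1 : ∀ᶠ y in 𝓝 x, ∀ e ∈ G.edgesMeeting (‖x‖ + 1), ∀ t ∈ (segmentList e).toFinset,
      Q e t → y ∉ segment ℝ t.1 t.2 := by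
    rw [Filter.eventually_all_finset]
    intro e he
    rw [Filter.eventually_all_finset]
    intro t ht
    by_cases hQ : Q e t
    · have hc := (isCompact_segment_complex t.1 t.2).isClosed.isOpen_compl
      filter_upwards [hc.mem_nhds (h e ((G.mem_edgesMeeting).1 he).1 t (List.mem_toFinset.1 ht) hQ)]
        with y hy _ using hy
    · exact Eventually.of_forall fun y hy => absurd hy hQ
  obtain ⟨δ, hδ, hb⟩ := Metric.eventually_nhds_iff_ball.1 h1
  refine ⟨min δ 1, by positivity, fun e he t ht hQ => ?_⟩
  rw [Set.disjoint_left]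
  intro y hy hyb
  have hy1 : y ∈ Metric.ball x δ := Metric.ball_subset_ball (min_le_left _ _) hyb
  refine hb y hy1 e ((G.mem_edgesMeeting).2 ⟨he, y, segment_subset_polyCarrier ht hy, ?_⟩) t
    (List.mem_toFinset.2 ht) hQ hy
  have hy2 : dist y x < 1 := Metric.ball_subset_ball (min_le_right _ _) hyb
  rw [mem_closedBall_zero_iff]
  rw [dist_eq_norm] at hy2
  have := norm_le_norm_add_norm_sub' y x
  linarith

/-- Off the edges a short segment crosses nothing. At an inner point of a piece, a short
perpendicular meets that piece alone and `crossing_perp` gives the unit jump. -/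
theorem isHeight_localHeight {Λ : Finset (List ℂ)} (hΛ : ↑Λ ⊆ G.edges) {N m : G.Config}
    (h : N.1 \ Λ = m.1 \ Λ) : G.IsHeight (G.flow m) N (G.localHeight Λ m N) := by
  constructor
  · intro z hz
    obtain ⟨δ, hδ, hd⟩ := exists_ball_disjoint_segments (G := G) z (fun _ _ => True) (by
      intro e he t ht _ hx
      exact hz (Set.mem_biUnion he (segment_subset_polyCarrier ht hx)))
    filter_upwards [Metric.ball_mem_nhds z hδ] with z' hz'
    rw [← sub_eq_zero, ← heightDiff_eq_localHeight_sub hΛ h, heightDiff_eq_sum ∅,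
      Finset.sum_empty]
    rintro e he ⟨x, hx, hxs⟩
    obtain ⟨t, ht, hxt⟩ := mem_polyCarrier.1 hx
    exact absurd ((convex_ball z δ).segment_subset hz' (Metric.mem_ball_self hδ) hxs)
      (Set.disjoint_left.1 (hd e (mem_edges_of_flow_ne he) t ht trivial) hxt)
  · intro e he s hs x hx
    rw [← mem_segmentList] at hs
    have arc := G.arc e he
    have hne := fst_ne_snd_of_mem arc.nodup hs
    have hxs := openSegment_subset_segment _ _ _ hx
    have hx1 : x ≠ s.1 := by
      rintro h1
      rw [h1] at hx
      exact hne (left_mem_openSegment_iff.1 hx)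
    have hx2 : x ≠ s.2 := by
      rintro h1
      rw [h1] at hx
      exact hne (right_mem_openSegment_iff.1 hx)
    obtain ⟨δ, hδ, hd⟩ := exists_ball_disjoint_segments (G := G) x
      (fun e' t => ¬ (e' = e ∧ t = s)) (by
        intro e' he' t ht hQ hxt
        by_cases hee : e' = e
        · subst hee
          have := (arc.simple t (mem_segmentList.1 ht) s (mem_segmentList.1 hs)
            (fun h' => hQ ⟨rfl, h'⟩) ⟨hxt, hxs⟩).2
          simp only [Set.mem_insert_iff, Set.mem_singleton_iff] at this
          tauto
        · have hxe := segment_subset_polyCarrier hs hxs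
          have hV := G.edges_inter e' he' e he hee ⟨segment_subset_polyCarrier ht hxt, hxe⟩
          have := mem_ends_of_mem_segment arc
            (mem_of_isEndpoint (G.vertex_on_edge e he x hV hxe)) hs hxs
          tauto)
    set w : ℂ := Complex.I * (s.2 - s.1) with hw
    have hlim : Tendsto (fun t : ℝ => (t : ℂ) * w) (𝓝[>] 0) (𝓝 0) := by
      have : Tendsto (fun t : ℝ => (t : ℂ) * w) (𝓝 0) (𝓝 (((0 : ℝ) : ℂ) * w)) :=
        Continuous.tendsto (by fun_prop) 0
      rw [Complex.ofReal_zero, zero_mul] at this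
      exact this.mono_left nhdsWithin_le_nhds
    filter_upwards [hlim (Metric.ball_mem_nhds 0 hδ), self_mem_nhdsWithin] with t ht ht0
    rw [Set.mem_preimage, mem_ball_zero_iff] at ht
    have hseg : segment ℝ (x + t * w) (x - t * w) ⊆ Metric.ball x δ :=
      (convex_ball x δ).segment_subset (by simpa [mem_ball_iff_norm] using ht)
        (by simpa [mem_ball_iff_norm] using ht)
    rw [← heightDiff_eq_localHeight_sub hΛ h, heightDiff_eq_sum {e}, Finset.sum_singleton,
      edgeCrossing_eq_sum arc.nodup {s} (by simpa using hs), Finset.sum_singleton,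
      crossing_perp hne hx ht0, mul_one]
    · intro s' hs' hss
      rw [Finset.mem_singleton] at hss
      exact (hd e he s' hs' fun h' => hss h'.2).mono_right hseg
    · rintro e' he' ⟨y, hy, hys⟩
      obtain ⟨t', ht', hyt⟩ := mem_polyCarrier.1 hy
      rw [Finset.mem_singleton]
      by_contra hee
      exact absurd (hseg hys) (Set.disjoint_left.1
        (hd e' (mem_edges_of_flow_ne he') t' ht' fun h' => hee h'.1) hyt)

/-- The edges inside the ball of radius `R`, as a finite set. -/
noncomputable def innerFinset (G : PlaneBipartiteGraph) (R : ℝ) : Finset (List ℂ) :=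
  (G.finite_innerEdges R).toFinset

theorem coe_innerFinset (R : ℝ) : (G.innerFinset R : Set (List ℂ)) = G.innerEdges R := by
  simp [innerFinset]

theorem innerFinset_subset (R : ℝ) : ↑(G.innerFinset R) ⊆ G.edges := by
  rw [coe_innerFinset]
  exact fun e he => he.1

theorem polyCarrier_subset_ball {R : ℝ} {e : List ℂ} (he : e ∈ G.innerFinset R) :
    polyCarrier e ⊆ Metric.ball 0 R := by
  rw [← Finset.mem_coe, coe_innerFinset] at he
  exact he.2

/-- The event only asks for some height function, so exhibiting the local one suffices; uniqueness
of heights is never needed. -/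
theorem mem_heightEvent {R : ℝ} {m N : G.Config}
    (h : N.1 \ G.innerFinset R = m.1 \ G.innerFinset R) {x : ℝ}
    (hx : G.localHeight (G.innerFinset R) m N 0 ∈ Set.Ioo x (x + 1)) :
    N ∈ G.heightEvent R m x := by
  refine ⟨_, isHeight_localHeight (innerFinset_subset R) h, fun z _ hz => ?_, hx⟩
  exact localHeight_eq_zero (innerFinset_subset R) h (fun e he => polyCarrier_subset_ball he)
    (by simpa using hz)

/-! ### Height differences of a configuration and its translates -/

theorem IsPeriod.neg {τ : ℂ} (h : G.IsPeriod τ) : G.IsPeriod (-τ) where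
  black_iff v := by rw [← h.black_iff (v + -τ), neg_add_cancel_right]
  white_iff v := by rw [← h.white_iff (v + -τ), neg_add_cancel_right]
  edge_iff e := by rw [← h.edge_iff (shiftEdge (-τ) e), shiftEdge_shiftEdge_neg]
  weight_eq e he := by
    have h' : shiftEdge (-τ) e ∈ G.edges := by
      rw [← h.edge_iff, shiftEdge_shiftEdge_neg]; exact he
    rw [← h.weight_eq _ h', shiftEdge_shiftEdge_neg]

theorem shiftEdge_add (τ σ : ℂ) (e : List ℂ) :
    shiftEdge (τ + σ) e = shiftEdge σ (shiftEdge τ e) := by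
  simp [shiftEdge, Function.comp_def, add_assoc]

theorem IsPeriod.add {τ σ : ℂ} (h : G.IsPeriod τ) (h' : G.IsPeriod σ) : G.IsPeriod (τ + σ) where
  black_iff v := by rw [← add_assoc, h'.black_iff, h.black_iff]
  white_iff v := by rw [← add_assoc, h'.white_iff, h.white_iff]
  edge_iff e := by rw [shiftEdge_add, h'.edge_iff, h.edge_iff]
  weight_eq e he := by
    rw [shiftEdge_add, h'.weight_eq _ ((h.edge_iff e).2 he), h.weight_eq e he]

theorem IsPeriod.zero : G.IsPeriod 0 where
  black_iff v := by simp
  white_iff v := by simp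
  edge_iff e := by simp [shiftEdge]
  weight_eq e he := by simp [shiftEdge]

theorem IsPeriod.zsmul {τ : ℂ} (h : G.IsPeriod τ) (n : ℤ) : G.IsPeriod (n * τ) := by
  induction n with
  | zero => simpa using IsPeriod.zero
  | succ n ih =>
    have := ih.add h
    push_cast at this ⊢
    rwa [add_mul, one_mul]
  | pred n ih =>
    have := ih.add h.neg
    push_cast at this ⊢
    rwa [sub_mul, one_mul, sub_eq_add_neg]

theorem IsBiperiodic.exists_near_period (hper : G.IsBiperiodic) :
    ∃ ρ : ℝ, ∀ z : ℂ, ∃ σ, G.IsPeriod σ ∧ ‖z + σ‖ ≤ ρ := by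
  obtain ⟨u, v, hli, hu, hv⟩ := hper
  refine ⟨‖u‖ + ‖v‖, fun z => ?_⟩
  have htop : Submodule.span ℝ (Set.range ![u, v]) = ⊤ := by
    apply hli.span_eq_top_of_card_eq_finrank
    simp [Complex.finrank_real_complex]
  have hz : z ∈ Submodule.span ℝ (Set.range ![u, v]) := by rw [htop]; trivial
  rw [Matrix.range_cons, Matrix.range_cons, Matrix.range_empty, Set.union_empty,
    Set.singleton_union, Submodule.mem_span_pair] at hz
  obtain ⟨a, b, rfl⟩ := hz
  refine ⟨((-⌊a⌋ : ℤ) : ℂ) * u + ((-⌊b⌋ : ℤ) : ℂ) * v, (hu.zsmul _).add (hv.zsmul _), ?_⟩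
  have e : a • u + b • v + (((-⌊a⌋ : ℤ) : ℂ) * u + ((-⌊b⌋ : ℤ) : ℂ) * v)
      = (Int.fract a) • u + (Int.fract b) • v := by
    simp only [Complex.real_smul, Int.fract]
    push_cast
    ring
  rw [e]
  refine (norm_add_le _ _).trans (add_le_add ?_ ?_) <;> rw [norm_smul, Real.norm_eq_abs,
    abs_of_nonneg (Int.fract_nonneg _)]
  · exact mul_le_of_le_one_left (norm_nonneg _) (Int.fract_lt_one _).le
  · exact mul_le_of_le_one_left (norm_nonneg _) (Int.fract_lt_one _).le

/-- A period moves z into a fixed ball, carrying the two configurations along; there the bound is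
uniform over all configurations. -/
theorem IsBiperiodic.exists_heightDiff_le (hper : G.IsBiperiodic) (τ : ℂ) :
    ∃ C : ℝ, ∀ (N₁ N₂ : G.Config) (z : ℂ), |G.heightDiff N₁ N₂ z (z - τ)| ≤ C := by
  obtain ⟨ρ, hρ⟩ := hper.exists_near_period
  refine ⟨G.heightBound (ρ + ‖τ‖), fun N₁ N₂ z => ?_⟩
  obtain ⟨σ, hσ, hz⟩ := hρ z
  rw [← heightDiff_translate hσ]
  refine abs_heightDiff_le _ _ (hz.trans (by linarith [norm_nonneg τ])) ?_
  have e : z - τ + σ = (z + σ) - τ := by ring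
  rw [e]
  exact (norm_sub_le _ _).trans (by linarith)

/-- Let b k be the increment from 0 to z of the height difference of m and its k-th translate.
Moving both configurations and both points by τ shows that b (k + 1) equals b k + b 1 up to 2C,
where C bounds increments over a displacement τ. Since the b k are bounded for fixed z, uniformly in
k, |b 1| > 2C would contradict linear growth. The resulting bound does not depend on z. -/
theorem IsBiperiodic.exists_heightDiff_translate_le (hper : G.IsBiperiodic) {τ : ℂ}
    (hτ : G.IsPeriod τ) :
    ∃ C : ℝ, ∀ (m : G.Config) (z : ℂ), |G.heightDiff m (G.translate hτ m) z 0| ≤ C := by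
  obtain ⟨C, hC⟩ := hper.exists_heightDiff_le τ
  refine ⟨2 * C, fun m z => ?_⟩
  set T : ℕ → G.Config := fun k => (G.translate hτ)^[k] m with hT
  set b : ℕ → ℝ := fun k => G.heightDiff m (T k) z 0 with hb
  have hTs : ∀ k, T (k + 1) = G.translate hτ (T k) := fun k =>
    Function.iterate_succ_apply' _ _ _
  have hT1 : T 1 = G.translate hτ m := rfl
  have hstep : ∀ k, |b k - b (k + 1) + b 1| ≤ 2 * C := by
    intro k
    have h1 := hC m (T k) z
    have h2 := hC (T 1) (T (k + 1)) τ
    rw [sub_self] at h2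
    have e1 : G.heightDiff m (T k) z (z - τ) = b k + G.heightDiff m (T k) 0 (z - τ) :=
      (heightDiff_trans _ _ _ _ _).symm
    have e2 : G.heightDiff m (T k) 0 (z - τ) = G.heightDiff (T 1) (T (k + 1)) τ z := by
      rw [hTs k, hT1, ← heightDiff_translate hτ m (T k) 0 (z - τ), zero_add, sub_add_cancel]
    have e3 : G.heightDiff (T 1) (T (k + 1)) τ z
        = G.heightDiff (T 1) (T (k + 1)) τ 0 - G.heightDiff (T 1) (T (k + 1)) z 0 := by
      rw [← heightDiff_trans (T 1) (T (k + 1)) τ 0 z, heightDiff_symm _ _ z 0]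
      ring
    have e4 : b 1 + G.heightDiff (T 1) (T (k + 1)) z 0 = b (k + 1) := heightDiff_add _ _ _ _ _
    have e5 : b k - b (k + 1) + b 1 = G.heightDiff m (T k) z (z - τ)
        - G.heightDiff (T 1) (T (k + 1)) τ 0 := by
      linarith
    rw [e5]
    exact (abs_sub _ _).trans (by linarith)
  have hsum : ∀ n : ℕ, |b 0 - b n + n * b 1| ≤ n * (2 * C) := by
    intro n
    induction n with
    | zero => simp
    | succ n ih =>
      have := hstep n
      push_cast
      have e : b 0 - b (n + 1) + (n + 1) * b 1
          = (b 0 - b n + n * b 1) + (b n - b (n + 1) + b 1) := by ring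
      rw [e]
      exact (abs_add_le _ _).trans (by linarith)
  have hbound : ∀ n, |b n| ≤ G.heightBound ‖z‖ := fun n =>
    abs_heightDiff_le _ _ le_rfl (by simp)
  change |b 1| ≤ 2 * C
  by_contra! hlt
  obtain ⟨n, hn⟩ := exists_nat_gt (2 * G.heightBound ‖z‖ / (|b 1| - 2 * C))
  rw [div_lt_iff₀ (by linarith)] at hn
  have e : (n : ℝ) * b 1 = (b 0 - b n + n * b 1) + (b n - b 0) := by ring
  have h4 := abs_add_le (b 0 - b n + n * b 1) (b n - b 0)
  rw [← e] at h4
  have h3 : n * |b 1| ≤ n * (2 * C) + 2 * G.heightBound ‖z‖ := by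
    calc n * |b 1| = |n * b 1| := by rw [abs_mul, Nat.abs_cast]
      _ ≤ |b 0 - b n + n * b 1| + |b n - b 0| := h4
      _ ≤ _ := by
        have := (abs_sub (b n) (b 0))
        linarith [hsum n, hbound n, hbound 0]
  nlinarith

/-! ### Exchanging two configurations along enclosed components -/

/-- The edges of `S` whose connected component in `S` is contained in `Λ`. -/
def enclosedPart (G : PlaneBipartiteGraph) (Λ : Finset (List ℂ)) (S : Set (List ℂ)) :
    Set (List ℂ) :=
  {e ∈ S | ∀ e', Relation.ReflTransGen (G.EdgeAdj S) e e' → e' ∈ Λ}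

theorem enclosedPart_subset {Λ : Finset (List ℂ)} {S : Set (List ℂ)} :
    G.enclosedPart Λ S ⊆ S := fun _ h => h.1

theorem mem_of_mem_enclosedPart {Λ : Finset (List ℂ)} {S : Set (List ℂ)} {e : List ℂ}
    (h : e ∈ G.enclosedPart Λ S) : e ∈ Λ := h.2 e .refl

theorem mem_enclosedPart_of_common {Λ : Finset (List ℂ)} {S : Set (List ℂ)} {e e' : List ℂ}
    (h : e ∈ G.enclosedPart Λ S) (he' : e' ∈ S) {v : ℂ} (hV : v ∈ G.black ∪ G.white)
    (hv : IsEndpoint v e) (hv' : IsEndpoint v e') : e' ∈ G.enclosedPart Λ S :=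
  ⟨he', fun _ hr => h.2 _ (.head ⟨h.1, he', v, hV, hv, hv'⟩ hr)⟩

/-- The configuration obtained from `N₁` by exchanging it with `N₂` along the components of their
symmetric difference that are contained in `Λ`. -/
def swapInside (G : PlaneBipartiteGraph) (Λ : Finset (List ℂ)) (N₁ N₂ : G.Config) : G.Config :=
  ⟨(N₁.1 \ G.enclosedPart Λ (symmDiff N₁.1 N₂.1)) ∪
      (N₂.1 ∩ G.enclosedPart Λ (symmDiff N₁.1 N₂.1)), by
    set S := symmDiff N₁.1 N₂.1 with hS
    set C := G.enclosedPart Λ S with hC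
    constructor
    · rintro e (h | h)
      exacts [N₁.2.1 h.1, N₂.2.1 h.1]
    · intro v hV
      obtain ⟨e₁, ⟨h₁, hv₁⟩, hu₁⟩ := N₁.2.2 v hV
      obtain ⟨e₂, ⟨h₂, hv₂⟩, hu₂⟩ := N₂.2.2 v hV
      have hmem : e₁ ≠ e₂ → e₁ ∈ S ∧ e₂ ∈ S := fun hne =>
        ⟨Or.inl ⟨h₁, fun h => hne (hu₂ e₁ ⟨h, hv₁⟩)⟩,
          Or.inr ⟨h₂, fun h => hne (hu₁ e₂ ⟨h, hv₂⟩).symm⟩⟩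
      have hCS : ∀ e ∈ C, ¬ (e ∈ N₁.1 ∧ e ∈ N₂.1) := by
        rintro e he ⟨h, h'⟩
        rcases (enclosedPart_subset he : e ∈ S) with h'' | h''
        exacts [h''.2 h', h''.2 h]
      -- C is a union of components, so at v it contains both edges of the symmetric difference or
      -- neither; exactly one edge at v survives the exchange.
      by_cases hc : e₁ ∈ C
      · have hne : e₁ ≠ e₂ := by
          rintro rfl
          exact hCS e₁ hc ⟨h₁, h₂⟩
        have hc₂ := mem_enclosedPart_of_common hc (hmem hne).2 hV hv₁ hv₂
        refine ⟨e₂, ⟨Or.inr ⟨h₂, hc₂⟩, hv₂⟩, ?_⟩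
        rintro e ⟨h | h, hv⟩
        · exact absurd (hu₁ e ⟨h.1, hv⟩ ▸ hc) h.2
        · exact hu₂ e ⟨h.1, hv⟩
      · refine ⟨e₁, ⟨Or.inl ⟨h₁, hc⟩, hv₁⟩, ?_⟩
        rintro e ⟨h | h, hv⟩
        · exact hu₁ e ⟨h.1, hv⟩
        · have he : e = e₂ := hu₂ e ⟨h.1, hv⟩
          subst he
          have hne : e₁ ≠ e := by
            rintro rfl
            exact hCS e₁ h.2 ⟨h₁, h₂⟩
          exact absurd (mem_enclosedPart_of_common h.2 (hmem hne).1 hV hv₂ hv₁) hc⟩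

theorem mem_swapInside {Λ : Finset (List ℂ)} {N₁ N₂ : G.Config} {e : List ℂ} :
    e ∈ (G.swapInside Λ N₁ N₂).1 ↔
      (e ∈ N₁.1 ∧ e ∉ G.enclosedPart Λ (symmDiff N₁.1 N₂.1)) ∨
        (e ∈ N₂.1 ∧ e ∈ G.enclosedPart Λ (symmDiff N₁.1 N₂.1)) := Iff.rfl

theorem mem_swapInside_swap {Λ : Finset (List ℂ)} {N₁ N₂ : G.Config} {e : List ℂ} :
    e ∈ (G.swapInside Λ N₂ N₁).1 ↔
      (e ∈ N₂.1 ∧ e ∉ G.enclosedPart Λ (symmDiff N₁.1 N₂.1)) ∨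
        (e ∈ N₁.1 ∧ e ∈ G.enclosedPart Λ (symmDiff N₁.1 N₂.1)) := by
  rw [mem_swapInside, symmDiff_comm]

/-- Exchanging relabels edges within the symmetric difference without changing it as a set, so the
enclosed components are the same and a second exchange undoes the first. -/
theorem symmDiff_swapInside (Λ : Finset (List ℂ)) (N₁ N₂ : G.Config) :
    symmDiff (G.swapInside Λ N₁ N₂).1 (G.swapInside Λ N₂ N₁).1 = symmDiff N₁.1 N₂.1 := by
  ext e
  rw [Set.mem_symmDiff, mem_swapInside, mem_swapInside_swap, Set.mem_symmDiff]
  tauto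

theorem swapInside_swapInside (Λ : Finset (List ℂ)) (N₁ N₂ : G.Config) :
    G.swapInside Λ (G.swapInside Λ N₁ N₂) (G.swapInside Λ N₂ N₁) = N₁ := by
  apply Subtype.ext
  ext e
  rw [mem_swapInside, symmDiff_swapInside, mem_swapInside, mem_swapInside_swap]
  tauto

theorem swapInside_sdiff (Λ : Finset (List ℂ)) (N₁ N₂ : G.Config) :
    (G.swapInside Λ N₁ N₂).1 \ Λ = N₁.1 \ Λ := by
  ext e
  have : e ∈ G.enclosedPart Λ (symmDiff N₁.1 N₂.1) → e ∈ (Λ : Set (List ℂ)) :=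
    mem_of_mem_enclosedPart
  simp only [Set.mem_sdiff, mem_swapInside]
  tauto

open Classical in
/-- The product of the weights of the dimers of `N` in `Λ`. -/
noncomputable def weightIn (G : PlaneBipartiteGraph) (Λ : Finset (List ℂ)) (N : G.Config) : ℝ :=
  ∏ e ∈ Λ, if e ∈ N.1 then G.weight e else 1

theorem weightIn_pos (Λ : Finset (List ℂ)) (N : G.Config) : 0 < G.weightIn Λ N := by
  refine Finset.prod_pos fun e _ => ?_
  split_ifs with h
  · exact G.weight_pos e (N.2.1 h)
  · exact one_pos

theorem weightIn_swapInside (Λ : Finset (List ℂ)) (N₁ N₂ : G.Config) :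
    G.weightIn Λ (G.swapInside Λ N₁ N₂) * G.weightIn Λ (G.swapInside Λ N₂ N₁)
      = G.weightIn Λ N₁ * G.weightIn Λ N₂ := by
  classical
  unfold weightIn
  rw [← Finset.prod_mul_distrib, ← Finset.prod_mul_distrib]
  refine Finset.prod_congr rfl fun e _ => ?_
  by_cases hc : e ∈ G.enclosedPart Λ (symmDiff N₁.1 N₂.1)
  · have h1 : e ∈ (G.swapInside Λ N₁ N₂).1 ↔ e ∈ N₂.1 := by rw [mem_swapInside]; tauto
    have h2 : e ∈ (G.swapInside Λ N₂ N₁).1 ↔ e ∈ N₁.1 := by rw [mem_swapInside_swap]; tauto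
    rw [if_congr h1 rfl rfl, if_congr h2 rfl rfl, mul_comm]
  · have h1 : e ∈ (G.swapInside Λ N₁ N₂).1 ↔ e ∈ N₁.1 := by rw [mem_swapInside]; tauto
    have h2 : e ∈ (G.swapInside Λ N₂ N₁).1 ↔ e ∈ N₂.1 := by rw [mem_swapInside_swap]; tauto
    rw [if_congr h1 rfl rfl, if_congr h2 rfl rfl]

theorem finite_agreeing (Λ : Finset (List ℂ)) (m : G.Config) :
    {N : G.Config | N.1 \ Λ = m.1 \ Λ}.Finite := by
  refine Set.Finite.of_finite_image (f := fun N : G.Config => N.1 ∩ (Λ : Set (List ℂ))) ?_ ?_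
  · refine (Λ.finite_toSet.finite_subsets).subset ?_
    rintro _ ⟨N, -, rfl⟩
    exact Set.inter_subset_right
  · intro N hN N' hN' h
    apply Subtype.ext
    rw [← Set.inter_union_sdiff N.1 (Λ : Set (List ℂ)),
      ← Set.inter_union_sdiff N'.1 (Λ : Set (List ℂ))]
    exact congrArg₂ _ h ((show N.1 \ Λ = m.1 \ Λ from hN).trans
      (show N'.1 \ Λ = m.1 \ Λ from hN').symm)

/-! ### Finite-volume laws and their comparison -/

/-- The finite set of the configurations that agree with `m` off `Λ`. -/
noncomputable def agreeing (G : PlaneBipartiteGraph) (Λ : Finset (List ℂ)) (m : G.Config) :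
    Finset G.Config := (finite_agreeing Λ m).toFinset

theorem mem_agreeing {Λ : Finset (List ℂ)} {m N : G.Config} :
    N ∈ G.agreeing Λ m ↔ N.1 \ Λ = m.1 \ Λ := by
  simp [agreeing]

theorem self_mem_agreeing (Λ : Finset (List ℂ)) (m : G.Config) : m ∈ G.agreeing Λ m :=
  mem_agreeing.2 rfl

/-- The partition function of the dimer model on `Λ` with boundary condition `m`. -/
noncomputable def partition (G : PlaneBipartiteGraph) (Λ : Finset (List ℂ)) (m : G.Config) : ℝ :=
  ∑ N ∈ G.agreeing Λ m, G.weightIn Λ N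

theorem partition_pos (Λ : Finset (List ℂ)) (m : G.Config) : 0 < G.partition Λ m :=
  Finset.sum_pos (fun N _ => weightIn_pos Λ N) ⟨m, self_mem_agreeing Λ m⟩

/-- The expectation of `F` for the dimer model on `Λ` with boundary condition `m`. -/
noncomputable def localExp (G : PlaneBipartiteGraph) (Λ : Finset (List ℂ)) (m : G.Config)
    (F : G.Config → ℝ) : ℝ :=
  (∑ N ∈ G.agreeing Λ m, G.weightIn Λ N * F N) / G.partition Λ m

theorem localExp_mono {Λ : Finset (List ℂ)} {m : G.Config} {F F' : G.Config → ℝ}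
    (h : ∀ N ∈ G.agreeing Λ m, F N ≤ F' N) : G.localExp Λ m F ≤ G.localExp Λ m F' :=
  div_le_div_of_nonneg_right (Finset.sum_le_sum fun N hN =>
    mul_le_mul_of_nonneg_left (h N hN) (weightIn_pos Λ N).le) (partition_pos Λ m).le

theorem localExp_sum {ι : Type*} (I : Finset ι) {Λ : Finset (List ℂ)} {m : G.Config}
    (F : ι → G.Config → ℝ) :
    G.localExp Λ m (fun N => ∑ i ∈ I, F i N) = ∑ i ∈ I, G.localExp Λ m (F i) := by
  unfold localExp
  rw [← Finset.sum_div]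
  congr 1
  simp only [Finset.mul_sum]
  exact Finset.sum_comm

theorem localExp_const (Λ : Finset (List ℂ)) (m : G.Config) (c : ℝ) :
    G.localExp Λ m (fun _ => c) = c := by
  unfold localExp
  rw [← Finset.sum_mul]
  exact mul_div_cancel_left₀ c (partition_pos Λ m).ne'

theorem localExp_const_mul (Λ : Finset (List ℂ)) (m : G.Config) (c : ℝ) (F : G.Config → ℝ) :
    G.localExp Λ m (fun N => c * F N) = c * G.localExp Λ m F := by
  unfold localExp
  rw [← mul_div_assoc, Finset.mul_sum]
  congr 1
  exact Finset.sum_congr rfl fun N _ => by ring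

/-- Exchanging the configurations along enclosed components compares the two local laws. -/
theorem abs_localExp_sub_le {Λ : Finset (List ℂ)} {m m' : G.Config} {F : G.Config → ℝ}
    {B : G.Config → G.Config → ℝ} (hB : ∀ N₁ ∈ G.agreeing Λ m, ∀ N₂ ∈ G.agreeing Λ m',
      |F (G.swapInside Λ N₁ N₂) - F N₂| ≤ B N₁ N₂) {δ : ℝ}
    (hδ : ∀ N₂ ∈ G.agreeing Λ m', G.localExp Λ m (fun N₁ => B N₁ N₂) ≤ δ) :
    |G.localExp Λ m F - G.localExp Λ m' F| ≤ δ := by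
  set W := G.weightIn Λ with hW
  set P := G.agreeing Λ m ×ˢ G.agreeing Λ m' with hP
  have hpos := partition_pos Λ m
  have hpos' := partition_pos Λ m'
  have e1 : G.localExp Λ m F * (G.partition Λ m * G.partition Λ m')
      = ∑ p ∈ P, W p.1 * W p.2 * F (G.swapInside Λ p.1 p.2) := by
    -- Change of variables by the exchange, an involution of pairs preserving the product weight:
    -- the exchanged first configuration has the law of the first one.
    have : ∑ p ∈ P, W p.1 * W p.2 * F (G.swapInside Λ p.1 p.2)
        = ∑ p ∈ P, W p.1 * W p.2 * F p.1 := by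
      refine Finset.sum_nbij' (fun p => (G.swapInside Λ p.1 p.2, G.swapInside Λ p.2 p.1))
        (fun p => (G.swapInside Λ p.1 p.2, G.swapInside Λ p.2 p.1)) ?_ ?_ ?_ ?_ ?_
      · intro p hp
        rw [hP, Finset.mem_product, mem_agreeing, mem_agreeing] at hp ⊢
        rwa [swapInside_sdiff, swapInside_sdiff]
      · intro p hp
        rw [hP, Finset.mem_product, mem_agreeing, mem_agreeing] at hp ⊢
        rwa [swapInside_sdiff, swapInside_sdiff]
      · intro p _
        exact Prod.ext (swapInside_swapInside Λ p.1 p.2) (swapInside_swapInside Λ p.2 p.1)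
      · intro p _
        exact Prod.ext (swapInside_swapInside Λ p.1 p.2) (swapInside_swapInside Λ p.2 p.1)
      · intro p _
        simp only [hW]
        rw [weightIn_swapInside]
    rw [this, hP, Finset.sum_product]
    unfold localExp
    rw [div_mul_eq_mul_div, div_eq_iff hpos.ne', Finset.sum_mul, Finset.sum_mul]
    refine Finset.sum_congr rfl fun N _ => ?_
    dsimp only
    rw [← Finset.sum_mul, ← Finset.mul_sum, ← hW]
    change _ = W N * G.partition Λ m' * F N * _
    ring
  have e2 : G.localExp Λ m' F * (G.partition Λ m * G.partition Λ m')
      = ∑ p ∈ P, W p.1 * W p.2 * F p.2 := by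
    rw [hP, Finset.sum_product_right]
    unfold localExp
    rw [div_mul_eq_mul_div, div_eq_iff hpos'.ne', Finset.sum_mul, Finset.sum_mul]
    refine Finset.sum_congr rfl fun N _ => ?_
    dsimp only
    rw [← Finset.sum_mul, ← Finset.sum_mul, ← hW]
    change _ = G.partition Λ m * W N * F N * _
    ring
  -- The bound `hδ` is conditional on the second configuration, which is averaged afterwards.
  have e3 : ∑ p ∈ P, W p.1 * W p.2 * B p.1 p.2 ≤ δ * (G.partition Λ m * G.partition Λ m') := by
    rw [hP, Finset.sum_product_right]
    calc _ = ∑ N₂ ∈ G.agreeing Λ m',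
          W N₂ * (G.partition Λ m * G.localExp Λ m (fun N₁ => B N₁ N₂)) := by
          refine Finset.sum_congr rfl fun N₂ _ => ?_
          unfold localExp
          rw [mul_div_cancel₀ _ hpos.ne', Finset.mul_sum]
          exact Finset.sum_congr rfl fun N _ => by ring
      _ ≤ ∑ N₂ ∈ G.agreeing Λ m', W N₂ * (G.partition Λ m * δ) :=
          Finset.sum_le_sum fun N₂ h => mul_le_mul_of_nonneg_left
            (mul_le_mul_of_nonneg_left (hδ N₂ h) hpos.le) (weightIn_pos Λ N₂).le
      _ = _ := by
          rw [← Finset.sum_mul]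
          change G.partition Λ m' * _ = _
          ring
  have hPP : 0 < G.partition Λ m * G.partition Λ m' := mul_pos hpos hpos'
  refine le_of_mul_le_mul_right ?_ hPP
  calc |G.localExp Λ m F - G.localExp Λ m' F| * (G.partition Λ m * G.partition Λ m')
      = |(G.localExp Λ m F - G.localExp Λ m' F) * (G.partition Λ m * G.partition Λ m')| := by
        rw [abs_mul, abs_of_pos hPP]
    _ = |∑ p ∈ P, W p.1 * W p.2 * (F (G.swapInside Λ p.1 p.2) - F p.2)| := by
        rw [sub_mul, e1, e2, ← Finset.sum_sub_distrib]
        congr 1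
        exact Finset.sum_congr rfl fun p _ => by ring
    _ ≤ ∑ p ∈ P, W p.1 * W p.2 * B p.1 p.2 := by
        refine (Finset.abs_sum_le_sum_abs _ _).trans (Finset.sum_le_sum fun p hp => ?_)
        have hw : 0 < W p.1 * W p.2 := mul_pos (weightIn_pos Λ _) (weightIn_pos Λ _)
        rw [abs_mul, abs_of_pos hw]
        rw [hP, Finset.mem_product] at hp
        exact mul_le_mul_of_nonneg_left (hB _ hp.1 _ hp.2) hw.le
    _ ≤ _ := e3

theorem mem_swapInside_iff_of_enclosed {Λ : Finset (List ℂ)} {N₁ N₂ : G.Config} {e : List ℂ}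
    (h : e ∈ symmDiff N₁.1 N₂.1 → e ∈ G.enclosedPart Λ (symmDiff N₁.1 N₂.1)) :
    e ∈ (G.swapInside Λ N₁ N₂).1 ↔ e ∈ N₂.1 := by
  rw [mem_swapInside]
  have h' : e ∈ G.enclosedPart Λ (symmDiff N₁.1 N₂.1) → e ∈ symmDiff N₁.1 N₂.1 :=
    fun h => enclosedPart_subset h
  rw [Set.mem_symmDiff] at h h'
  tauto

/-- By convexity of the ball, an edge all of whose corners lie in it is contained in it. -/
theorem exists_end_norm_ge {e : List ℂ} {R : ℝ} (h : ¬ polyCarrier e ⊆ Metric.ball 0 R) :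
    ∃ t ∈ segmentList e, ∃ v, (v = t.1 ∨ v = t.2) ∧ R ≤ ‖v‖ := by
  by_contra! hn
  apply h
  intro y hy
  obtain ⟨t, ht, hyt⟩ := mem_polyCarrier.1 hy
  exact (convex_ball (0 : ℂ) R).segment_subset (by simpa using hn t ht t.1 (Or.inl rfl))
    (by simpa using hn t ht t.2 (Or.inr rfl)) hyt

/-- If some component of the symmetric difference connects a given finite set of edges to the
outside of the ball, then the heights at the origin are close to each other. -/
theorem IsBiperiodic.exists_localHeight_sub_le (hper : G.IsBiperiodic) {τ : ℂ}
    (hτ : G.IsPeriod τ) (F : Finset (List ℂ)) :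
    ∃ K : ℝ, ∀ (R : ℝ) (m N₁ N₂ : G.Config), N₁ ∈ G.agreeing (G.innerFinset R) m →
      N₂ ∈ G.agreeing (G.innerFinset R) (G.translate hτ m) →
      (∃ e ∈ F, e ∈ symmDiff N₁.1 N₂.1 ∧
        e ∉ G.enclosedPart (G.innerFinset R) (symmDiff N₁.1 N₂.1)) →
      |G.localHeight (G.innerFinset R) m N₁ 0
        - G.localHeight (G.innerFinset R) (G.translate hτ m) N₂ 0| ≤ K := by
  obtain ⟨C, hC⟩ := hper.exists_heightDiff_translate_le hτ
  have hρ : ∃ ρ : ℝ, 0 ≤ ρ ∧ ∀ e ∈ F, ∀ s ∈ segmentList e, ‖segmentMid s‖ ≤ ρ := by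
    classical
    refine ⟨∑ e ∈ F, ∑ s ∈ (segmentList e).toFinset, ‖segmentMid s‖, by positivity,
      fun e he s hs => ?_⟩
    calc ‖segmentMid s‖ ≤ ∑ s ∈ (segmentList e).toFinset, ‖segmentMid s‖ :=
          Finset.single_le_sum (f := fun s => ‖segmentMid s‖) (fun _ _ => norm_nonneg _)
            (List.mem_toFinset.2 hs)
      _ ≤ _ := Finset.single_le_sum
          (f := fun e => ∑ s ∈ (segmentList e).toFinset, ‖segmentMid s‖)
          (fun _ _ => by positivity) he
  obtain ⟨ρ, hρ0, hρ⟩ := hρ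
  -- The three terms pay for going from 0 to a midpoint on F, for the half piece from a midpoint to
  -- a corner v not in the ball, and for the height difference of m and its translate. None depends
  -- on R.
  refine ⟨G.heightBound ρ + 1 + C, ?_⟩
  rintro R m N₁ N₂ h₁ h₂ ⟨e, heF, heS, hen⟩
  set S := symmDiff N₁.1 N₂.1 with hS
  rw [mem_agreeing] at h₁ h₂
  obtain ⟨e', hr, he'⟩ : ∃ e', Relation.ReflTransGen (G.EdgeAdj S) e e' ∧
      e' ∉ G.innerFinset R := by
    by_contra! hn
    exact hen ⟨heS, hn⟩
  have he'S : e' ∈ S := by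
    rcases Relation.ReflTransGen.cases_tail hr with h | ⟨_, _, h⟩
    · exact h ▸ heS
    · exact h.2.1
  have f := mem_symmDiff_iff_flow_ne.1 heS
  have f' := mem_symmDiff_iff_flow_ne.1 he'S
  have g := mem_edges_of_flow_ne f
  have g' := mem_edges_of_flow_ne f'
  have hball : ¬ polyCarrier e' ⊆ Metric.ball 0 R := fun h => he' (by
    rw [← Finset.mem_coe, coe_innerFinset]
    exact ⟨g', h⟩)
  obtain ⟨t, ht, v, hvt, hvR⟩ := exists_end_norm_ge hball
  obtain ⟨s, hs⟩ := List.exists_mem_of_ne_nil _ (segmentList_ne_nil (G.arc e g).two_le)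
  obtain ⟨k, hk1, hk⟩ := exists_heightDiff_mid_eq f' (mem_of_eq_or_eq ht hvt)
  have d1 : |G.heightDiff N₁ N₂ 0 (segmentMid s)| ≤ G.heightBound ρ :=
    abs_heightDiff_le _ _ (by simpa using hρ0) (hρ e heF s hs)
  have d2 := heightDiff_mid_mid_of_connected heS hr hs ht
  have d3 := hk e' f' t ht hvt
  have d4 : G.heightDiff N₁ N₂ 0 v = G.heightDiff N₁ N₂ 0 (segmentMid s) + k := by
    rw [← heightDiff_trans N₁ N₂ 0 (segmentMid s) v,
      ← heightDiff_trans N₁ N₂ (segmentMid s) (segmentMid t) v, d2, d3, zero_add]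
  -- The difference of N₁ and N₂ is split through m and its translate. As the local heights vanish
  -- at v, the outer two terms are the heights at 0.
  have d5 := heightDiff_add N₁ m N₂ 0 v
  have d6 := heightDiff_add m (G.translate hτ m) N₂ 0 v
  have d7 := heightDiff_eq_localHeight_sub (innerFinset_subset R) h₁ 0 v
  have d8 := heightDiff_eq_localHeight_sub (innerFinset_subset R) h₂ 0 v
  rw [localHeight_eq_zero (innerFinset_subset R) h₁ (fun e he => polyCarrier_subset_ball he) hvR]
    at d7
  rw [localHeight_eq_zero (innerFinset_subset R) h₂ (fun e he => polyCarrier_subset_ball he) hvR]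
    at d8
  rw [heightDiff_neg] at d8
  have d9 := hC m v
  rw [heightDiff_symm, abs_neg] at d9
  rw [abs_le] at *
  constructor <;> linarith

/-! ### Consistency of the local laws -/

theorem weightIn_congr {Λ : Finset (List ℂ)} {N N' : G.Config}
    (h : ∀ e ∈ Λ, e ∈ N.1 ↔ e ∈ N'.1) : G.weightIn Λ N = G.weightIn Λ N' := by
  classical
  exact Finset.prod_congr rfl fun e he => if_congr (h e he) rfl rfl

theorem agreeing_congr {Λ : Finset (List ℂ)} {N N' : G.Config} (h : N.1 \ Λ = N'.1 \ Λ) :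
    G.agreeing Λ N = G.agreeing Λ N' := by
  ext M
  rw [mem_agreeing, mem_agreeing, h]

/-- Detailed balance: for configurations equal off Λ, the ratio of weights is the same on Λ and on
any larger set. -/
theorem weightIn_mul_weightIn {Λ Λ' : Finset (List ℂ)} (hΛ : Λ ⊆ Λ') {N N' : G.Config}
    (h : N.1 \ Λ = N'.1 \ Λ) :
    G.weightIn Λ' N * G.weightIn Λ N' = G.weightIn Λ' N' * G.weightIn Λ N := by
  classical
  have hs : ∀ M : G.Config, G.weightIn Λ' M = G.weightIn (Λ' \ Λ) M * G.weightIn Λ M := fun M =>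
    (Finset.prod_sdiff hΛ).symm
  rw [hs N, hs N', weightIn_congr (Λ := Λ' \ Λ) (N := N) (N' := N')]
  · ring
  · intro e he
    have := Set.ext_iff.1 h e
    simpa [(Finset.mem_sdiff.1 he).2] using this

/-- The tower property: resampling Λ is reversible for the law on Λ', so after exchanging the two
sums the inner weights add up to the partition function and cancel. -/
theorem localExp_localExp {Λ Λ' : Finset (List ℂ)} (hΛ : Λ ⊆ Λ') (m : G.Config)
    (F : G.Config → ℝ) :
    G.localExp Λ' m (fun N => G.localExp Λ N F) = G.localExp Λ' m F := by
  have hsub : ∀ {N N' : G.Config}, N.1 \ Λ = N'.1 \ Λ → N.1 \ Λ' = N'.1 \ Λ' := by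
    intro N N' h
    ext e
    have h1 := Set.ext_iff.1 h e
    have h2 := @hΛ e
    simp only [Set.mem_sdiff, Finset.mem_coe] at h1 ⊢
    tauto
  unfold localExp
  congr 1
  calc _ = ∑ N ∈ G.agreeing Λ' m, ∑ N' ∈ G.agreeing Λ N,
        G.weightIn Λ' N * (G.weightIn Λ N' * F N') / G.partition Λ N := by
        refine Finset.sum_congr rfl fun N _ => ?_
        rw [← mul_div_assoc, Finset.mul_sum, Finset.sum_div]
    _ = ∑ N' ∈ G.agreeing Λ' m, ∑ N ∈ G.agreeing Λ N',
        G.weightIn Λ' N * (G.weightIn Λ N' * F N') / G.partition Λ N := by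
        refine Finset.sum_comm' fun N N' => ?_
        simp only [mem_agreeing]
        constructor
        · rintro ⟨h, h'⟩
          exact ⟨h'.symm, (hsub h').trans h⟩
        · rintro ⟨h, h'⟩
          exact ⟨(hsub h).trans h', h.symm⟩
    _ = _ := by
        refine Finset.sum_congr rfl fun N' _ => ?_
        calc _ = ∑ N ∈ G.agreeing Λ N', G.weightIn Λ N * (G.weightIn Λ' N' * F N'
              / G.partition Λ N') := by
              refine Finset.sum_congr rfl fun N hN => ?_
              rw [mem_agreeing] at hN
              have hp : G.partition Λ N = G.partition Λ N' := by
                unfold partition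
                rw [agreeing_congr hN]
              rw [hp]
              have := weightIn_mul_weightIn hΛ hN
              rw [← mul_div_assoc]
              congr 1
              linear_combination F N' * this
          _ = _ := by
              rw [← Finset.sum_mul]
              change G.partition Λ N' * _ = _
              field_simp [(partition_pos Λ N').ne']

/-- The configuration that is `N` on `Λ` and `M'` off `Λ`, where `N` can be obtained by a
modification on `Λ` of a configuration `M` that agrees with `M'` on `Λ`. -/
def graft (Λ : Finset (List ℂ)) (M M' N : G.Config) (hN : N.1 \ Λ = M.1 \ Λ)
    (h : ∀ e ∈ Λ, e ∈ M.1 ↔ e ∈ M'.1) : G.Config :=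
  ⟨(M'.1 \ Λ) ∪ (N.1 ∩ Λ), by
    have hN' : ∀ e, e ∉ Λ → (e ∈ N.1 ↔ e ∈ M.1) := fun e he => by
      have := Set.ext_iff.1 hN e
      simpa [he] using this
    constructor
    · rintro e (he | he)
      exacts [M'.2.1 he.1, N.2.1 he.1]
    · intro v hV
      obtain ⟨e', ⟨he', hv'⟩, hu'⟩ := M'.2.2 v hV
      obtain ⟨e, ⟨he, hv⟩, hu⟩ := M.2.2 v hV
      obtain ⟨n, ⟨hn, hvn⟩, hun⟩ := N.2.2 v hV
      -- The edge of M' at v lies in Λ exactly when that of M does, hence exactly when that of N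
      -- does; so one of the two parts covers v, and only once.
      by_cases hΛ : e' ∈ Λ
      · have hee : e' = e := hu e' ⟨(h e' hΛ).2 he', hv'⟩
        have hnΛ : n ∈ Λ := by
          by_contra hn'
          have : n = e := hu n ⟨(hN' n hn').1 hn, hvn⟩
          exact hn' (this.trans hee.symm ▸ hΛ)
        refine ⟨n, ⟨Or.inr ⟨hn, hnΛ⟩, hvn⟩, ?_⟩
        rintro x ⟨hx | hx, hvx⟩
        · exact absurd (hu' x ⟨hx.1, hvx⟩ ▸ hΛ) hx.2
        · exact hun x ⟨hx.1, hvx⟩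
      · refine ⟨e', ⟨Or.inl ⟨he', hΛ⟩, hv'⟩, ?_⟩
        rintro x ⟨hx | hx, hvx⟩
        · exact hu' x ⟨hx.1, hvx⟩
        · exfalso
          have hxn : x = n := hun x ⟨hx.1, hvx⟩
          by_cases heΛ : e ∈ Λ
          · exact hΛ (hu' e ⟨(h e heΛ).1 he, hv⟩ ▸ heΛ)
          · have : e = n := hun e ⟨(hN' e heΛ).2 he, hv⟩
            exact heΛ (this.trans hxn.symm ▸ hx.2)⟩

theorem mem_graft {Λ : Finset (List ℂ)} {M M' N : G.Config} {hN : N.1 \ Λ = M.1 \ Λ}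
    {h : ∀ e ∈ Λ, e ∈ M.1 ↔ e ∈ M'.1} {e : List ℂ} :
    e ∈ (graft Λ M M' N hN h).1 ↔ (e ∈ M'.1 ∧ e ∉ Λ) ∨ (e ∈ N.1 ∧ e ∈ Λ) := Iff.rfl

theorem graft_mem_agreeing {Λ : Finset (List ℂ)} {M M' N : G.Config} {hN : N.1 \ Λ = M.1 \ Λ}
    {h : ∀ e ∈ Λ, e ∈ M.1 ↔ e ∈ M'.1} : graft Λ M M' N hN h ∈ G.agreeing Λ M' := by
  rw [mem_agreeing]
  ext e
  rw [Set.mem_sdiff, Set.mem_sdiff, mem_graft, Finset.mem_coe]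
  tauto

theorem graft_graft {Λ : Finset (List ℂ)} {M M' N : G.Config} {hN : N.1 \ Λ = M.1 \ Λ}
    {h : ∀ e ∈ Λ, e ∈ M.1 ↔ e ∈ M'.1} {hN'} {h'} :
    graft Λ M' M (graft Λ M M' N hN h) hN' h' = N := by
  apply Subtype.ext
  ext e
  have := Set.ext_iff.1 hN e
  rw [Set.mem_sdiff, Set.mem_sdiff, Finset.mem_coe] at this
  rw [mem_graft, mem_graft]
  tauto

/-- `f` depends only on the intersection of a configuration with the finite set `K`. -/
def DependsOnlyOn (f : G.Config → ℝ) (K : Finset (List ℂ)) : Prop :=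
  ∀ M M' : G.Config, (∀ e ∈ K, e ∈ M.1 ↔ e ∈ M'.1) → f M = f M'

/-- Grafting matches the modifications of M with those of M' without changing weights on Λ or values
of f. Local expectations are thereby local functions themselves, which provides their measurability
and integrability. -/
theorem DependsOnlyOn.sum_agreeing {f : G.Config → ℝ} {K : Finset (List ℂ)}
    (hf : DependsOnlyOn f K) (Λ : Finset (List ℂ)) {M M' : G.Config}
    (hΛ : ∀ e ∈ Λ, e ∈ M.1 ↔ e ∈ M'.1) (hK : ∀ e ∈ K, e ∈ M.1 ↔ e ∈ M'.1) :
    ∑ N ∈ G.agreeing Λ M, G.weightIn Λ N * f N = ∑ N ∈ G.agreeing Λ M', G.weightIn Λ N * f N := by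
  have hΛ' : ∀ e ∈ Λ, e ∈ M'.1 ↔ e ∈ M.1 := fun e he => (hΛ e he).symm
  refine Finset.sum_bij' (fun N hN => graft Λ M M' N (mem_agreeing.1 hN) hΛ)
    (fun N hN => graft Λ M' M N (mem_agreeing.1 hN) hΛ') (fun N hN => graft_mem_agreeing)
    (fun N hN => graft_mem_agreeing) (fun N hN => graft_graft) (fun N hN => graft_graft) ?_
  intro N hN
  congr 1
  · refine weightIn_congr fun e he => ?_
    rw [mem_graft]
    tauto
  · refine hf _ _ fun e he => ?_
    have h1 := hK e he
    have h2 := Set.ext_iff.1 (mem_agreeing.1 hN) e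
    rw [Set.mem_sdiff, Set.mem_sdiff, Finset.mem_coe] at h2
    rw [mem_graft]
    tauto

theorem DependsOnlyOn.localExp [DecidableEq (List ℂ)] {f : G.Config → ℝ} {K : Finset (List ℂ)}
    (hf : DependsOnlyOn f K) (Λ : Finset (List ℂ)) :
    DependsOnlyOn (fun M => G.localExp Λ M f) (Λ ∪ K) := by
  intro M M' h
  have h1 : ∀ e ∈ Λ, e ∈ M.1 ↔ e ∈ M'.1 := fun e he => h e (Finset.mem_union_left _ he)
  have h2 : ∀ e ∈ K, e ∈ M.1 ↔ e ∈ M'.1 := fun e he => h e (Finset.mem_union_right _ he)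
  have hone : DependsOnlyOn (fun _ : G.Config => (1 : ℝ)) K := fun _ _ _ => rfl
  have hp := hone.sum_agreeing Λ h1 h2
  simp only [mul_one] at hp
  simp only [PlaneBipartiteGraph.localExp]
  rw [hf.sum_agreeing Λ h1 h2]
  congr 1

/-! ### Translations -/

theorem translate_translate_neg {τ : ℂ} (hτ : G.IsPeriod τ) (N : G.Config) :
    G.translate hτ (G.translate hτ.neg N) = N := by
  apply Subtype.ext
  change shiftEdge τ '' (shiftEdge (-τ) '' N.1) = N.1
  rw [← Set.image_comp]
  convert Set.image_id N.1 using 2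
  exact shiftEdge_shiftEdge_neg τ _

theorem translate_neg_translate {τ : ℂ} (hτ : G.IsPeriod τ) (N : G.Config) :
    G.translate hτ.neg (G.translate hτ N) = N := by
  apply Subtype.ext
  change shiftEdge (-τ) '' (shiftEdge τ '' N.1) = N.1
  rw [← Set.image_comp]
  convert Set.image_id N.1 using 2
  exact shiftEdge_neg_shiftEdge τ _

theorem mem_translate {τ : ℂ} (hτ : G.IsPeriod τ) (N : G.Config) (e : List ℂ) :
    e ∈ (G.translate hτ N).1 ↔ shiftEdge (-τ) e ∈ N.1 := by
  rw [← shiftEdge_mem_translate hτ N, shiftEdge_shiftEdge_neg]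

/-- The finite set `Λ` of edges translated by `τ`. -/
def shiftFinset (τ : ℂ) (Λ : Finset (List ℂ)) : Finset (List ℂ) :=
  Λ.map (shiftEquiv τ).toEmbedding

theorem mem_shiftFinset {τ : ℂ} {Λ : Finset (List ℂ)} {e : List ℂ} :
    e ∈ shiftFinset τ Λ ↔ shiftEdge (-τ) e ∈ Λ := by
  unfold shiftFinset
  rw [Finset.mem_map_equiv]
  rfl

theorem weightIn_translate {τ : ℂ} (hτ : G.IsPeriod τ) (Λ : Finset (List ℂ)) (N : G.Config) :
    G.weightIn (shiftFinset τ Λ) (G.translate hτ N) = G.weightIn Λ N := by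
  classical
  unfold weightIn shiftFinset
  rw [Finset.prod_map]
  refine Finset.prod_congr rfl fun e _ => ?_
  change (if shiftEdge τ e ∈ (G.translate hτ N).1 then G.weight (shiftEdge τ e) else 1) = _
  by_cases h : e ∈ N.1
  · rw [if_pos h, if_pos ((shiftEdge_mem_translate hτ N e).2 h), hτ.weight_eq e (N.2.1 h)]
  · rw [if_neg h, if_neg (mt (shiftEdge_mem_translate hτ N e).1 h)]

theorem translate_mem_agreeing {τ : ℂ} (hτ : G.IsPeriod τ) {Λ : Finset (List ℂ)}
    {M N : G.Config} : G.translate hτ N ∈ G.agreeing (shiftFinset τ Λ) (G.translate hτ M) ↔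
      N ∈ G.agreeing Λ M := by
  rw [mem_agreeing, mem_agreeing, Set.ext_iff, Set.ext_iff]
  simp only [Set.mem_sdiff, Finset.mem_coe, mem_shiftFinset, mem_translate]
  constructor
  · intro h e
    have := h (shiftEdge τ e)
    rwa [shiftEdge_neg_shiftEdge] at this
  · intro h e
    exact h _

theorem sum_agreeing_translate {τ : ℂ} (hτ : G.IsPeriod τ) (Λ : Finset (List ℂ)) (M : G.Config)
    (F : G.Config → ℝ) :
    ∑ N ∈ G.agreeing (shiftFinset τ Λ) (G.translate hτ M), G.weightIn (shiftFinset τ Λ) N * F N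
      = ∑ N ∈ G.agreeing Λ M, G.weightIn Λ N * F (G.translate hτ N) := by
  symm
  refine Finset.sum_nbij' (G.translate hτ) (G.translate hτ.neg)
    (fun N hN => (translate_mem_agreeing hτ).2 hN) (fun N hN => ?_)
    (fun N _ => translate_neg_translate hτ N) (fun N _ => translate_translate_neg hτ N)
    (fun N _ => by rw [weightIn_translate])
  rw [← translate_mem_agreeing hτ, translate_translate_neg]
  exact hN

theorem localExp_translate {τ : ℂ} (hτ : G.IsPeriod τ) (Λ : Finset (List ℂ)) (M : G.Config)
    (F : G.Config → ℝ) :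
    G.localExp (shiftFinset τ Λ) (G.translate hτ M) F
      = G.localExp Λ M (fun N => F (G.translate hτ N)) := by
  have h := sum_agreeing_translate hτ Λ M (fun _ => 1)
  simp only [mul_one] at h
  unfold localExp partition
  rw [sum_agreeing_translate, h]

theorem shiftFinset_shiftFinset_neg (τ : ℂ) (Λ : Finset (List ℂ)) :
    shiftFinset τ (shiftFinset (-τ) Λ) = Λ := by
  ext e
  rw [mem_shiftFinset, mem_shiftFinset, neg_neg, shiftEdge_shiftEdge_neg]

theorem DependsOnlyOn.translate {τ : ℂ} (hτ : G.IsPeriod τ) {f : G.Config → ℝ}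
    {K : Finset (List ℂ)} (hf : DependsOnlyOn f K) :
    DependsOnlyOn (fun N => f (G.translate hτ N)) (shiftFinset (-τ) K) := by
  intro M M' h
  refine hf _ _ fun e he => ?_
  rw [mem_translate, mem_translate]
  exact h _ (by rwa [mem_shiftFinset, neg_neg, shiftEdge_shiftEdge_neg])

/-! ### The local laws as measures -/

theorem innerWeight_eq (R : ℝ) (N : G.Config) :
    G.innerWeight R N = G.weightIn (G.innerFinset R) N := by
  classical
  unfold innerWeight weightIn
  rw [← Finset.prod_filter, ← finprod_mem_coe_finset]
  have : N.1 ∩ G.innerEdges R = ↑((G.innerFinset R).filter (fun e => e ∈ N.1)) := by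
    ext e
    rw [← coe_innerFinset, Finset.mem_coe, Finset.mem_filter, Set.mem_inter_iff, Finset.mem_coe,
      and_comm]
  rw [this]

theorem outside_eq_iff {R : ℝ} {N m : G.Config} :
    G.outside R N = G.outside R m ↔ N ∈ G.agreeing (G.innerFinset R) m := by
  rw [mem_agreeing, coe_innerFinset]
  rfl

theorem localWeightMeasure_apply (R : ℝ) (m : G.Config) {A : Set G.Config}
    (hA : MeasurableSet A) : G.localWeightMeasure R m A = ENNReal.ofReal
      (∑ N ∈ G.agreeing (G.innerFinset R) m,
        G.weightIn (G.innerFinset R) N * A.indicator (fun _ => 1) N) := by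
  classical
  have hfin : Finite {N : G.Config // G.outside R N = G.outside R m} := by
    have := finite_agreeing (G.innerFinset R) m
    refine (this.subset fun N hN => ?_).to_subtype
    exact mem_agreeing.1 (outside_eq_iff.1 hN)
  have := Fintype.ofFinite {N : G.Config // G.outside R N = G.outside R m}
  unfold localWeightMeasure
  rw [Measure.sum_apply _ hA, tsum_fintype, ENNReal.ofReal_sum_of_nonneg,
    Finset.sum_subtype (p := fun N => G.outside R N = G.outside R m) _
      (fun N => outside_eq_iff.symm)]
  · refine Finset.sum_congr rfl fun N _ => ?_
    rw [Measure.smul_apply, Measure.dirac_apply' _ hA, innerWeight_eq, smul_eq_mul]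
    by_cases h : N.1 ∈ A <;> simp [h]
  · intro N _
    exact mul_nonneg (weightIn_pos _ _).le (Set.indicator_nonneg (fun _ _ => zero_le_one) _)

/-- For sets not known to be measurable, such as `heightEvent`, only this inequality is available,
and it is the direction in which spread-out is used. -/
theorem le_localWeightMeasure_apply (R : ℝ) (m : G.Config) (A : Set G.Config) :
    ENNReal.ofReal (∑ N ∈ G.agreeing (G.innerFinset R) m,
        G.weightIn (G.innerFinset R) N * A.indicator (fun _ => 1) N)
      ≤ G.localWeightMeasure R m A := by
  classical
  have hfin : Finite {N : G.Config // G.outside R N = G.outside R m} := by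
    have := finite_agreeing (G.innerFinset R) m
    refine (this.subset fun N hN => ?_).to_subtype
    exact mem_agreeing.1 (outside_eq_iff.1 hN)
  have := Fintype.ofFinite {N : G.Config // G.outside R N = G.outside R m}
  unfold localWeightMeasure
  refine le_trans ?_ (Measure.le_sum_apply _ _)
  rw [tsum_fintype, ENNReal.ofReal_sum_of_nonneg,
    Finset.sum_subtype (p := fun N => G.outside R N = G.outside R m) _
      (fun N => outside_eq_iff.symm)]
  · refine Finset.sum_le_sum fun N _ => ?_
    rw [Measure.smul_apply, innerWeight_eq, smul_eq_mul]
    by_cases h : N.1 ∈ A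
    · rw [Measure.dirac_apply_of_mem h]
      simp [h]
    · simp [h]
  · intro N _
    exact mul_nonneg (weightIn_pos _ _).le (Set.indicator_nonneg (fun _ _ => zero_le_one) _)

theorem localWeightMeasure_univ (R : ℝ) (m : G.Config) :
    G.localWeightMeasure R m Set.univ = ENNReal.ofReal (G.partition (G.innerFinset R) m) := by
  rw [localWeightMeasure_apply R m MeasurableSet.univ]
  simp [partition]

theorem inv_mul_ofReal_sum (R : ℝ) (m : G.Config) (A : Set G.Config) :
    (ENNReal.ofReal (G.partition (G.innerFinset R) m))⁻¹ * ENNReal.ofReal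
      (∑ N ∈ G.agreeing (G.innerFinset R) m,
        G.weightIn (G.innerFinset R) N * A.indicator (fun _ => 1) N)
      = ENNReal.ofReal (G.localExp (G.innerFinset R) m (A.indicator fun _ => 1)) := by
  unfold localExp
  rw [ENNReal.ofReal_div_of_pos (partition_pos _ _), ENNReal.div_eq_inv_mul]

theorem localExp_indicator_nonneg (Λ : Finset (List ℂ)) (m : G.Config) (A : Set G.Config) :
    0 ≤ G.localExp Λ m (A.indicator fun _ => 1) := by
  rw [← localExp_const Λ m 0]
  exact localExp_mono fun N _ => Set.indicator_nonneg (fun _ _ => zero_le_one) _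

theorem localExp_indicator_le_one (Λ : Finset (List ℂ)) (m : G.Config) (A : Set G.Config) :
    G.localExp Λ m (A.indicator fun _ => 1) ≤ 1 := by
  refine (localExp_mono fun N _ => ?_).trans (localExp_const Λ m 1).le
  exact Set.indicator_le_self' (fun _ _ => zero_le_one) _

theorem localMeasure_real_apply (R : ℝ) (m : G.Config) {A : Set G.Config}
    (hA : MeasurableSet A) : (G.localMeasure R m).real A
      = G.localExp (G.innerFinset R) m (A.indicator fun _ => 1) := by
  unfold localMeasure
  rw [Measure.real, Measure.smul_apply, smul_eq_mul, localWeightMeasure_univ,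
    localWeightMeasure_apply R m hA, inv_mul_ofReal_sum,
    ENNReal.toReal_ofReal (localExp_indicator_nonneg _ _ _)]

theorem localExp_le_localMeasure_real (R : ℝ) (m : G.Config) (A : Set G.Config) :
    G.localExp (G.innerFinset R) m (A.indicator fun _ => 1) ≤ (G.localMeasure R m).real A := by
  have h1 : ENNReal.ofReal (G.localExp (G.innerFinset R) m (A.indicator fun _ => 1))
      ≤ G.localMeasure R m A := by
    unfold localMeasure
    rw [Measure.smul_apply, smul_eq_mul, localWeightMeasure_univ, ← inv_mul_ofReal_sum]
    gcongr
    exact le_localWeightMeasure_apply R m A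
  have hp : ENNReal.ofReal (G.partition (G.innerFinset R) m) ≠ 0 := by
    rw [Ne, ENNReal.ofReal_eq_zero, not_le]
    exact partition_pos _ _
  have h2 : G.localMeasure R m A ≠ ⊤ := by
    refine ne_top_of_le_ne_top ?_ (measure_mono (Set.subset_univ A))
    unfold localMeasure
    rw [Measure.smul_apply, smul_eq_mul, localWeightMeasure_univ,
      ENNReal.inv_mul_cancel hp ENNReal.ofReal_ne_top]
    exact ENNReal.one_ne_top
  rw [Measure.real, ← ENNReal.toReal_ofReal (localExp_indicator_nonneg _ _ _)]
  exact ENNReal.toReal_mono h2 h1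

/-! ### Local functions and the integrated Gibbs property -/

theorem measurable_mem_config (e : List ℂ) : Measurable fun M : G.Config => e ∈ M.1 :=
  (measurable_set_mem e).comp measurable_subtype_coe

/-- The intersection of a configuration with a finite set of edges. -/
def pattern (K : Finset (List ℂ)) (M : G.Config) : K → Prop := fun e => e.1 ∈ M.1

theorem measurable_pattern (K : Finset (List ℂ)) :
    Measurable (pattern K : G.Config → K → Prop) :=
  measurable_pi_iff.2 fun e => measurable_mem_config e.1

theorem DependsOnlyOn.exists_eq_comp_pattern {f : G.Config → ℝ} {K : Finset (List ℂ)}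
    (hf : DependsOnlyOn f K) : ∃ g : (K → Prop) → ℝ, ∀ M, f M = g (pattern K M) := by
  have h : Function.FactorsThrough f (pattern K : G.Config → K → Prop) := by
    intro M M' h
    exact hf M M' fun e he => iff_of_eq (congrFun h ⟨e, he⟩)
  exact ⟨Function.extend (pattern K) f 0, fun M => (h.extend_apply 0 M).symm⟩

theorem DependsOnlyOn.measurable {f : G.Config → ℝ} {K : Finset (List ℂ)}
    (hf : DependsOnlyOn f K) : Measurable f := by
  obtain ⟨g, hg⟩ := hf.exists_eq_comp_pattern
  rw [show f = g ∘ pattern K from funext hg]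
  exact (Measurable.of_discrete (f := g)).comp (measurable_pattern K)

theorem DependsOnlyOn.integrable {f : G.Config → ℝ} {K : Finset (List ℂ)}
    (hf : DependsOnlyOn f K) (μ : Measure G.Config) [IsFiniteMeasure μ] : Integrable f μ := by
  classical
  obtain ⟨g, hg⟩ := hf.exists_eq_comp_pattern
  refine Integrable.of_bound hf.measurable.aestronglyMeasurable (∑ c, |g c|)
    (Eventually.of_forall fun M => ?_)
  rw [Real.norm_eq_abs, hg]
  exact Finset.single_le_sum (f := fun c => |g c|) (fun _ _ => abs_nonneg _) (Finset.mem_univ _)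

theorem outsideSigma_le (R : ℝ) : G.outsideSigma R ≤ (inferInstance : MeasurableSpace G.Config) := by
  rw [← measurable_iff_comap_le]
  refine measurable_set_iff.2 fun e => ?_
  change Measurable fun M : G.Config => e ∈ M.1 ∧ e ∉ G.innerEdges R
  exact (measurable_mem_config e).and measurable_const

theorem IsGibbs.integral_localExp_indicator {μ : Measure G.Config} [IsProbabilityMeasure μ]
    (hμ : G.IsGibbs μ) {R : ℝ} (hR : 0 < R) {A : Set G.Config} (hA : MeasurableSet A) :
    ∫ M, G.localExp (G.innerFinset R) M (A.indicator fun _ => 1) ∂μ = μ.real A := by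
  have h := integral_congr_ae (hμ R hR A hA)
  simp only [localMeasure_real_apply R _ hA] at h
  rw [← h, integral_condExp (outsideSigma_le R), integral_indicator_const _ hA]
  simp

/-- A local function takes one value for each of the finitely many patterns on K, so the statement
reduces by linearity to pattern events. -/
theorem IsGibbs.integral_localExp_inner {μ : Measure G.Config} [IsProbabilityMeasure μ]
    (hμ : G.IsGibbs μ) {R : ℝ} (hR : 0 < R) {f : G.Config → ℝ} {K : Finset (List ℂ)}
    (hf : DependsOnlyOn f K) :
    ∫ M, G.localExp (G.innerFinset R) M f ∂μ = ∫ M, f M ∂μ := by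
  classical
  obtain ⟨g, hg⟩ := hf.exists_eq_comp_pattern
  set A : (K → Prop) → Set G.Config := fun c => pattern K ⁻¹' {c} with hAdef
  have hA : ∀ c, MeasurableSet (A c) := fun c =>
    measurable_pattern K (MeasurableSet.of_discrete (s := {c}))
  have hdep : ∀ c, DependsOnlyOn ((A c).indicator fun _ => (1 : ℝ)) K := by
    intro c M M' h
    have hp : pattern K M = pattern K M' := funext fun e => propext (h e.1 e.2)
    simp only [Set.indicator, hAdef, Set.mem_preimage, hp]
  have hsum : f = fun M => ∑ c, g c * (A c).indicator (fun _ => (1 : ℝ)) M := by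
    funext M
    rw [hg, Finset.sum_eq_single (pattern K M)]
    · simp [hAdef]
    · intro c _ hc
      rw [Set.indicator_of_notMem, mul_zero]
      exact fun h => hc (Set.mem_singleton_iff.1 h).symm
    · simp
  have hexp : ∀ M, G.localExp (G.innerFinset R) M f
      = ∑ c, g c * G.localExp (G.innerFinset R) M ((A c).indicator fun _ => 1) := by
    intro M
    conv_lhs => rw [hsum]
    rw [localExp_sum]
    simp only [localExp_const_mul]
  simp only [hexp]
  rw [integral_finsetSum _ fun c _ => (((hdep c).localExp _).integrable μ).const_mul _]
  conv_rhs => rw [hsum]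
  rw [integral_finsetSum _ fun c _ => ((hdep c).integrable μ).const_mul _]
  refine Finset.sum_congr rfl fun c _ => ?_
  rw [integral_const_mul, integral_const_mul, hμ.integral_localExp_indicator hR (hA c),
    integral_indicator_const _ (hA c)]
  simp

theorem exists_subset_innerFinset {Λ : Finset (List ℂ)} (hΛ : ↑Λ ⊆ G.edges) :
    ∃ R : ℝ, 0 < R ∧ Λ ⊆ G.innerFinset R := by
  have hb : Bornology.IsBounded (⋃ e ∈ Λ, polyCarrier e) := by
    rw [Bornology.isBounded_biUnion_finset]
    intro e _
    have : polyCarrier e = ⋃ s ∈ (segmentList e).toFinset, segment ℝ s.1 s.2 := by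
      ext z
      simp [mem_polyCarrier]
    rw [this, Bornology.isBounded_biUnion_finset]
    exact fun s _ => (isCompact_segment_complex s.1 s.2).isBounded
  obtain ⟨R, hR, h⟩ := hb.subset_ball_lt 0 0
  refine ⟨R, hR, fun e he => ?_⟩
  rw [← Finset.mem_coe, coe_innerFinset]
  exact ⟨hΛ he, (Set.subset_biUnion_of_mem (u := fun e => polyCarrier e) he).trans h⟩

/-- The Gibbs property for arbitrary finite sets of edges. -/
theorem IsGibbs.integral_localExp {μ : Measure G.Config} [IsProbabilityMeasure μ]
    (hμ : G.IsGibbs μ) {Λ : Finset (List ℂ)} (hΛ : ↑Λ ⊆ G.edges) {f : G.Config → ℝ}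
    {K : Finset (List ℂ)} (hf : DependsOnlyOn f K) :
    ∫ M, G.localExp Λ M f ∂μ = ∫ M, f M ∂μ := by
  classical
  obtain ⟨R, hR, hsub⟩ := exists_subset_innerFinset hΛ
  -- The Gibbs property is assumed only for balls; Λ sits in one, and resampling Λ within the law of
  -- the ball changes nothing.
  rw [← hμ.integral_localExp_inner hR (hf.localExp Λ)]
  simp only [localExp_localExp hsub]
  exact hμ.integral_localExp_inner hR hf

/-! ### Invariance -/

theorem exists_mem_Ioo_of_abs_sub_le {K h k : ℝ} (hh : |h - k| ≤ K) :
    ∃ j ∈ Finset.range (⌈4 * K⌉₊ + 2),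
      h ∈ Set.Ioo (k - K - 1 + j / 2) (k - K - 1 + j / 2 + 1) := by
  obtain ⟨h1, h2⟩ := abs_le.1 hh
  set y := h - k + K with hy
  have hy0 : 0 ≤ 2 * y := by linarith
  -- The unit intervals are open, so they are spaced by 1/2 in order to cover the common endpoints
  -- too.
  refine ⟨⌊2 * y⌋₊ + 1, ?_, ?_⟩
  · rw [Finset.mem_range]
    have : ⌊2 * y⌋₊ ≤ ⌈4 * K⌉₊ := by
      apply Nat.cast_le (α := ℝ).1
      calc (⌊2 * y⌋₊ : ℝ) ≤ 2 * y := Nat.floor_le hy0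
        _ ≤ 4 * K := by linarith
        _ ≤ _ := Nat.le_ceil _
    omega
  · have f1 := Nat.floor_le hy0
    have f2 := Nat.lt_floor_add_one (2 * y)
    push_cast
    constructor <;> linarith

/-- Either the exchange reproduces N₂ on S, or a component escapes and the heights at 0 are within
K. Given N₂, the latter restricts the height of N₁ to a window of length 2K, covered by finitely
many unit intervals of probability at most ε each. -/
theorem abs_localExp_sub_translate_le {τ : ℂ} (hτ : G.IsPeriod τ) {A : Set G.Config}
    {S : Finset (List ℂ)} (hA : DependsOnlyOn (A.indicator fun _ => (1 : ℝ)) S) {K : ℝ}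
    {R : ℝ} {m : G.Config} {ε : ℝ}
    (hK : ∀ N₁ N₂ : G.Config, N₁ ∈ G.agreeing (G.innerFinset R) m →
      N₂ ∈ G.agreeing (G.innerFinset R) (G.translate hτ m) →
      (∃ e ∈ S, e ∈ symmDiff N₁.1 N₂.1 ∧
        e ∉ G.enclosedPart (G.innerFinset R) (symmDiff N₁.1 N₂.1)) →
      |G.localHeight (G.innerFinset R) m N₁ 0
        - G.localHeight (G.innerFinset R) (G.translate hτ m) N₂ 0| ≤ K)
    (hm : ∀ x : ℝ, (G.localMeasure R m).real (G.heightEvent R m x) ≤ ε) :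
    |G.localExp (G.innerFinset R) m (A.indicator fun _ => 1)
      - G.localExp (G.innerFinset R) (G.translate hτ m) (A.indicator fun _ => 1)|
      ≤ (⌈4 * K⌉₊ + 2 : ℕ) * ε := by
  classical
  set Λ := G.innerFinset R with hΛ
  set m' := G.translate hτ m with hm'
  refine abs_localExp_sub_le (B := fun N₁ N₂ =>
    if |G.localHeight Λ m N₁ 0 - G.localHeight Λ m' N₂ 0| ≤ K then 1 else 0) ?_ ?_
  · intro N₁ h₁ N₂ h₂
    by_cases hbad : ∃ e ∈ S, e ∈ symmDiff N₁.1 N₂.1 ∧ e ∉ G.enclosedPart Λ (symmDiff N₁.1 N₂.1)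
    · rw [if_pos (hK N₁ N₂ h₁ h₂ hbad)]
      simp only [Set.indicator]
      split_ifs <;> norm_num
    · push Not at hbad
      rw [hA _ N₂ fun e he => mem_swapInside_iff_of_enclosed (hbad e he), sub_self, abs_zero]
      split_ifs <;> norm_num
  · intro N₂ _
    set k := G.localHeight Λ m' N₂ 0 with hk
    calc G.localExp Λ m (fun N₁ => if |G.localHeight Λ m N₁ 0 - k| ≤ K then 1 else 0)
        ≤ G.localExp Λ m (fun N₁ => ∑ j ∈ Finset.range (⌈4 * K⌉₊ + 2),
            (G.heightEvent R m (k - K - 1 + (j : ℝ) / 2)).indicator (fun _ => 1) N₁) := by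
          refine localExp_mono fun N₁ h₁ => ?_
          have hnn : ∀ j ∈ Finset.range (⌈4 * K⌉₊ + 2), (0 : ℝ) ≤
              (G.heightEvent R m (k - K - 1 + (j : ℝ) / 2)).indicator (fun _ => 1) N₁ :=
            fun j _ => Set.indicator_nonneg (fun _ _ => zero_le_one) _
          split_ifs with h
          · obtain ⟨j, hj, hx⟩ := exists_mem_Ioo_of_abs_sub_le h
            have hmem := mem_heightEvent (mem_agreeing.1 h₁) hx
            refine le_trans ?_ (Finset.single_le_sum hnn hj)
            rw [Set.indicator_of_mem hmem]
          · exact Finset.sum_nonneg hnn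
      _ = ∑ j ∈ Finset.range (⌈4 * K⌉₊ + 2), G.localExp Λ m
            ((G.heightEvent R m (k - K - 1 + (j : ℝ) / 2)).indicator fun _ => 1) :=
          localExp_sum _ _
      _ ≤ ∑ j ∈ Finset.range (⌈4 * K⌉₊ + 2), ε :=
          Finset.sum_le_sum fun j _ => (localExp_le_localMeasure_real R m _).trans (hm _)
      _ = _ := by rw [Finset.sum_const, Finset.card_range, nsmul_eq_mul]

theorem measurable_translate {τ : ℂ} (hτ : G.IsPeriod τ) : Measurable (G.translate hτ) := by
  refine Measurable.subtype_mk (measurable_set_iff.2 fun e => ?_)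
  have : (fun M : G.Config => e ∈ shiftEdge τ '' M.1) = fun M => shiftEdge (-τ) e ∈ M.1 :=
    funext fun M => propext (mem_translate hτ M e)
  rw [this]
  exact measurable_mem_config _

theorem measurableSet_setOf_subset (S : Finset (List ℂ)) :
    MeasurableSet {M : G.Config | ∀ e ∈ S, e ∈ M.1} := by
  have : {M : G.Config | ∀ e ∈ S, e ∈ M.1} = ⋂ e ∈ S, {M : G.Config | e ∈ M.1} := by
    ext M
    simp
  rw [this]
  exact S.measurableSet_biInter fun e _ => measurableSet_setOfPred.2 (measurable_mem_config e)

theorem measure_preimage_translate_eq (hper : G.IsBiperiodic) {μ : Measure G.Config}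
    [IsProbabilityMeasure μ] (hμ : G.IsGibbs μ) (hspread : G.IsSpreadOut μ) {τ : ℂ}
    (hτ : G.IsPeriod τ) (S : Finset (List ℂ)) :
    μ.real (G.translate hτ ⁻¹' {M : G.Config | ∀ e ∈ S, e ∈ M.1})
      = μ.real {M : G.Config | ∀ e ∈ S, e ∈ M.1} := by
  classical
  set A := {M : G.Config | ∀ e ∈ S, e ∈ M.1} with hAdef
  have hAm : MeasurableSet A := measurableSet_setOf_subset S
  set f : G.Config → ℝ := A.indicator fun _ => 1 with hf
  have hdep : DependsOnlyOn f S := by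
    intro M M' h
    have : M ∈ A ↔ M' ∈ A := forall₂_congr h
    by_cases hM : M ∈ A
    · rw [hf, Set.indicator_of_mem hM, Set.indicator_of_mem (this.1 hM)]
    · rw [hf, Set.indicator_of_notMem hM, Set.indicator_of_notMem (mt this.2 hM)]
  -- K, and thus the number of intervals, is chosen before ε and R; this allows ε to tend to 0 at
  -- the end.
  obtain ⟨K, hK⟩ := hper.exists_localHeight_sub_le hτ S
  set n : ℝ := ((⌈4 * K⌉₊ + 2 : ℕ) : ℝ) with hn
  have hn0 : 0 ≤ n := Nat.cast_nonneg _
  have key : ∀ ε : ℝ, 0 < ε → |μ.real A - μ.real (G.translate hτ ⁻¹' A)| ≤ (n + 1) * ε := by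
    intro ε hε
    obtain ⟨R, hR, hgood⟩ := hspread ε hε
    set Λ := G.innerFinset R with hΛ
    have hΛe : ↑Λ ⊆ G.edges := innerFinset_subset R
    set Λ' := shiftFinset (-τ) Λ with hΛ'
    have hΛ'e : ↑Λ' ⊆ G.edges := by
      intro e he
      rw [Finset.mem_coe, hΛ', mem_shiftFinset, neg_neg] at he
      exact (hτ.edge_iff e).1 (hΛe he)
    set φ₁ : G.Config → ℝ := fun M => G.localExp Λ M f with hφ₁
    set φ₂ : G.Config → ℝ := fun M => G.localExp Λ (G.translate hτ M) f with hφ₂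
    -- The law on Λ with translated boundary condition is the translate of the law on the shifted
    -- set Λ', which is in general not the edge set of a ball about 0.
    have hφ₂' : φ₂ = fun M => G.localExp Λ' M (fun N => f (G.translate hτ N)) := by
      funext M
      rw [← localExp_translate, hΛ', shiftFinset_shiftFinset_neg]
    have d₁ := hdep.localExp Λ
    have d₂ : DependsOnlyOn φ₂ (Λ' ∪ shiftFinset (-τ) S) := by
      rw [hφ₂']
      exact (hdep.translate hτ).localExp Λ'
    have i₁ : ∫ M, φ₁ M ∂μ = μ.real A := by
      rw [hμ.integral_localExp hΛe hdep, hf, integral_indicator_const _ hAm]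
      simp
    have i₂ : ∫ M, φ₂ M ∂μ = μ.real (G.translate hτ ⁻¹' A) := by
      rw [hφ₂', hμ.integral_localExp hΛ'e (hdep.translate hτ)]
      have : (fun N => f (G.translate hτ N))
          = (G.translate hτ ⁻¹' A).indicator fun _ => (1 : ℝ) := rfl
      rw [this, integral_indicator_const _ (measurable_translate hτ hAm)]
      simp
    set g : G.Config → ℝ := fun M => |φ₁ M - φ₂ M| with hg
    have hgm : Measurable g := (d₁.measurable.sub d₂.measurable).abs
    set B : Set G.Config := {M | n * ε < g M} with hB
    have hBm : MeasurableSet B := measurableSet_lt measurable_const hgm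
    have hBμ : μ.real B ≤ ε := by
      -- The spread-out event is only compared with the measurable set Bᶜ containing it, so its own
      -- measurability plays no role.
      have hsub : {M | ∀ x : ℝ, (G.localMeasure R M).real (G.heightEvent R M x) ≤ ε} ⊆ Bᶜ := by
        intro M hM hMB
        exact absurd (abs_localExp_sub_translate_le hτ hdep (hK R M) hM) (not_le.2 hMB)
      have h1 := measureReal_mono (μ := μ) hsub
      rw [probReal_compl_eq_one_sub hBm] at h1
      linarith
    have hgle : ∀ M, g M ≤ n * ε + B.indicator (fun _ => 1) M := by
      intro M
      by_cases h : M ∈ B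
      · rw [Set.indicator_of_mem h]
        have h1 := localExp_indicator_nonneg Λ M A
        have h2 := localExp_indicator_le_one Λ M A
        have h3 := localExp_indicator_nonneg Λ (G.translate hτ M) A
        have h4 := localExp_indicator_le_one Λ (G.translate hτ M) A
        have : g M ≤ 1 := abs_le.2 ⟨by linarith, by linarith⟩
        have : 0 ≤ n * ε := by positivity
        linarith
      · rw [Set.indicator_of_notMem h, add_zero]
        exact not_lt.1 h
    have hint := (d₁.integrable μ).sub (d₂.integrable μ)
    calc |μ.real A - μ.real (G.translate hτ ⁻¹' A)| = |∫ M, (φ₁ M - φ₂ M) ∂μ| := by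
          rw [integral_sub (d₁.integrable μ) (d₂.integrable μ), i₁, i₂]
      _ ≤ ∫ M, g M ∂μ := abs_integral_le_integral_abs
      _ ≤ ∫ M, (n * ε + B.indicator (fun _ => 1) M) ∂μ :=
          integral_mono hint.abs ((integrable_const _).add
            ((integrable_const (1 : ℝ)).indicator hBm)) hgle
      _ = n * ε + μ.real B := by
          rw [integral_add (integrable_const _) ((integrable_const (1 : ℝ)).indicator hBm),
            integral_indicator_const _ hBm]
          simp
      _ ≤ (n + 1) * ε := by linarith
  by_contra hne
  have hpos : 0 < |μ.real A - μ.real (G.translate hτ ⁻¹' A)| :=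
    abs_pos.2 (sub_ne_zero.2 (Ne.symm hne))
  -- This ε makes the bound half of the difference itself, so a nonzero difference is impossible.
  have := key (|μ.real A - μ.real (G.translate hτ ⁻¹' A)| / (2 * (n + 1))) (by positivity)
  have e : (n + 1) * (|μ.real A - μ.real (G.translate hτ ⁻¹' A)| / (2 * (n + 1)))
      = |μ.real A - μ.real (G.translate hτ ⁻¹' A)| / 2 := by field_simp
  linarith

theorem generateFrom_setOf_subset :
    (inferInstance : MeasurableSpace G.Config) = MeasurableSpace.generateFrom
      (Set.range fun S : Finset (List ℂ) => {M : G.Config | ∀ e ∈ S, e ∈ M.1}) := by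
  apply le_antisymm
  · have h : @Measurable _ _ (MeasurableSpace.generateFrom
        (Set.range fun S : Finset (List ℂ) => {M : G.Config | ∀ e ∈ S, e ∈ M.1})) _
        (Subtype.val : G.Config → Set (List ℂ)) := by
      refine (@measurable_set_iff _ _ (_) _).2 fun e => ?_
      refine (@measurableSet_setOfPred _ (_) _).1 (MeasurableSpace.measurableSet_generateFrom ?_)
      exact ⟨{e}, by simp⟩
    exact measurable_iff_comap_le.1 h
  · refine MeasurableSpace.generateFrom_le ?_
    rintro _ ⟨S, rfl⟩
    exact measurableSet_setOf_subset S

theorem isPiSystem_setOf_subset :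
    IsPiSystem (Set.range fun S : Finset (List ℂ) => {M : G.Config | ∀ e ∈ S, e ∈ M.1}) := by
  classical
  rintro _ ⟨S, rfl⟩ _ ⟨S', rfl⟩ -
  refine ⟨S ∪ S', ?_⟩
  ext M
  simp only [Finset.mem_union, Set.mem_inter_iff, Set.mem_ofPred_eq, or_imp, forall_and]

end PlaneBipartiteGraph

/-! ### Conclusion from the π-system of cylinder events -/

theorem mainTheorem6 (G : PlaneBipartiteGraph) (hper : G.IsBiperiodic)
    (h0 : (0 : ℂ) ∉ G.carrier) (μ : Measure G.Config) [IsProbabilityMeasure μ]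
    (hGibbs : G.IsGibbs μ) (hspread : G.IsSpreadOut μ) :
    G.IsTranslationInvariant μ := by
  intro τ hτ
  have hmeas := PlaneBipartiteGraph.measurable_translate hτ
  refine ⟨hmeas, ?_⟩
  have := Measure.isProbabilityMeasure_map (μ := μ) hmeas.aemeasurable
  refine ext_of_generate_finite _ PlaneBipartiteGraph.generateFrom_setOf_subset
    PlaneBipartiteGraph.isPiSystem_setOf_subset ?_ (by simp)
  rintro _ ⟨S, rfl⟩
  rw [Measure.map_apply hmeas (PlaneBipartiteGraph.measurableSet_setOf_subset S)]
  exact (measureReal_eq_measureReal_iff).1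
    (PlaneBipartiteGraph.measure_preimage_translate_eq hper hGibbs hspread hτ S)
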